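/- Let $D_0>0$, $L>0$, $K_0\in\mathbb R$. Put $\kappa=\frac{K_0}{2D_0}$, $\omega(\lambda)=D_0\lambda^2+iK_0\lambda$, $\nu=\nu(\lambda)=-\lambda-i\frac{K_0}{D_0}$, $$F_\gamma(\lambda,y)=(\gamma\kappa-1)\sin\big(y(\lambda+i\kappa)\big)-\gamma(\lambda+i\kappa)\cos\big(y(\lambda+i\kappa)\big),\qquad G(\lambda,y)=\kappa\sin\big(y(\lambda+i\kappa)\big)-(\lambda+i\kappa)\cos\big(y(\lambda+i\kappa)\big),$$ $$\Delta(\lambda)=e^{-i\lambda L}(1-i\alpha\lambda)(1-i\beta\nu)-e^{-i\nu L}(1-i\alpha\nu)(1-i\beta\lambda),\quad \Delta_\alpha(\lambda)=e^{-i\lambda L}(1-i\alpha\lambda)-e^{-i\nu L}(1-i\alpha\nu),\quad \Delta_0(\lambda)=e^{-i\lambda L}-e^{-i\nu L},$$ and $\hat\theta_0(\lambda)=\int_0^Le^{-i\lambda x}\theta_0(x)\,dx$, $\tilde f(\lambda,t)=\int_0^te^{\lambda\tau}f(\tau)\,d\tau$. **Solutions.** A sufficiently smooth solution of $\theta_t+K_0\theta_x=D_0\theta_{xx}$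 ($0<x<L$, $t>0$) with initial value $\theta_0\in L^1(0,L)$ is a real function $\theta$ such that $\theta,\theta_x$ are continuous on $[0,L]\times(0,\infty)$, $\theta_{xx}$ and $\theta_t$ exist and $\theta_t$ is continuous on $(0,L)\times(0,\infty)$, the equation holds there, $\theta(x,0)=\theta_0(x)$ for $0<x<L$, and $\int_0^L|\theta(x,t)-\theta_0(x)|\,dx\to0$ as $t\to0^+$. Boundary data are real functions on $(0,\infty)$ integrable on $(0,T)$ for every $T>0$. **Contours.** Let $D_+=\{\operatorname{Re}\omega(\lambda)<0,\ \operatorname{Im}\lambda>0\}$. A contour is a $C^1$ curve $\Gamma:\mathbb R\to\{\operatorname{Im}\lambda\ge0\}$ with bounded (possibly vanishing) derivative, running from left to right, each end of which is asymptotic to a straight line that goes to infinity in the open upper half plane, is neither vertical nor horizontal, and eventually lies outside $D_+$. It is favourable for an entire function $E$ if it passes above every zero $z$ of $E$: $\Gamma$ avoids $z$, and some continuous choice of $\arg(\Gamma(s)-z)$ lies in $(0,\pi)$ for all $s$ with $|s|$ large. For all real $\alpha,\beta$ there is a contour favourable for $\Delta$; if $\Delta$ has no zero in $\overline{D_+}$,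 then the boundary curve $\partial D_+$, i.e. $\lambda=s+i\big(\sqrt{s^2+\kappa^2}-\kappa\big)$, $s\in\mathbb R$, is one. **Robin–Robin.** Let $\alpha,\beta\in\mathbb R$, and let $\theta$ be a sufficiently smooth solution with $\theta(0,t)-\alpha\theta_x(0,t)=f(t)$ and $\theta(L,t)-\beta\theta_x(L,t)=g(t)$ for $t>0$, where $f,g$ are boundary data. Then for every contour $\Gamma$ favourable for $\Delta$ and all $0<x<L$, $t>0$, with absolutely convergent integrals, $$\theta(x,t)=\frac1{2\pi}\int_{\mathbb R}e^{i\lambda x-\omega(\lambda)t}\hat\theta_0(\lambda)\,d\lambda-\frac i\pi e^{-\kappa(L-x)}\int_\Gamma\frac{e^{-\omega(\lambda)t}}{\Delta(\lambda)}\Big[F_\alpha(\lambda,x)(1-i\beta\lambda)e^{iL(\lambda+i\kappa)}\hat\theta_0(\lambda)-F_\beta(\lambda,x-L)(1-i\alpha\nu)\hat\theta_0(\nu)$$ $$\qquad+(K_0-2i\lambda D_0)\big(F_\beta(\lambda,x-L)\tilde f(\omega(\lambda),t)-F_\alpha(\lambda,x)e^{-\kappa L}\tilde g(\omega(\lambda),t)\big)\Big]d\lambda.$$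 **Robin–Dirichlet** ($\theta(0,t)-\alpha\theta_x(0,t)=f(t)$, $\theta(L,t)=g(t)$). Setting $\beta=0$ turns the integrand into the one below, and for every $\Gamma$ favourable for $\Delta_\alpha$ the solution is, again with absolutely convergent integrals, $$\theta(x,t)=\frac1{2\pi}\int_{\mathbb R}e^{i\lambda x-\omega t}\hat\theta_0\,d\lambda-\frac i\pi e^{-\kappa(L-x)}\int_\Gamma\frac{e^{-\omega t}}{\Delta_\alpha}\Big\{F_\alpha(\lambda,x)e^{iL(\lambda+i\kappa)}\hat\theta_0(\lambda)-(1-i\alpha\nu)\sin\big((L-x)(\lambda+i\kappa)\big)\hat\theta_0(\nu)$$ $$\qquad+(K_0-2i\lambda D_0)\big[\sin\big((L-x)(\lambda+i\kappa)\big)\tilde f(\omega,t)-F_\alpha(\lambda,x)e^{-\kappa L}\tilde g(\omega,t)\big]\Big\}d\lambda.$$ **Dirichlet–Dirichlet** ($\theta(0,t)=f(t)$, $\theta(L,t)=g(t)$). Setting $\alpha=\beta=0$ turns the Robin–Robin integrand into the one below, and for every $\Gamma$ favourable for $\Delta_0$, with absolutely convergent integrals, $$\theta(x,t)=\frac1{2\pi}\int_{\mathbb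 R}e^{i\lambda x-\omega t}\hat\theta_0\,d\lambda-\frac i\pi e^{-\kappa(L-x)}\int_\Gamma\frac{e^{-\omega t}}{\Delta_0}\Big\{-\sin\big(x(\lambda+i\kappa)\big)e^{iL(\lambda+i\kappa)}\hat\theta_0(\lambda)-\sin\big((L-x)(\lambda+i\kappa)\big)\hat\theta_0(\nu)$$ $$\qquad+(K_0-2i\lambda D_0)\big[\sin\big((L-x)(\lambda+i\kappa)\big)\tilde f(\omega,t)+\sin\big(x(\lambda+i\kappa)\big)e^{-\kappa L}\tilde g(\omega,t)\big]\Big\}d\lambda.$$ **Neumann–Neumann** ($\theta_x(0,t)=f_N(t)$, $\theta_x(L,t)=g_N(t)$). Contours favourable for $\lambda\nu\Delta_0$ exist, and for every such $\Gamma$ the solution is, with absolutely convergent integrals, $$\theta(x,t)=\frac1{2\pi}\int_{\mathbb R}e^{i\lambda x-\omega t}\hat\theta_0\,d\lambda+\frac1\pi e^{-\kappa(L-x)}\int_\Gamma\frac{e^{-\omega t}}{\Delta_0}\frac1{\lambda\nu}\Big\{\lambda G(\lambda,x)e^{iL(\lambda+i\kappa)}\hat\theta_0(\lambda)-\nu G(\lambda,x-L)\hat\theta_0(\nu)$$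 $$\qquad-i(K_0-2i\lambda D_0)\big[G(\lambda,x-L)\tilde f_N(\omega,t)-G(\lambda,x)e^{-\kappa L}\tilde g_N(\omega,t)\big]\Big\}d\lambda.$$ Moreover, for such $\Gamma$, $\theta_0\in L^1(0,L)$ and boundary data $f_N,g_N$: $\Gamma$ is favourable for $\Delta$ with $\alpha=\beta$ for all sufficiently large $\alpha$, and the right-hand side of the Robin–Robin formula with $\beta=\alpha$, $f=-\alpha f_N$, $g=-\alpha g_N$ converges, as $\alpha\to+\infty$, to the right-hand side of the Neumann–Neumann formula, for all $0<x<L$ and $t>0$. -/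

import Mathlib

open MeasureTheory Filter Topology Set

namespace AdvectionDiffusion

noncomputable section

/-! ### Sufficiently smooth solutions -/

/-- The spatial derivative `θ_x(x,t)`, one-sided at the endpoints of `[0,L]`. -/
def dx (L : ℝ) (θ : ℝ → ℝ → ℝ) (x t : ℝ) : ℝ :=
  derivWithin (fun y => θ y t) (Icc 0 L) x

/-- The time derivative `θ_t(x,t)`. -/
def dt (θ : ℝ → ℝ → ℝ) (x t : ℝ) : ℝ := deriv (fun s => θ x s) t

/-- The second spatial derivative `θ_xx(x,t)`, used for `0 < x < L`. -/
def dxx (L : ℝ) (θ : ℝ → ℝ → ℝ) (x t : ℝ) : ℝ := deriv (fun y => dx L θ y t) x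

/-- `θ` is a sufficiently smooth solution of `θ_t + K₀ θ_x = D₀ θ_xx` on `0 < x < L`, `t > 0`,
with integrable initial value `θ₀`: `θ` and `θ_x` are continuous on `[0,L] × (0,∞)`, `θ_t` (hence
also `θ_xx`) is continuous on `(0,L) × (0,∞)`, and the initial value is attained in the mean. -/
structure IsSolution (K₀ D₀ L : ℝ) (θ₀ : ℝ → ℝ) (θ : ℝ → ℝ → ℝ) : Prop where
  differentiable_x : ∀ t, 0 < t → DifferentiableOn ℝ (fun y => θ y t) (Icc 0 L)
  differentiable_xx : ∀ t, 0 < t → DifferentiableOn ℝ (fun y => dx L θ y t) (Ioo 0 L)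
  differentiable_t : ∀ x ∈ Ioo 0 L, DifferentiableOn ℝ (fun s => θ x s) (Ioi 0)
  continuous_theta : ContinuousOn (fun p : ℝ × ℝ => θ p.1 p.2) (Icc 0 L ×ˢ Ioi 0)
  continuous_dx : ContinuousOn (fun p : ℝ × ℝ => dx L θ p.1 p.2) (Icc 0 L ×ˢ Ioi 0)
  continuous_dt : ContinuousOn (fun p : ℝ × ℝ => dt θ p.1 p.2) (Ioo 0 L ×ˢ Ioi 0)
  pde : ∀ x ∈ Ioo 0 L, ∀ t, 0 < t → dt θ x t + K₀ * dx L θ x t = D₀ * dxx L θ x t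
  integrable_initial : IntegrableOn θ₀ (Ioo 0 L)
  initial : ∀ x ∈ Ioo 0 L, θ x 0 = θ₀ x
  initial_mean : Tendsto (fun t => ∫ x in Ioo 0 L, |θ x t - θ₀ x|) (𝓝[>] 0) (𝓝 0)

/-- Boundary data that are integrable on every bounded time interval `(0,T)`. -/
def IsBoundaryData (f : ℝ → ℝ) : Prop := ∀ T, 0 < T → IntegrableOn f (Ioo 0 T)

/-! ### Symbols and transforms; `k` is the spectral variable -/

/-- `ω(k) = D₀ k² + i K₀ k`. -/
def omega (K₀ D₀ : ℝ) (k : ℂ) : ℂ := D₀ * k ^ 2 + Complex.I * K₀ * k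

/-- `ν(k) = -k - i K₀ / D₀`. -/
def nu (K₀ D₀ : ℝ) (k : ℂ) : ℂ := -k - Complex.I * (K₀ / D₀)

/-- `k + i K₀ / (2 D₀)`. -/
def shift (K₀ D₀ : ℝ) (k : ℂ) : ℂ := k + Complex.I * (K₀ / (2 * D₀))

/-- The finite Fourier transform `∫_0^L e^{-ikx} θ₀(x) dx`. -/
def hat (L : ℝ) (θ₀ : ℝ → ℝ) (k : ℂ) : ℂ :=
  ∫ x in Ioo 0 L, Complex.exp (-Complex.I * k * (x : ℂ)) * (θ₀ x : ℂ)

/-- The `t`-transform `∫_0^t e^{kτ} f(τ) dτ`. -/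
def tilde (f : ℝ → ℝ) (k : ℂ) (t : ℝ) : ℂ :=
  ∫ τ in Ioo 0 t, Complex.exp (k * (τ : ℂ)) * (f τ : ℂ)

/-- `F_γ(k,y)`, with the subscript called `c`. -/
def F (K₀ D₀ c : ℝ) (k : ℂ) (y : ℝ) : ℂ :=
  (c * (K₀ / (2 * D₀)) - 1) * Complex.sin (y * shift K₀ D₀ k)
    - c * shift K₀ D₀ k * Complex.cos (y * shift K₀ D₀ k)

/-- The denominator `Δ(k)` of the Robin–Robin problem. -/
def Delta (K₀ D₀ L α β : ℝ) (k : ℂ) : ℂ :=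
  Complex.exp (-Complex.I * k * L) * (1 - Complex.I * α * k) * (1 - Complex.I * β * nu K₀ D₀ k)
    - Complex.exp (-Complex.I * nu K₀ D₀ k * L) * (1 - Complex.I * α * nu K₀ D₀ k)
      * (1 - Complex.I * β * k)

/-- The denominator `Δ_α(k)` of the Robin–Dirichlet problem. -/
def DeltaRD (K₀ D₀ L α : ℝ) (k : ℂ) : ℂ :=
  Complex.exp (-Complex.I * k * L) * (1 - Complex.I * α * k)
    - Complex.exp (-Complex.I * nu K₀ D₀ k * L) * (1 - Complex.I * α * nu K₀ D₀ k)

/-- `Δ₀(k) = e^{-ikL} - e^{-iνL}`. -/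
def Delta0 (K₀ D₀ L : ℝ) (k : ℂ) : ℂ :=
  Complex.exp (-Complex.I * k * L) - Complex.exp (-Complex.I * nu K₀ D₀ k * L)

/-- `G(k,y) = lim_{α → ∞} F_α(k,y) / α`. -/
def G (K₀ D₀ : ℝ) (k : ℂ) (y : ℝ) : ℂ :=
  (K₀ / (2 * D₀)) * Complex.sin (y * shift K₀ D₀ k)
    - shift K₀ D₀ k * Complex.cos (y * shift K₀ D₀ k)

/-! ### Contours -/

/-- `D₊ = {Re ω(k) < 0, Im k > 0}`. -/
def DPlus (K₀ D₀ : ℝ) : Set ℂ := {k | (omega K₀ D₀ k).re < 0 ∧ 0 < k.im}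

/-- The boundary curve `∂D₊`, i.e. `Re ω = 0`, `Im k > 0` (together with its limit point `0` on the
real axis if `K₀ ≥ 0`), traversed from left to right. -/
def boundaryDPlus (K₀ D₀ : ℝ) (s : ℝ) : ℂ :=
  (s : ℂ) + Complex.I *
    ((Real.sqrt (s ^ 2 + (K₀ / (2 * D₀)) ^ 2) - K₀ / (2 * D₀) : ℝ) : ℂ)

/-- The curve `γ` passes above the point `z`: it avoids `z`, and a continuous choice of the argument
of `γ(s) - z` lies in `(0,π)` near both ends. -/
def PassesAbove (γ : ℝ → ℂ) (z : ℂ) : Prop :=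
  (∀ s, γ s ≠ z) ∧ ∃ φ : ℝ → ℝ, Continuous φ ∧
    (∀ s, γ s - z = (‖γ s - z‖ : ℂ) * Complex.exp (Complex.I * φ s)) ∧
    (∀ᶠ s in atTop, φ s ∈ Ioo 0 Real.pi) ∧ (∀ᶠ s in atBot, φ s ∈ Ioo 0 Real.pi)

/-- An admissible deformation of `∂D₊`: an open curve in the upper half plane, running from left to
right, whose ends are asymptotic to straight lines which go to infinity in the open upper half plane
outside `D₊`.  (Zero speed is allowed, so corners are possible.) -/
structure IsContour (K₀ D₀ : ℝ) (γ : ℝ → ℂ) : Prop where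
  contDiff : ContDiff ℝ 1 γ
  bounded_deriv : ∃ C : ℝ, ∀ s, ‖deriv γ s‖ ≤ C
  im_nonneg : ∀ s, 0 ≤ (γ s).im
  right_end : ∃ p d : ℂ, 0 < d.re ∧ 0 < d.im ∧
    Tendsto (fun s : ℝ => γ s - (p + s * d)) atTop (𝓝 0) ∧
    ∀ᶠ s : ℝ in atTop, p + s * d ∉ DPlus K₀ D₀
  left_end : ∃ p d : ℂ, 0 < d.re ∧ d.im < 0 ∧
    Tendsto (fun s : ℝ => γ s - (p + s * d)) atBot (𝓝 0) ∧
    ∀ᶠ s : ℝ in atBot, p + s * d ∉ DPlus K₀ D₀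

/-- A favourable contour for the denominator `E`: no zero of `E` lies on it or above it. -/
def IsFavourable (K₀ D₀ : ℝ) (E : ℂ → ℂ) (γ : ℝ → ℂ) : Prop :=
  IsContour K₀ D₀ γ ∧ ∀ z, E z = 0 → PassesAbove γ z

/-- The pull-back of `Φ(k) dk` to the parameter line. -/
def pullback (γ : ℝ → ℂ) (Φ : ℂ → ℂ) (s : ℝ) : ℂ := Φ (γ s) * deriv γ s

/-- `∫_γ Φ(k) dk`. -/
def contourIntegral (γ : ℝ → ℂ) (Φ : ℂ → ℂ) : ℂ := ∫ s, pullback γ Φ s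

/-! ### Integrands of the representations -/

/-- `e^{ikx - ω(k)t} θ̂₀(k)` for real `k`. -/
def lineIntegrand (K₀ D₀ L : ℝ) (θ₀ : ℝ → ℝ) (x t k : ℝ) : ℂ :=
  Complex.exp (Complex.I * k * x - omega K₀ D₀ k * t) * hat L θ₀ k

/-- Robin–Robin integrand on `∂D₊`. -/
def integrandRR (K₀ D₀ L α β : ℝ) (θ₀ f g : ℝ → ℝ) (x t : ℝ) (k : ℂ) : ℂ :=
  Complex.exp (-omega K₀ D₀ k * t) / Delta K₀ D₀ L α β k *
    (F K₀ D₀ α k x * (1 - Complex.I * β * k) * Complex.exp (Complex.I * L * shift K₀ D₀ k)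
        * hat L θ₀ k
      - F K₀ D₀ β k (x - L) * (1 - Complex.I * α * nu K₀ D₀ k) * hat L θ₀ (nu K₀ D₀ k)
      + (K₀ - 2 * Complex.I * k * D₀) *
        (F K₀ D₀ β k (x - L) * tilde f (omega K₀ D₀ k) t
          - F K₀ D₀ α k x * Complex.exp (-(K₀ / (2 * D₀)) * L) * tilde g (omega K₀ D₀ k) t))

/-- Robin–Dirichlet integrand on `∂D₊`. -/
def integrandRD (K₀ D₀ L α : ℝ) (θ₀ f g : ℝ → ℝ) (x t : ℝ) (k : ℂ) : ℂ :=
  Complex.exp (-omega K₀ D₀ k * t) / DeltaRD K₀ D₀ L α k *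
    (F K₀ D₀ α k x * Complex.exp (Complex.I * L * shift K₀ D₀ k) * hat L θ₀ k
      - (1 - Complex.I * α * nu K₀ D₀ k) * Complex.sin ((L - x) * shift K₀ D₀ k)
        * hat L θ₀ (nu K₀ D₀ k)
      + (K₀ - 2 * Complex.I * k * D₀) *
        (Complex.sin ((L - x) * shift K₀ D₀ k) * tilde f (omega K₀ D₀ k) t
          - F K₀ D₀ α k x * Complex.exp (-(K₀ / (2 * D₀)) * L) * tilde g (omega K₀ D₀ k) t))

/-- Dirichlet–Dirichlet integrand on `∂D₊`. -/
def integrandDD (K₀ D₀ L : ℝ) (θ₀ f g : ℝ → ℝ) (x t : ℝ) (k : ℂ) : ℂ :=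
  Complex.exp (-omega K₀ D₀ k * t) / Delta0 K₀ D₀ L k *
    (-(Complex.sin (x * shift K₀ D₀ k) * Complex.exp (Complex.I * L * shift K₀ D₀ k) * hat L θ₀ k)
      - Complex.sin ((L - x) * shift K₀ D₀ k) * hat L θ₀ (nu K₀ D₀ k)
      + (K₀ - 2 * Complex.I * k * D₀) *
        (Complex.sin ((L - x) * shift K₀ D₀ k) * tilde f (omega K₀ D₀ k) t
          + Complex.sin (x * shift K₀ D₀ k) * Complex.exp (-(K₀ / (2 * D₀)) * L)
            * tilde g (omega K₀ D₀ k) t))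

/-- Neumann–Neumann integrand on `∂D₊`. -/
def integrandNN (K₀ D₀ L : ℝ) (θ₀ fN gN : ℝ → ℝ) (x t : ℝ) (k : ℂ) : ℂ :=
  Complex.exp (-omega K₀ D₀ k * t) / Delta0 K₀ D₀ L k * (1 / (k * nu K₀ D₀ k)) *
    (k * G K₀ D₀ k x * Complex.exp (Complex.I * L * shift K₀ D₀ k) * hat L θ₀ k
      - nu K₀ D₀ k * G K₀ D₀ k (x - L) * hat L θ₀ (nu K₀ D₀ k)
      - Complex.I * (K₀ - 2 * Complex.I * k * D₀) *
        (G K₀ D₀ k (x - L) * tilde fN (omega K₀ D₀ k) t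
          - G K₀ D₀ k x * Complex.exp (-(K₀ / (2 * D₀)) * L) * tilde gN (omega K₀ D₀ k) t))

/-- `(1/2π) ∫_ℝ e^{ikx - ωt} θ̂₀ dk + c e^{-K₀(L-x)/(2D₀)} ∫_γ Φ dk`. -/
def representation (K₀ D₀ L : ℝ) (θ₀ : ℝ → ℝ) (c : ℂ) (γ : ℝ → ℂ) (Φ : ℂ → ℂ) (x t : ℝ) : ℂ :=
  1 / (2 * Real.pi) * (∫ k : ℝ, lineIntegrand K₀ D₀ L θ₀ x t k)
    + c * Complex.exp (-(K₀ / (2 * D₀)) * (L - x)) * contourIntegral γ Φ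

/-- `θ` equals the representation with absolutely convergent integrals, for all `0 < x < L` and
all `t > 0`.  The integrand `Φ` depends on `x` and `t`. -/
def IsRepresentedBy (K₀ D₀ L : ℝ) (θ₀ : ℝ → ℝ) (θ : ℝ → ℝ → ℝ) (c : ℂ) (γ : ℝ → ℂ)
    (Φ : ℝ → ℝ → ℂ → ℂ) : Prop :=
  ∀ x ∈ Ioo 0 L, ∀ t, 0 < t →
    Integrable (lineIntegrand K₀ D₀ L θ₀ x t) ∧ Integrable (pullback γ (Φ x t)) ∧
    (θ x t : ℂ) = representation K₀ D₀ L θ₀ c γ (Φ x t) x t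

end

end AdvectionDiffusion

open AdvectionDiffusion

/-! All four problems are instances of `a θ - α θ_x = f` at `0` and `b θ - β θ_x = g` at `L`: Robin
is `a = b = 1`, Dirichlet is Robin with vanishing `α` or `β`, Neumann is `a = b = 0`. One theorem,
`IsSolution.isRepresentedBy`, covers all of them.

Fix `x` and `t`. For `0 < s < t` write the claimed formula with the clock restarted at `s`: initial
value `θ(·,s)`, elapsed time `t - s`, boundary data kept only after `s` (`restarted`). This
expression does not depend on `s`. As `s → 0` it tends to the claimed formula. As `s → t` it tends
to `θ(x,t)`: the integral over the real line is a convolution with a shrinking Gaussian, and the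
contour integral tends to its value at elapsed time zero, which vanishes.

Independence of `s` (`restarted_eq`). Green's formula between two times `s₁ ≤ s₂` gives the global
relation: the jump of `e^{ωs} θ̂(k,s)` equals a boundary flux made of four transforms, two of them
unknown. Since `ω(ν) = ω(k)`, the relation at `ν` contains the same four transforms. The
coefficients of `θ̂₀(k)` and `θ̂₀(ν)` are such that the unknowns survive only with the factor `Δ`
(`elimination`). After division by `Δ` the jump of the contour integrand is entire. It splits into a
flux from `x = 0` and a flux from `x = L`, each decaying like a heat kernel because only times
before `s₂ < t` occur. The contour of the first can be moved to the real line, that of the second to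
the image of the real line under `ν`; there the global relation on the real line shows that they
cancel the jump of the first integral. Positive starting times are needed because nothing is assumed
about the separate boundary values near time zero.

Vanishing at elapsed time zero (`integral_heatIntegrand_zero`). The integrand is a quotient of
entire functions that decays like `e^{-δ Im k}` high up, with `δ = min x (L - x)`, and the contour
passes above all its poles. "Above" is a condition on a continuous argument, and this is exactly
what makes the integral of `1/(k - z)` over a truncated contour equal to that over its chord.
Partial fractions extend this to all quotients (`chordEq_div`), and the chord integrals tend to
zero.

Limits are taken by dominated convergence. The majorant rests on a lower bound `c₀ e^{L Im k}` for
`|Δ|` along the contour which is locally uniform in `a` and `b` (`robinDelta_contour`). Dividing the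
coefficients by `α` turns the Robin problem with `α = β` into `a = b = 1/α` with unit derivative
coefficients, so the Neumann limit is another case of the same continuity. -/

namespace AdvectionDiffusion

noncomputable section

section

/-! ### Zeros of entire functions and logarithms along curves -/

/-- Splitting off one zero of an entire function, with its multiplicity. -/
theorem exists_eq_pow_mul {E : ℂ → ℂ} (hE : Differentiable ℂ E) {w : ℂ} (hw : E w ≠ 0) (z : ℂ) :
    ∃ (n : ℕ) (G : ℂ → ℂ), Differentiable ℂ G ∧ G z ≠ 0 ∧ ∀ k, E k = (k - z) ^ n * G k := by
  have hA : AnalyticOnNhd ℂ E univ := fun x _ => hE.analyticAt x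
  have hne : ¬ ∀ᶠ k in 𝓝 z, E k = 0 := by
    intro h
    exact hw (hA.eqOn_zero_of_preconnected_of_eventuallyEq_zero isPreconnected_univ (mem_univ z) h
      (mem_univ w))
  obtain ⟨n, g, hg, hgz, hEg⟩ := (hE.analyticAt z).exists_eventuallyEq_pow_smul_nonzero_iff.2 hne
  -- The quotient `E / (k - z)^n` has a removable singularity at `z`; the local factor `g` supplies
  -- the missing value.
  refine ⟨n, Function.update (fun k => E k / (k - z) ^ n) z (g z), ?_, by simpa using hgz, ?_⟩
  · intro k
    by_cases hk : k = z
    · subst hk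
      refine hg.differentiableAt.congr_of_eventuallyEq ?_
      filter_upwards [hEg] with y hy
      by_cases hyk : y = k
      · simp [hyk]
      · rw [Function.update_of_ne hyk, hy, smul_eq_mul,
          mul_div_cancel_left₀ _ (pow_ne_zero _ (sub_ne_zero.2 hyk))]
    · have h1 : DifferentiableAt ℂ (fun k => E k / (k - z) ^ n) k :=
        (hE k).div (by fun_prop) (pow_ne_zero _ (sub_ne_zero.2 hk))
      refine h1.congr_of_eventuallyEq ?_
      filter_upwards [isOpen_ne.mem_nhds hk] with y hy
      rw [Function.update_of_ne hy]
  · intro k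
    by_cases hk : k = z
    · subst hk; simpa using hEg.self_of_nhds
    · rw [Function.update_of_ne hk, mul_div_cancel₀ _ (pow_ne_zero _ (sub_ne_zero.2 hk))]

/-- Splitting off all zeros of an entire function in a compact set. -/
theorem exists_eq_prod_mul {K : Set ℂ} (hK : IsCompact K) {E : ℂ → ℂ} (hE : Differentiable ℂ E)
    {w : ℂ} (hw : E w ≠ 0) :
    ∃ (Z : Multiset ℂ) (G : ℂ → ℂ), Differentiable ℂ G ∧ (∀ k ∈ K, G k ≠ 0) ∧
      (∀ z ∈ Z, E z = 0) ∧ ∀ k, E k = (Z.map fun z => k - z).prod * G k := by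
  have hA : AnalyticOnNhd ℂ E univ := fun x _ => hE.analyticAt x
  have hfin : (K ∩ E ⁻¹' {0}).Finite := by
    by_contra hinf
    obtain ⟨z, hzK, hz⟩ := Set.Infinite.exists_accPt_of_subset_isCompact hinf hK inter_subset_left
    have h1 : ∃ᶠ k in 𝓝[≠] z, E k = 0 := by
      have h2 := accPt_iff_frequently_nhdsNE.1 hz
      exact h2.mono fun k hk => hk.2
    exact hw (hA.eqOn_zero_of_preconnected_of_frequently_eq_zero isPreconnected_univ (mem_univ z) h1
      (mem_univ w))
  -- Induction on the size of a finite set `Y` containing the zeros in `K`. One point of `Y` is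
  -- removed at each step together with its full multiplicity, which is zero if the point is not a
  -- zero.
  have key : ∀ n : ℕ, ∀ E : ℂ → ℂ, Differentiable ℂ E → E w ≠ 0 →
      ∀ Y : Finset ℂ, Y.card = n → (K ∩ E ⁻¹' {0} ⊆ Y) →
      ∃ (Z : Multiset ℂ) (G : ℂ → ℂ), Differentiable ℂ G ∧ (∀ k ∈ K, G k ≠ 0) ∧
      (∀ z ∈ Z, E z = 0) ∧ ∀ k, E k = (Z.map fun z => k - z).prod * G k := by
    intro n
    induction n with
    | zero =>
      intro E hE _ Y hY hsub
      have hY' : Y = ∅ := Finset.card_eq_zero.1 hY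
      refine ⟨0, E, hE, fun k hk h0 => ?_, by simp, by simp⟩
      have := hsub ⟨hk, h0⟩
      simp [hY'] at this
    | succ n ih =>
      intro E hE hw Y hY hsub
      obtain ⟨z, hz⟩ : Y.Nonempty := Finset.card_pos.1 (by omega)
      obtain ⟨m, G, hG, hGz, hEG⟩ := exists_eq_pow_mul hE hw z
      have hGw : G w ≠ 0 := fun h => hw (by rw [hEG, h, mul_zero])
      obtain ⟨Z, H, hH, hHK, hZ, hGH⟩ := ih G hG hGw (Y.erase z)
        (by rw [Finset.card_erase_of_mem hz, hY]; rfl) (by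
          rintro k ⟨hk, hGk⟩
          have hGk' : G k = 0 := hGk
          have h1 : k ∈ Y := hsub ⟨hk, by simp [hEG, hGk']⟩
          simp only [Finset.coe_erase, Set.mem_sdiff, Finset.mem_coe, mem_singleton_iff]
          exact ⟨h1, fun h => hGz (h ▸ hGk')⟩)
      refine ⟨Multiset.replicate m z + Z, H, hH, hHK, ?_, ?_⟩
      · intro y hy
        rcases Multiset.mem_add.1 hy with h | h
        · have h2 := Multiset.mem_replicate.1 h
          rw [h2.2, hEG]; simp [h2.1]
        · rw [hEG, hZ y h, mul_zero]
      · intro k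
        rw [hEG, hGH]; simp [mul_assoc]
  exact key _ E hE hw hfin.toFinset rfl (by simp)

/-- A continuous logarithm of a differentiable curve is differentiable. -/
theorem hasDerivAt_of_exp_eq {ℓ g : ℝ → ℂ} {g' : ℂ} {s : ℝ} (hℓ : Continuous ℓ)
    (h : ∀ u, Complex.exp (ℓ u) = g u) (hg : HasDerivAt g g' s) : HasDerivAt ℓ (g' / g s) s := by
  have h0 : g s ≠ 0 := h s ▸ Complex.exp_ne_zero _
  have h1 : HasDerivAt (fun u => ℓ s + Complex.log (g u / g s)) (g' / g s) s := by
    have h2 : HasDerivAt (fun u => g u / g s) (g' / g s) s := hg.div_const _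
    have h3 := (h2.clog_real (by rw [div_self h0]; exact Complex.one_mem_slitPlane)).const_add (ℓ s)
    simpa [div_self h0] using h3
  refine h1.congr_of_eventuallyEq ?_
  -- As `1 < π`, the difference `ℓ u - ℓ s` stays in the range of the principal logarithm and
  -- therefore equals `log (g u / g s)`.
  have h4 : ∀ᶠ u in 𝓝 s, ‖ℓ u - ℓ s‖ < 1 := by
    have := (hℓ.tendsto s).sub_const (ℓ s)
    rw [sub_self] at this
    simpa using this.norm.eventually (gt_mem_nhds (by simp : ‖(0 : ℂ)‖ < 1))
  filter_upwards [h4] with u hu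
  have h5 : |(ℓ u - ℓ s).im| < 1 := lt_of_le_of_lt (Complex.abs_im_le_norm _) hu
  have h6 := abs_lt.1 h5
  have hpi := Real.pi_gt_three
  rw [← h u, ← h s, ← Complex.exp_sub, Complex.log_exp (by linarith) (by linarith)]
  ring

end

section

/-! ### Replacing a curve by its chord -/

/-- The integral of `Φ` along `γ` over `[a,b]` equals its integral along the chord. -/
def ChordEq (γ : ℝ → ℂ) (a b : ℝ) (Φ : ℂ → ℂ) : Prop :=
  ∫ s in a..b, Φ (γ s) * deriv γ s
    = ∫ u in (0 : ℝ)..1, Φ (γ a + u * (γ b - γ a)) * (γ b - γ a)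

/-- The union of the curve `γ` over `[a,b]` and its chord. -/
def chordTrace (γ : ℝ → ℂ) (a b : ℝ) : Set ℂ :=
  γ '' Icc a b ∪ (fun u : ℝ => γ a + u * (γ b - γ a)) '' Icc 0 1

section chord

variable {γ : ℝ → ℂ} {a b : ℝ} {Φ Ψ P : ℂ → ℂ}

theorem intervalIntegrable_curve (hγ : ContDiff ℝ 1 γ) (hab : a ≤ b)
    (hΦ : ContinuousOn Φ (chordTrace γ a b)) :
    IntervalIntegrable (fun s => Φ (γ s) * deriv γ s) volume a b := by
  refine ContinuousOn.intervalIntegrable ?_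
  rw [uIcc_of_le hab]
  refine ContinuousOn.mul ?_ (hγ.continuous_deriv le_rfl).continuousOn
  exact hΦ.comp hγ.continuous.continuousOn fun s hs => Or.inl ⟨s, hs, rfl⟩

theorem intervalIntegrable_chord (hΦ : ContinuousOn Φ (chordTrace γ a b)) :
    IntervalIntegrable (fun u : ℝ => Φ (γ a + u * (γ b - γ a)) * (γ b - γ a)) volume 0 1 := by
  refine ContinuousOn.intervalIntegrable ?_
  rw [uIcc_of_le zero_le_one]
  refine ContinuousOn.mul ?_ continuousOn_const
  exact hΦ.comp (by fun_prop) fun s hs => Or.inr ⟨s, hs, rfl⟩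

theorem ChordEq.add (hγ : ContDiff ℝ 1 γ) (hab : a ≤ b) (hΦ : ContinuousOn Φ (chordTrace γ a b))
    (hΨ : ContinuousOn Ψ (chordTrace γ a b)) (h1 : ChordEq γ a b Φ) (h2 : ChordEq γ a b Ψ) :
    ChordEq γ a b fun k => Φ k + Ψ k := by
  unfold ChordEq at *
  simp only [add_mul]
  rw [intervalIntegral.integral_add (intervalIntegrable_curve hγ hab hΦ)
    (intervalIntegrable_curve hγ hab hΨ),
    intervalIntegral.integral_add (intervalIntegrable_chord hΦ) (intervalIntegrable_chord hΨ),
    h1, h2]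

theorem ChordEq.const_mul (c : ℂ) (h1 : ChordEq γ a b Φ) : ChordEq γ a b fun k => c * Φ k := by
  unfold ChordEq at *
  simp only [mul_assoc, intervalIntegral.integral_const_mul]
  rw [h1]

theorem ChordEq.congr (hab : a ≤ b) (h : EqOn Φ Ψ (chordTrace γ a b)) (h1 : ChordEq γ a b Φ) :
    ChordEq γ a b Ψ := by
  unfold ChordEq at *
  have e1 : ∫ s in a..b, Ψ (γ s) * deriv γ s = ∫ s in a..b, Φ (γ s) * deriv γ s := by
    refine intervalIntegral.integral_congr fun s hs => ?_
    rw [uIcc_of_le hab] at hs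
    simp only [h (Or.inl ⟨s, hs, rfl⟩)]
  have e2 : ∫ u in (0 : ℝ)..1, Ψ (γ a + u * (γ b - γ a)) * (γ b - γ a)
      = ∫ u in (0 : ℝ)..1, Φ (γ a + u * (γ b - γ a)) * (γ b - γ a) := by
    refine intervalIntegral.integral_congr fun u hu => ?_
    rw [uIcc_of_le zero_le_one] at hu
    simp only [h (Or.inr ⟨u, hu, rfl⟩)]
  rw [e1, e2, h1]

theorem integral_curve_of_primitive (hγ : ContDiff ℝ 1 γ) (hab : a ≤ b)
    (hΦ : ContinuousOn Φ (γ '' Icc a b)) (hP : ∀ k ∈ γ '' Icc a b, HasDerivAt P (Φ k) k) :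
    ∫ s in a..b, Φ (γ s) * deriv γ s = P (γ b) - P (γ a) := by
  refine intervalIntegral.integral_eq_sub_of_hasDerivAt (f := fun s => P (γ s)) ?_ ?_
  · intro s hs
    rw [uIcc_of_le hab] at hs
    exact (hP _ ⟨s, hs, rfl⟩).comp_of_eq s
      ((hγ.differentiable one_ne_zero).differentiableAt.hasDerivAt) rfl
  · refine ContinuousOn.intervalIntegrable ?_
    rw [uIcc_of_le hab]
    refine ContinuousOn.mul ?_ (hγ.continuous_deriv le_rfl).continuousOn
    exact hΦ.comp hγ.continuous.continuousOn fun s hs => ⟨s, hs, rfl⟩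

theorem integral_chord_of_primitive {p q : ℂ}
    (hΦ : ContinuousOn Φ ((fun u : ℝ => p + u * (q - p)) '' Icc 0 1))
    (hP : ∀ k ∈ (fun u : ℝ => p + u * (q - p)) '' Icc 0 1, HasDerivAt P (Φ k) k) :
    ∫ u in (0 : ℝ)..1, Φ (p + u * (q - p)) * (q - p) = P q - P p := by
  have hd : ∀ u : ℝ, HasDerivAt (fun u : ℝ => p + u * (q - p)) (q - p) u := fun u => by
    simpa using ((Complex.ofRealCLM.hasDerivAt (x := u)).mul_const (q - p)).const_add p
  have hc : ContDiff ℝ 1 (fun u : ℝ => p + u * (q - p)) := by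
    have : ContDiff ℝ 1 (fun u : ℝ => (u : ℂ)) := Complex.ofRealCLM.contDiff
    fun_prop
  have := integral_curve_of_primitive hc zero_le_one hΦ hP
  simp only [fun u => (hd u).deriv] at this
  simpa using this

theorem ChordEq.of_primitive (hγ : ContDiff ℝ 1 γ) (hab : a ≤ b)
    (hΦ : ContinuousOn Φ (chordTrace γ a b)) (hP : ∀ k ∈ chordTrace γ a b, HasDerivAt P (Φ k) k) :
    ChordEq γ a b Φ := by
  unfold ChordEq
  rw [integral_curve_of_primitive hγ hab (hΦ.mono subset_union_left) fun k hk => hP k (Or.inl hk),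
    integral_chord_of_primitive (hΦ.mono subset_union_right) fun k hk => hP k (Or.inr hk)]

theorem prod_sub_ne_zero {Z : Multiset ℂ} {k : ℂ} (h : k ∉ Z) :
    (Z.map fun z => k - z).prod ≠ 0 := by
  simp only [ne_eq, Multiset.prod_eq_zero_iff, Multiset.mem_map, not_exists, not_and]
  intro z hz h0
  exact h (sub_eq_zero.1 h0 ▸ hz)

theorem continuous_prod_sub (Z : Multiset ℂ) :
    Continuous fun k : ℂ => (Z.map fun z => k - z).prod := by
  induction Z using Multiset.induction_on with
  | empty => simpa using continuous_const
  | cons z Z ih => simp only [Multiset.map_cons, Multiset.prod_cons]; fun_prop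

theorem continuousOn_inv_prod_sub {Z : Multiset ℂ} {T : Set ℂ} (hZ : ∀ z ∈ Z, z ∉ T) :
    ContinuousOn (fun k : ℂ => ((Z.map fun z => k - z).prod)⁻¹) T :=
  (continuous_prod_sub Z).continuousOn.inv₀ fun _ hk =>
    prod_sub_ne_zero fun h => hZ _ h hk

/-- Partial fractions. If two of the points differ, `1/((k-z)(k-y))` is `1/(z-y)` times a difference
of simple fractions, and each summand has one factor fewer. If all points coincide and there are at
least two, the function has a rational primitive. So a logarithm is needed only for a single factor,
which is the hypothesis. -/
theorem ChordEq.inv_prod (hγ : ContDiff ℝ 1 γ) (hab : a ≤ b) :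
    ∀ (n : ℕ) (Z : Multiset ℂ), Z.card = n + 1 →
      (∀ z ∈ Z, z ∉ chordTrace γ a b ∧ ChordEq γ a b fun k => (k - z)⁻¹) →
      ChordEq γ a b fun k => ((Z.map fun z => k - z).prod)⁻¹ := by
  intro n
  induction n with
  | zero =>
    intro Z hZ h
    obtain ⟨z, rfl⟩ := Multiset.card_eq_one.1 hZ
    simpa using (h z (by simp)).2
  | succ n ih =>
    intro Z hZ h
    obtain ⟨z, Z', hcard, rfl⟩ : ∃ z Z', Multiset.card Z' = n + 1 ∧ z ::ₘ Z' = Z := by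
      obtain ⟨z, hz⟩ := Multiset.card_pos_iff_exists_mem.1 (by omega : 0 < Multiset.card Z)
      obtain ⟨Z', rfl⟩ := Multiset.exists_cons_of_mem hz
      exact ⟨z, Z', by simpa using hZ, rfl⟩
    by_cases hall : ∀ y ∈ Z', y = z
    · have hrep : Z' = Multiset.replicate (n + 1) z := Multiset.eq_replicate.2 ⟨hcard, hall⟩
      have hz := (h z (by simp)).1
      refine ChordEq.of_primitive (P := fun k => -((n + 1 : ℂ)⁻¹ * ((k - z) ^ (n + 1))⁻¹)) hγ hab
        (continuousOn_inv_prod_sub fun y hy => (h y hy).1) ?_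
      intro k hk
      have hkz : k - z ≠ 0 := sub_ne_zero.2 fun h => hz (h ▸ hk)
      have h1 : HasDerivAt (fun k : ℂ => (k - z) ^ (n + 1)) (((n + 1 : ℕ) : ℂ) * (k - z) ^ n * 1) k :=
        ((hasDerivAt_id k).sub_const z).pow (n + 1)
      have h2 := (((h1.inv (pow_ne_zero _ hkz)).const_mul ((n + 1 : ℂ)⁻¹)).neg)
      refine h2.congr_deriv ?_
      have hn : (n + 1 : ℂ) ≠ 0 := by exact_mod_cast Nat.succ_ne_zero n
      rw [hrep]
      simp only [Multiset.map_cons, Multiset.map_replicate, Multiset.prod_cons,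
        Multiset.prod_replicate]
      push_cast
      field_simp
      ring
    · push Not at hall
      obtain ⟨y, hy, hyz⟩ := hall
      obtain ⟨Z'', rfl⟩ := Multiset.exists_cons_of_mem hy
      have e1 := ih (z ::ₘ Z'') (by simpa using hcard) fun w hw => h w (by
        rcases Multiset.mem_cons.1 hw with h | h <;> simp [h])
      have e2 := ih (y ::ₘ Z'') (by simpa using hcard) fun w hw => h w (by
        rcases Multiset.mem_cons.1 hw with h | h <;> simp [h])
      have c1 : ContinuousOn (fun k : ℂ => (((z ::ₘ Z'').map fun z => k - z).prod)⁻¹)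
          (chordTrace γ a b) := continuousOn_inv_prod_sub fun w hw => (h w (by
        rcases Multiset.mem_cons.1 hw with h | h <;> simp [h])).1
      have c2 : ContinuousOn (fun k : ℂ => (((y ::ₘ Z'').map fun z => k - z).prod)⁻¹)
          (chordTrace γ a b) := continuousOn_inv_prod_sub fun w hw => (h w (by
        rcases Multiset.mem_cons.1 hw with h | h <;> simp [h])).1
      refine ChordEq.congr hab ?_ (ChordEq.add hγ hab (continuousOn_const.mul c1)
        (continuousOn_const.mul c2) (e1.const_mul (z - y)⁻¹) (e2.const_mul (-(z - y)⁻¹)))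
      intro k hk
      have hkz : k - z ≠ 0 := sub_ne_zero.2 fun h' => (h z (by simp)).1 (h' ▸ hk)
      have hky : k - y ≠ 0 := sub_ne_zero.2 fun h' => (h y (by simp)).1 (h' ▸ hk)
      have hzy : z - y ≠ 0 := sub_ne_zero.2 (Ne.symm hyz)
      have hp : (Z''.map fun z => k - z).prod ≠ 0 :=
        prod_sub_ne_zero fun h' => (h k (by simp [h'])).1 hk
      simp only [Multiset.map_cons, Multiset.prod_cons, Pi.mul_apply]
      field_simp
      ring

/-- Writing `h(k) = h(z) + (k - z) dslope h z k` removes one pole from the second term, while the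
first is a constant multiple of the case of numerator one. Without poles, a holomorphic function on
a ball has a primitive. -/
theorem ChordEq.div_prod (hγ : ContDiff ℝ 1 γ) (hab : a ≤ b) {c : ℂ} {r : ℝ}
    (hU : chordTrace γ a b ⊆ Metric.ball c r) (Z : Multiset ℂ)
    (hZ : ∀ z ∈ Z, z ∉ chordTrace γ a b ∧ ChordEq γ a b fun k => (k - z)⁻¹) :
    ∀ h : ℂ → ℂ, DifferentiableOn ℂ h (Metric.ball c r) →
      ChordEq γ a b fun k => h k * ((Z.map fun z => k - z).prod)⁻¹ := by
  induction Z using Multiset.induction_on with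
  | empty =>
    intro h hh
    obtain ⟨P, hP⟩ := hh.isExactOn_ball
    simp only [Multiset.map_zero, Multiset.prod_zero, inv_one, mul_one]
    exact ChordEq.of_primitive hγ hab (hh.continuousOn.mono hU) fun k hk => hP k (hU hk)
  | cons z Z ih =>
    intro h hh
    have hd : DifferentiableOn ℂ (dslope h z) (Metric.ball c r) := by
      by_cases hz : z ∈ Metric.ball c r
      · exact (Complex.differentiableOn_dslope (Metric.isOpen_ball.mem_nhds hz)).2 hh
      · exact (differentiableOn_dslope_of_notMem hz).2 hh
    have e1 := ih (fun y hy => hZ y (by simp [hy])) _ hd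
    have e2 := (ChordEq.inv_prod hγ hab (Multiset.card Z) (z ::ₘ Z) (by simp) hZ).const_mul (h z)
    have c1 : ContinuousOn (fun k : ℂ => ((Z.map fun z => k - z).prod)⁻¹) (chordTrace γ a b) :=
      continuousOn_inv_prod_sub fun w hw => (hZ w (by simp [hw])).1
    have c2 : ContinuousOn (fun k : ℂ => (((z ::ₘ Z).map fun z => k - z).prod)⁻¹)
        (chordTrace γ a b) := continuousOn_inv_prod_sub fun w hw => (hZ w hw).1
    refine ChordEq.congr hab ?_ (ChordEq.add hγ hab ((hd.continuousOn.mono hU).mul c1)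
      (continuousOn_const.mul c2) e1 e2)
    intro k hk
    have hkz : k - z ≠ 0 := sub_ne_zero.2 fun h' => (hZ z (by simp)).1 (h' ▸ hk)
    have hp : (Z.map fun z => k - z).prod ≠ 0 :=
      prod_sub_ne_zero fun h' => (hZ k (by simp [h'])).1 hk
    have hds : h k = h z + (k - z) * dslope h z k := by
      have := sub_smul_dslope h z k
      rw [smul_eq_mul] at this
      rw [this]; ring
    simp only [Multiset.map_cons, Multiset.prod_cons, Pi.mul_apply]
    rw [hds]
    field_simp
    ring

/-- If `γ` passes above `z` in the sense of continuous arguments, the chord may replace `γ` in the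
integral of `1/(k-z)`. -/
theorem ChordEq.inv_sub (hγ : ContDiff ℝ 1 γ) {z : ℂ} (hz : ∀ s, γ s ≠ z) {φ : ℝ → ℝ}
    (hφ : Continuous φ) (hφz : ∀ s, γ s - z = (‖γ s - z‖ : ℂ) * Complex.exp (Complex.I * φ s))
    (ha : φ a ∈ Ioo 0 Real.pi) (hb : φ b ∈ Ioo 0 Real.pi) (hza : z.im < (γ a).im)
    (hzb : z.im < (γ b).im) :
    z ∉ chordTrace γ a b ∧ ChordEq γ a b fun k => (k - z)⁻¹ := by
  have him : ∀ u ∈ Icc (0 : ℝ) 1, z.im < (γ a + u * (γ b - γ a)).im := by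
    intro u hu
    have : (γ a + u * (γ b - γ a)).im = (1 - u) * (γ a).im + u * (γ b).im := by
      simp; ring
    rw [this]
    rcases eq_or_lt_of_le hu.1 with h | h
    · rw [← h]; simpa using hza
    · nlinarith [hu.2]
  have hmem : z ∉ chordTrace γ a b := by
    rintro (⟨s, -, hs⟩ | ⟨u, hu, hs⟩)
    · exact hz s hs
    · have := him u hu
      simp only at hs
      rw [hs] at this
      exact lt_irrefl _ this
  refine ⟨hmem, ?_⟩
  have hn : ∀ s, ‖γ s - z‖ ≠ 0 := fun s => norm_ne_zero_iff.2 (sub_ne_zero.2 (hz s))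
  -- A continuous logarithm of `γ - z` along the curve; the integral of `1/(k - z)` is its
  -- increment.
  set ℓ : ℝ → ℂ := fun s => (Real.log ‖γ s - z‖ : ℂ) + Complex.I * φ s with hℓ
  have hexp : ∀ s, Complex.exp (ℓ s) = γ s - z := by
    intro s
    rw [hℓ]
    simp only
    rw [Complex.exp_add, ← Complex.ofReal_exp,
      Real.exp_log (lt_of_le_of_ne (norm_nonneg _) (hn s).symm), ← hφz s]
  have hℓc : Continuous ℓ := by
    have h1 : Continuous fun s => Real.log ‖γ s - z‖ :=
      Continuous.log (by have := hγ.continuous; fun_prop) hn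
    fun_prop
  -- At `a` and `b` the argument lies in `(0,π)`, so there `ℓ` is the principal logarithm. The
  -- latter is a primitive along the chord, which stays above `z`. Hence both integrals have the
  -- same value.
  have hlog : ∀ s, φ s ∈ Ioo 0 Real.pi → ℓ s = Complex.log (γ s - z) := by
    intro s hs
    have : (ℓ s).im = φ s := by simp [hℓ]
    rw [← hexp s, Complex.log_exp (by rw [this]; linarith [hs.1, Real.pi_pos])
      (by rw [this]; exact hs.2.le)]
  unfold ChordEq
  have e1 : ∫ s in a..b, (γ s - z)⁻¹ * deriv γ s = ℓ b - ℓ a := by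
    refine intervalIntegral.integral_eq_sub_of_hasDerivAt ?_ ?_
    · intro s _
      have hd : HasDerivAt (fun u => γ u - z) (deriv γ s) s :=
        ((hγ.differentiable one_ne_zero).differentiableAt.hasDerivAt).sub_const z
      exact (hasDerivAt_of_exp_eq hℓc hexp hd).congr_deriv (by rw [div_eq_mul_inv, mul_comm])
    · refine Continuous.intervalIntegrable ?_ _ _
      exact ((hγ.continuous.sub continuous_const).inv₀ fun s => sub_ne_zero.2 (hz s)).mul
        (hγ.continuous_deriv le_rfl)
  have e2 : ∫ u in (0 : ℝ)..1, (γ a + u * (γ b - γ a) - z)⁻¹ * (γ b - γ a)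
      = Complex.log (γ b - z) - Complex.log (γ a - z) := by
    refine integral_chord_of_primitive (Φ := fun k => (k - z)⁻¹)
      (P := fun k => Complex.log (k - z)) ?_ ?_
    · refine ContinuousOn.inv₀ (by fun_prop) ?_
      rintro k ⟨u, hu, rfl⟩ h0
      exact hmem (Or.inr ⟨u, hu, sub_eq_zero.1 h0⟩)
    · rintro k ⟨u, hu, rfl⟩
      have h1 : (γ a + u * (γ b - γ a) - z) ∈ Complex.slitPlane := by
        refine Complex.mem_slitPlane_iff.2 (Or.inr ?_)
        have := him u hu
        rw [Complex.sub_im]; linarith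
      have h2 := (Complex.hasDerivAt_log h1).comp (γ a + u * (γ b - γ a))
        ((hasDerivAt_id _).sub_const z)
      simpa [Function.comp_def] using h2
  rw [e1, e2, hlog b hb, hlog a ha]

/-- The residue theorem in the form needed here: a curve passing above all poles of `h/E` may be
replaced by its chord. -/
theorem chordEq_div (hγ : ContDiff ℝ 1 γ) (hab : a ≤ b) {h E : ℂ → ℂ} (hh : Differentiable ℂ h)
    (hE : Differentiable ℂ E) {w : ℂ} (hw : E w ≠ 0)
    (hz : ∀ z, E z = 0 → z ∉ chordTrace γ a b ∧ ChordEq γ a b fun k => (k - z)⁻¹) :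
    ChordEq γ a b fun k => h k / E k := by
  have hcomp : IsCompact (chordTrace γ a b) :=
    (isCompact_Icc.image hγ.continuous).union (isCompact_Icc.image (by fun_prop))
  obtain ⟨r, hr⟩ := hcomp.isBounded.subset_ball 0
  -- The zeros of `E` in a closed ball around curve and chord are divided out; the cofactor `G` has
  -- no zero there, so `h / G` is holomorphic on the ball.
  obtain ⟨Z, G, hG, hGK, hZ, hEG⟩ := exists_eq_prod_mul (isCompact_closedBall (0 : ℂ) r) hE hw
  have h1 := ChordEq.div_prod hγ hab hr Z (fun z h => hz z (hZ z h)) (fun k => h k / G k)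
    (fun k hk => ((hh k).div (hG k) (hGK k (Metric.ball_subset_closedBall hk))).differentiableWithinAt)
  refine ChordEq.congr hab ?_ h1
  intro k hk
  simp only [hEG, div_eq_mul_inv, mul_inv]
  ring

end chord

end

/-! ### Geometry of contours and of the points they pass above -/

section

theorem re_omega (K₀ D₀ : ℝ) (k : ℂ) :
    (omega K₀ D₀ k).re = D₀ * (k.re ^ 2 - k.im ^ 2) - K₀ * k.im := by
  simp [omega, pow_two]; ring

theorem differentiable_omega (K₀ D₀ : ℝ) : Differentiable ℂ (omega K₀ D₀) := by
  unfold omega; fun_prop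

theorem differentiable_nu (K₀ D₀ : ℝ) : Differentiable ℂ (nu K₀ D₀) := by
  unfold nu; fun_prop

theorem differentiable_shift (K₀ D₀ : ℝ) : Differentiable ℂ (shift K₀ D₀) := by
  unfold shift; fun_prop

/-- Turns inequalities that hold near both ends of the line into global ones with an additive
constant, by compactness of the middle part. -/
theorem exists_lower_bound {H : ℝ → ℝ} (hH : Continuous H) (h1 : ∀ᶠ s in atTop, 0 ≤ H s)
    (h2 : ∀ᶠ s in atBot, 0 ≤ H s) : ∃ C, 0 ≤ C ∧ ∀ s, -C ≤ H s := by
  obtain ⟨A, hA⟩ := eventually_atTop.1 h1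
  obtain ⟨B, hB⟩ := eventually_atBot.1 h2
  obtain ⟨m, hm⟩ := (isCompact_Icc (a := B) (b := A)).bddBelow_image hH.continuousOn
  refine ⟨|m|, abs_nonneg m, fun s => ?_⟩
  have h0 := neg_abs_le m
  rcases le_total A s with h | h
  · linarith [hA s h, abs_nonneg m]
  rcases le_total s B with h' | h'
  · linarith [hB s h', abs_nonneg m]
  · linarith [hm ⟨s, ⟨h', h⟩, rfl⟩]

section ends

variable {K₀ D₀ : ℝ} {g : ℝ → ℂ} {p d : ℂ}

/-- The asymptote has these growth rates with constants `‖d‖`, `d.im`, `|d.re|`; the factors of two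
absorb `p` and the deviation from the asymptote. -/
theorem end_bounds (hr : d.re ≠ 0) (hi : 0 < d.im)
    (ht : Tendsto (fun s : ℝ => g s - (p + s * d)) atTop (𝓝 0)) :
    ∀ᶠ s : ℝ in atTop, 0 < s ∧ ‖g s‖ ≤ (2 * ‖d‖) * s ∧ d.im / 2 * s ≤ (g s).im ∧
      |d.re| / 2 * s ≤ |(g s).re| := by
  have hd : 0 < ‖d‖ := norm_pos_iff.2 fun h => hr (by simp [h])
  have hr' : 0 < |d.re| := abs_pos.2 hr
  have h1 : ∀ᶠ s : ℝ in atTop, ‖g s - (p + s * d)‖ < 1 := by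
    simpa using ht.norm.eventually (gt_mem_nhds (by simp : ‖(0 : ℂ)‖ < 1))
  filter_upwards [h1, eventually_gt_atTop 0,
    eventually_ge_atTop ((1 + ‖p‖) / ‖d‖), eventually_ge_atTop ((1 + ‖p‖) / (d.im / 2)),
    eventually_ge_atTop ((1 + ‖p‖) / (|d.re| / 2))] with s h1 hs h2 h3 h4
  rw [div_le_iff₀ hd] at h2
  rw [div_le_iff₀ (by positivity)] at h3 h4
  have e : g s = (g s - (p + s * d)) + p + s * d := by ring
  set r := g s - (p + s * d) with hrdef
  have a1 := Complex.abs_re_le_norm r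
  have a2 := Complex.abs_im_le_norm r
  have a3 := Complex.abs_re_le_norm p
  have a4 := Complex.abs_im_le_norm p
  refine ⟨hs, ?_, ?_, ?_⟩
  · rw [e]
    calc ‖r + p + s * d‖ ≤ ‖r‖ + ‖p‖ + ‖(s : ℂ) * d‖ := norm_add₃_le
      _ = ‖r‖ + ‖p‖ + s * ‖d‖ := by rw [norm_mul, Complex.norm_real, Real.norm_of_nonneg hs.le]
      _ ≤ _ := by nlinarith
  · rw [e]
    simp only [Complex.add_im, Complex.im_ofReal_mul]
    nlinarith [abs_le.1 a2, abs_le.1 a4]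
  · rw [e]
    simp only [Complex.add_re, Complex.re_ofReal_mul]
    have b1 : |s * d.re| = s * |d.re| := by rw [abs_mul, abs_of_pos hs]
    have b2 := abs_sub_abs_le_abs_sub (s * d.re) (-(r.re + p.re))
    rw [abs_neg, sub_neg_eq_add, b1] at b2
    have b3 := abs_add_le r.re p.re
    rw [add_comm (r.re + p.re)]
    nlinarith

/-- The asymptote avoids `D₊`, but the end of the curve need not. Since `ω` is quadratic, a
deviation `o(1)` at distance of order `s` changes `Re ω` by `o(s)` only. This is harmless, because
the integrands decay exponentially in `Im k`. -/
theorem end_omega (hD : 0 < D₀) (hr : d.re ≠ 0) (hi : 0 < d.im)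
    (ht : Tendsto (fun s : ℝ => g s - (p + s * d)) atTop (𝓝 0))
    (hout : ∀ᶠ s : ℝ in atTop, p + s * d ∉ DPlus K₀ D₀) {η : ℝ} (hη : 0 < η) :
    ∀ᶠ s : ℝ in atTop, -(η * s) ≤ (omega K₀ D₀ (g s)).re := by
  have hd : 0 < ‖d‖ := norm_pos_iff.2 fun h => hr (by simp [h])
  set A := D₀ * (2 * ‖d‖ + 2 * ‖d‖) + |K₀| with hA
  have hApos : 0 < A := by positivity
  have h1 : ∀ᶠ s : ℝ in atTop, ‖g s - (p + s * d)‖ < η / A := by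
    simpa using ht.norm.eventually (gt_mem_nhds (by simpa using div_pos hη hApos : ‖(0 : ℂ)‖ < η / A))
  -- The line is its own asymptote, so `end_bounds` applies to it as well.
  have hline : Tendsto (fun s : ℝ => (p + s * d) - (p + s * d)) atTop (𝓝 0) := by simp
  filter_upwards [h1, end_bounds hr hi ht, end_bounds hr hi hline, hout,
    eventually_ge_atTop 1] with s h1 h2 h3 h4 hs1
  obtain ⟨hs, h2, -⟩ := h2
  obtain ⟨-, h3, h5, -⟩ := h3
  have him : 0 < (p + s * d).im := lt_of_lt_of_le (by positivity) h5
  have hre : 0 ≤ (omega K₀ D₀ (p + s * d)).re := by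
    by_contra hneg
    exact h4 ⟨not_le.1 hneg, him⟩
  have e : omega K₀ D₀ (g s) - omega K₀ D₀ (p + s * d)
      = (g s - (p + s * d)) * (D₀ * (g s + (p + s * d)) + Complex.I * K₀) := by
    simp only [omega]; ring
  have hb : ‖omega K₀ D₀ (g s) - omega K₀ D₀ (p + s * d)‖ ≤ η / A * (A * s) := by
    rw [e, norm_mul]
    refine mul_le_mul h1.le ?_ (norm_nonneg _) (by positivity)
    calc ‖(D₀ : ℂ) * (g s + (p + s * d)) + Complex.I * K₀‖
        ≤ D₀ * (‖g s‖ + ‖p + s * d‖) + |K₀| := by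
          refine (norm_add_le _ _).trans (add_le_add ?_ ?_)
          · rw [norm_mul, Complex.norm_real, Real.norm_of_nonneg hD.le]
            exact mul_le_mul_of_nonneg_left (norm_add_le _ _) hD.le
          · simp
      _ ≤ D₀ * ((2 * ‖d‖) * s + (2 * ‖d‖) * s) + |K₀| * s := by
          gcongr
          exact le_mul_of_one_le_right (abs_nonneg _) hs1
      _ = A * s := by rw [hA]; ring
  have h6 := (abs_le.1 ((Complex.abs_re_le_norm _).trans hb)).1
  rw [Complex.sub_re] at h6
  have : η / A * (A * s) = η * s := by field_simp
  linarith

end ends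

namespace IsContour

variable {K₀ D₀ : ℝ} {γ : ℝ → ℂ}

/-- Reversing the parameter lets the lemmas for an end at `+∞` serve both ends. -/
theorem left_end' (h : IsContour K₀ D₀ γ) : ∃ p d : ℂ, d.re < 0 ∧ 0 < d.im ∧
    Tendsto (fun s : ℝ => γ (-s) - (p + s * d)) atTop (𝓝 0) ∧
    ∀ᶠ s : ℝ in atTop, p + s * d ∉ DPlus K₀ D₀ := by
  obtain ⟨p, d, h1, h2, h3, h4⟩ := h.left_end
  refine ⟨p, -d, by simpa using h1, by simpa using h2, ?_, ?_⟩
  · have := h3.comp tendsto_neg_atTop_atBot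
    refine this.congr fun s => ?_
    simp [Function.comp]
  · have := tendsto_neg_atTop_atBot.eventually h4
    filter_upwards [this] with s hs
    simpa using hs

theorem eventually_atBot_of_neg {P : ℝ → Prop} (h : ∀ᶠ s : ℝ in atTop, P (-s)) :
    ∀ᶠ s : ℝ in atBot, P s := by
  have := tendsto_neg_atBot_atTop.eventually h
  simpa using this

/-- These linear rates convert decay in `Im k` or in `Re k` into decay in the parameter `s`. A
single `C` serves as upper slope and as additive slack. -/
theorem bounds (h : IsContour K₀ D₀ γ) : ∃ c, 0 < c ∧ ∃ C, 0 ≤ C ∧ ∀ s,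
    ‖γ s‖ ≤ C * (1 + |s|) ∧ c * |s| - C ≤ (γ s).im ∧ c * |s| - C ≤ |(γ s).re| := by
  obtain ⟨p, d, h1, h2, h3, -⟩ := h.right_end
  obtain ⟨p', d', h1', h2', h3', -⟩ := h.left_end'
  have e1 := end_bounds h1.ne' h2 h3
  have e2 := end_bounds h1'.ne h2' h3'
  have hγ := h.contDiff.continuous
  set c := min (min (d.im / 2) (d'.im / 2)) (min (|d.re| / 2) (|d'.re| / 2)) with hc
  have hc0 : 0 < c := by
    have := abs_pos.2 h1.ne'
    have := abs_pos.2 h1'.ne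
    simp only [hc, lt_min_iff]; refine ⟨⟨?_, ?_⟩, ?_, ?_⟩ <;> positivity
  have c1 : c ≤ d.im / 2 := (min_le_left _ _).trans (min_le_left _ _)
  have c2 : c ≤ d'.im / 2 := (min_le_left _ _).trans (min_le_right _ _)
  have c3 : c ≤ |d.re| / 2 := (min_le_right _ _).trans (min_le_left _ _)
  have c4 : c ≤ |d'.re| / 2 := (min_le_right _ _).trans (min_le_right _ _)
  set M := 2 * ‖d‖ + 2 * ‖d'‖ with hM
  obtain ⟨C1, p1, q1⟩ := exists_lower_bound (H := fun s => M * |s| - ‖γ s‖) (by fun_prop)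
    (by
      filter_upwards [e1] with s hs
      rw [abs_of_pos hs.1]
      nlinarith [hs.1, hs.2.1, norm_nonneg d'])
    (eventually_atBot_of_neg (by
      filter_upwards [e2] with s hs
      rw [abs_neg, abs_of_pos hs.1]
      nlinarith [hs.1, hs.2.1, norm_nonneg d]))
  obtain ⟨C2, p2, q2⟩ := exists_lower_bound (H := fun s => (γ s).im - c * |s|) (by fun_prop)
    (by
      filter_upwards [e1] with s hs
      rw [abs_of_pos hs.1]
      nlinarith [hs.1, hs.2.2.1])
    (eventually_atBot_of_neg (by
      filter_upwards [e2] with s hs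
      rw [abs_neg, abs_of_pos hs.1]
      nlinarith [hs.1, hs.2.2.1]))
  obtain ⟨C3, p3, q3⟩ := exists_lower_bound (H := fun s => |(γ s).re| - c * |s|) (by fun_prop)
    (by
      filter_upwards [e1] with s hs
      rw [abs_of_pos hs.1]
      nlinarith [hs.1, hs.2.2.2])
    (eventually_atBot_of_neg (by
      filter_upwards [e2] with s hs
      rw [abs_neg, abs_of_pos hs.1]
      nlinarith [hs.1, hs.2.2.2]))
  have hM0 : 0 ≤ M := by positivity
  refine ⟨c, hc0, M + C1 + C2 + C3, by positivity, fun s => ⟨?_, ?_, ?_⟩⟩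
  · have := q1 s
    have := abs_nonneg s
    nlinarith [mul_nonneg p1 this, mul_nonneg p2 this, mul_nonneg p3 this]
  · linarith [q2 s]
  · linarith [q3 s]

/-- The rate `η` is free, so that the loss in `e^{-tω}` can be made half of the gain from `e^{-δ Im
k}`. -/
theorem omega_lower (h : IsContour K₀ D₀ γ) (hD : 0 < D₀) {η : ℝ} (hη : 0 < η) :
    ∃ C, 0 ≤ C ∧ ∀ s, -(η * |s|) - C ≤ (omega K₀ D₀ (γ s)).re := by
  obtain ⟨p, d, h1, h2, h3, h4⟩ := h.right_end
  obtain ⟨p', d', h1', h2', h3', h4'⟩ := h.left_end'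
  have hγ := h.contDiff.continuous
  have hω := (differentiable_omega K₀ D₀).continuous
  obtain ⟨C, hC, q⟩ := exists_lower_bound (H := fun s => (omega K₀ D₀ (γ s)).re + η * |s|)
    (by fun_prop)
    (by
      filter_upwards [end_omega hD h1.ne' h2 h3 h4 hη, eventually_gt_atTop 0] with s hs h0
      rw [abs_of_pos h0]; linarith)
    (eventually_atBot_of_neg (by
      filter_upwards [end_omega hD h1'.ne h2' h3' h4' hη, eventually_gt_atTop 0] with s hs h0
      rw [abs_neg, abs_of_pos h0]; linarith))
  exact ⟨C, hC, fun s => by linarith [q s]⟩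

theorem tendsto_re_atTop (h : IsContour K₀ D₀ γ) : Tendsto (fun s => (γ s).re) atTop atTop := by
  obtain ⟨p, d, h1, -, h3, -⟩ := h.right_end
  have e1 := (Complex.continuous_re.tendsto 0).comp h3
  have e2 : Tendsto (fun s : ℝ => p.re + s * d.re) atTop atTop :=
    tendsto_atTop_add_const_left _ _ (tendsto_id.atTop_mul_const h1)
  refine (e1.add_atTop e2).congr fun s => ?_
  simp

theorem tendsto_re_atBot (h : IsContour K₀ D₀ γ) : Tendsto (fun s => (γ s).re) atBot atBot := by
  obtain ⟨p, d, h1, -, h3, -⟩ := h.left_end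
  have e1 := (Complex.continuous_re.tendsto 0).comp h3
  have e2 : Tendsto (fun s : ℝ => p.re + s * d.re) atBot atBot :=
    tendsto_atBot_add_const_left _ _ (tendsto_id.atBot_mul_const h1)
  refine (e1.add_atBot e2).congr fun s => ?_
  simp

theorem tendsto_im_atTop (h : IsContour K₀ D₀ γ) : Tendsto (fun s => (γ s).im) atTop atTop := by
  obtain ⟨c, hc, C, -, hb⟩ := h.bounds
  refine tendsto_atTop_mono (fun s => (hb s).2.1) ?_
  exact tendsto_atTop_add_const_right _ (-C)
    ((tendsto_abs_atTop_atTop).const_mul_atTop hc)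

theorem tendsto_im_atBot (h : IsContour K₀ D₀ γ) : Tendsto (fun s => (γ s).im) atBot atTop := by
  obtain ⟨c, hc, C, -, hb⟩ := h.bounds
  refine tendsto_atTop_mono (fun s => (hb s).2.1) ?_
  exact tendsto_atTop_add_const_right _ (-C)
    ((tendsto_abs_atBot_atTop).const_mul_atTop hc)

/-- A contour passes above every point `z` such that it does not meet the ray going down
from `z`. -/
theorem passesAbove_of_ray (h : IsContour K₀ D₀ γ) {z : ℂ}
    (hz : ∀ s, (γ s).re = z.re → z.im < (γ s).im) : PassesAbove γ z := by
  have hγ := h.contDiff.continuous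
  -- Multiplication by `-i` takes the ray going down from `z` to the branch cut of the principal
  -- argument, so that argument is continuous along the curve; adding `π/2` undoes the rotation.
  have hmem : ∀ s, -Complex.I * (γ s - z) ∈ Complex.slitPlane := by
    intro s
    rw [Complex.mem_slitPlane_iff]
    by_cases hs : (γ s).re = z.re
    · left; simpa using hz s hs
    · right; simpa [sub_eq_zero] using Ne.symm hs
  refine ⟨fun s hs => ?_, fun s => Complex.arg (-Complex.I * (γ s - z)) + Real.pi / 2, ?_, ?_, ?_⟩
  · exact lt_irrefl _ (hs ▸ hz s (by rw [hs]))
  · refine Continuous.add ?_ continuous_const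
    rw [continuous_iff_continuousAt]
    intro s
    exact ContinuousAt.comp (f := fun s => -Complex.I * (γ s - z))
      (Complex.continuousAt_arg (hmem s)) (by fun_prop)
  · intro s
    have h1 := Complex.norm_mul_exp_arg_mul_I (-Complex.I * (γ s - z))
    have h2 : ‖-Complex.I * (γ s - z)‖ = ‖γ s - z‖ := by simp
    rw [h2] at h1
    push_cast
    rw [mul_add, Complex.exp_add, mul_comm Complex.I (Complex.arg _ : ℂ), ← mul_assoc, h1,
      mul_comm Complex.I, Complex.exp_pi_div_two_mul_I]
    linear_combination (γ s - z) * Complex.I_mul_I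
  · have key : ∀ s, z.im < (γ s).im →
        Complex.arg (-Complex.I * (γ s - z)) + Real.pi / 2 ∈ Ioo 0 Real.pi := by
      intro s hs
      have h1 : |Complex.arg (-Complex.I * (γ s - z))| < Real.pi / 2 :=
        Complex.abs_arg_lt_pi_div_two_iff.2 (Or.inl (by simpa using hs))
      have h2 := abs_lt.1 h1
      constructor <;> linarith [h2.1, h2.2]
    exact ⟨(h.tendsto_im_atTop.eventually_gt_atTop z.im).mono key,
      (h.tendsto_im_atBot.eventually_gt_atTop z.im).mono key⟩

theorem isClosed_range (h : IsContour K₀ D₀ γ) : IsClosed (range γ) := by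
  have hc := h.contDiff.continuous
  have hp : Tendsto γ (cocompact ℝ) (cocompact ℂ) := by
    rw [← Metric.cobounded_eq_cocompact, ← Metric.cobounded_eq_cocompact,
      ← tendsto_norm_atTop_iff_cobounded]
    rw [Metric.cobounded_eq_cocompact, cocompact_eq_atBot_atTop]
    refine Tendsto.sup ?_ ?_
    · exact tendsto_atTop_mono (fun s => (le_abs_self _).trans (Complex.abs_im_le_norm _))
        h.tendsto_im_atBot
    · exact tendsto_atTop_mono (fun s => (le_abs_self _).trans (Complex.abs_im_le_norm _))
        h.tendsto_im_atTop
  exact (isProperMap_iff_tendsto_cocompact.2 ⟨hc, hp⟩).isClosedMap.isClosed_range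

/-- If `z` is closer to `z₀` than the curve is, the quotient `(γ - z)/(γ - z₀)` stays in the right
half plane. Adding its principal argument to the lift for `z₀` gives a lift for `z` that differs by
less than `π/2`. -/
theorem isOpen_passesAbove (h : IsContour K₀ D₀ γ) : IsOpen {z | PassesAbove γ z} := by
  have hγ := h.contDiff.continuous
  rw [isOpen_iff_mem_nhds]
  rintro z₀ ⟨hz, φ, hφ, hφz, ht, hb⟩
  obtain ⟨r, hr, hball⟩ := Metric.isOpen_iff.1 h.isClosed_range.isOpen_compl z₀ (by
    rintro ⟨s, hs⟩; exact hz s hs)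
  have hdist : ∀ s, r ≤ ‖γ s - z₀‖ := by
    intro s
    by_contra hlt
    exact hball (by rw [Metric.mem_ball, dist_eq_norm]; exact not_le.1 hlt) ⟨s, rfl⟩
  filter_upwards [Metric.ball_mem_nhds z₀ hr] with z hzr
  have hne : ∀ s, γ s - z₀ ≠ 0 := fun s => sub_ne_zero.2 (hz s)
  set q : ℝ → ℂ := fun s => (γ s - z) / (γ s - z₀) with hq
  have hqre : ∀ s, 0 < (q s).re := by
    intro s
    have e : q s = 1 - (z - z₀) / (γ s - z₀) := by
      have := hne s
      simp only [hq]; field_simp; ring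
    have h1 : ‖(z - z₀) / (γ s - z₀)‖ < 1 := by
      rw [norm_div, div_lt_one (norm_pos_iff.2 (hne s))]
      rw [Metric.mem_ball, dist_eq_norm] at hzr
      exact hzr.trans_le (hdist s)
    have h2 := (abs_le.1 (Complex.abs_re_le_norm ((z - z₀) / (γ s - z₀)))).2
    rw [e, Complex.sub_re, Complex.one_re]
    linarith
  have hqarg : ∀ s, |Complex.arg (q s)| < Real.pi / 2 := fun s =>
    Complex.abs_arg_lt_pi_div_two_iff.2 (Or.inl (hqre s))
  have hprod : ∀ s, γ s - z = (γ s - z₀) * q s := fun s => by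
    simp only [hq]; rw [mul_div_cancel₀ _ (hne s)]
  have hlift : ∀ s, γ s - z = (‖γ s - z‖ : ℂ) * Complex.exp (Complex.I * (φ s + Complex.arg (q s) : ℝ)) := by
    intro s
    have e1 := Complex.norm_mul_exp_arg_mul_I (q s)
    conv_lhs => rw [hprod s, hφz s, ← e1]
    rw [hprod s, norm_mul]
    push_cast
    rw [mul_add, Complex.exp_add]
    ring_nf
  -- The new argument lies in `(-π/2, 3π/2)` and has positive sine, because the curve is above the
  -- level of `z`; this forces it into `(0,π)`.
  have key : ∀ s, z.im < (γ s).im → φ s ∈ Ioo 0 Real.pi →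
      φ s + Complex.arg (q s) ∈ Ioo 0 Real.pi := by
    intro s hs hφs
    have h2 := abs_lt.1 (hqarg s)
    have h3 : (γ s - z).im = ‖γ s - z‖ * Real.sin (φ s + Complex.arg (q s)) := by
      conv_lhs => rw [hlift s]
      rw [Complex.im_ofReal_mul, mul_comm Complex.I, Complex.exp_ofReal_mul_I_im]
    have h4 : 0 < Real.sin (φ s + Complex.arg (q s)) := by
      have h5 : 0 < (γ s - z).im := by rw [Complex.sub_im]; linarith
      rw [h3] at h5
      exact (pos_iff_pos_of_mul_pos h5).1 (lt_of_le_of_ne (norm_nonneg _) fun h0 => by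
        rw [← h0, zero_mul] at h5; exact lt_irrefl _ h5)
    constructor
    · by_contra hneg
      have := Real.sin_nonpos_of_nonpos_of_neg_pi_le (not_lt.1 hneg)
        (by linarith [hφs.1, h2.1, Real.pi_pos])
      linarith
    · by_contra hneg
      have h6 : 0 ≤ Real.sin (φ s + Complex.arg (q s) - Real.pi) :=
        Real.sin_nonneg_of_nonneg_of_le_pi (by linarith [not_lt.1 hneg])
          (by linarith [hφs.2, h2.2, Real.pi_pos])
      rw [Real.sin_sub_pi] at h6
      linarith
  refine ⟨fun s hs => ?_, fun s => φ s + Complex.arg (q s), ?_, hlift, ?_, ?_⟩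
  · have := hprod s
    rw [hs, sub_self] at this
    rcases mul_eq_zero.1 this.symm with h0 | h0
    · exact hne s (by rw [hs]; exact h0)
    · have := hqre s; rw [h0] at this; simp at this
  · refine hφ.add ?_
    rw [continuous_iff_continuousAt]
    intro s
    refine ContinuousAt.comp (f := q) (Complex.continuousAt_arg
      (Complex.mem_slitPlane_iff.2 (Or.inl (hqre s)))) ?_
    exact ContinuousAt.div (by fun_prop) (by fun_prop) (hne s)
  · filter_upwards [ht, h.tendsto_im_atTop.eventually_gt_atTop z.im] with s h1 h2 using key s h2 h1
  · filter_upwards [hb, h.tendsto_im_atBot.eventually_gt_atTop z.im] with s h1 h2 using key s h2 h1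

/-- A contour passes above all points of a horizontal strip that are far away or below the real
axis. -/
theorem passesAbove_far (h : IsContour K₀ D₀ γ) (M : ℝ) : ∃ X : ℝ, ∀ z : ℂ, z.im ≤ M →
    (z.im < 0 ∨ X < |z.re|) → PassesAbove γ z := by
  obtain ⟨c, hc, C, hC, hb⟩ := h.bounds
  -- If `Re γ(s) = Re z` exceeds this bound in modulus, then `|s| > (|M| + C)/c`, and so `Im γ(s) >
  -- |M| ≥ Im z`.
  refine ⟨C * (1 + (|M| + C) / c), fun z hzM hz => h.passesAbove_of_ray fun s hs => ?_⟩
  rcases hz with hz | hz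
  · exact hz.trans_le (h.im_nonneg s)
  · have h1 : |z.re| ≤ C * (1 + |s|) := by
      rw [← hs]; exact (Complex.abs_re_le_norm _).trans (hb s).1
    have h2 : (|M| + C) / c < |s| := by
      by_contra hle
      have := mul_le_mul_of_nonneg_left (not_lt.1 hle) hC
      nlinarith
    rw [div_lt_iff₀ hc] at h2
    have := (hb s).2.1
    have := le_abs_self M
    nlinarith

end IsContour

end

/-! ### Exponential decay and deformation of contours -/

section

theorem exists_pow_le_exp {c : ℝ} (hc : 0 < c) (n : ℕ) :
    ∃ B, 0 < B ∧ ∀ y, 0 ≤ y → (1 + y) ^ n ≤ B * Real.exp (c * y) := by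
  refine ⟨n.factorial / c ^ n * Real.exp c, by positivity, fun y hy => ?_⟩
  have h := Real.pow_div_factorial_le_exp (c * (1 + y)) (by positivity) n
  rw [div_le_iff₀ (by positivity), mul_pow] at h
  have e : c * (1 + y) = c + c * y := by ring
  rw [e, Real.exp_add] at h
  have hcn : 0 < c ^ n := by positivity
  rw [div_mul_eq_mul_div, div_mul_eq_mul_div, le_div_iff₀ hcn]
  linarith

/-- A polynomial factor is absorbed in an exponential decay. -/
theorem exists_pow_mul_exp_le {c : ℝ} (hc : 0 < c) (n : ℕ) :
    ∃ B, 0 < B ∧ ∀ y, 0 ≤ y → (1 + y) ^ n * Real.exp (-(c * y)) ≤ B * Real.exp (-(c / 2 * y)) := by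
  obtain ⟨B, hB, h⟩ := exists_pow_le_exp (half_pos hc) n
  refine ⟨B, hB, fun y hy => ?_⟩
  have e : -(c * y) = -(c / 2 * y) + -(c / 2 * y) := by ring
  have e2 : Real.exp (c / 2 * y) * Real.exp (-(c / 2 * y)) = 1 := by
    rw [← Real.exp_add]; simp
  rw [e, Real.exp_add]
  calc (1 + y) ^ n * (Real.exp (-(c / 2 * y)) * Real.exp (-(c / 2 * y)))
      ≤ (B * Real.exp (c / 2 * y)) * (Real.exp (-(c / 2 * y)) * Real.exp (-(c / 2 * y))) := by
        gcongr; exact h y hy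
    _ = B * (Real.exp (c / 2 * y) * Real.exp (-(c / 2 * y))) * Real.exp (-(c / 2 * y)) := by ring
    _ = _ := by rw [e2, mul_one]

theorem integrable_exp_neg_abs {c : ℝ} (hc : 0 < c) :
    Integrable fun s : ℝ => Real.exp (-(c * |s|)) := by
  have h1 : IntegrableOn (fun s : ℝ => Real.exp (-(c * |s|))) (Ioi 0) := by
    refine (integrableOn_exp_mul_Ioi (neg_lt_zero.2 hc) 0).congr_fun (fun s hs => ?_)
      measurableSet_Ioi
    simp only [abs_of_pos (mem_Ioi.1 hs), neg_mul]
  have h3 : IntegrableOn (fun s : ℝ => Real.exp (-(c * |s|))) (Iic 0) := by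
    refine (integrableOn_exp_mul_Iic hc 0).congr_fun (fun s hs => ?_) measurableSet_Iic
    simp only [abs_of_nonpos (mem_Iic.1 hs), mul_neg, neg_neg]
  rw [← integrableOn_univ, ← Iic_union_Ioi (a := (0 : ℝ))]
  exact h3.union h1

theorem tendsto_exp_neg_mul {c : ℝ} (hc : 0 < c) :
    Tendsto (fun S : ℝ => Real.exp (-(c * S))) atTop (𝓝 0) :=
  Real.tendsto_exp_neg_atTop_nhds_zero.comp (tendsto_id.const_mul_atTop hc)

/-- The argument of a curve that stays in the upper half plane stays in `(0,π)`. -/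
theorem arg_mem_of_eventually {φ : ℝ → ℝ} (hφ : Continuous φ) {S : ℝ}
    (h1 : ∀ s, S ≤ s → 0 < Real.sin (φ s)) (h2 : ∀ᶠ s in atTop, φ s ∈ Ioo 0 Real.pi) :
    φ S ∈ Ioo 0 Real.pi := by
  obtain ⟨T, hT, hST⟩ := (h2.and (eventually_ge_atTop S)).exists
  constructor
  · by_contra hneg
    obtain ⟨s, hs, hs0⟩ := intermediate_value_Icc hST hφ.continuousOn
      (show (0 : ℝ) ∈ Icc (φ S) (φ T) from ⟨not_lt.1 hneg, hT.1.le⟩)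
    have := h1 s hs.1
    rw [hs0, Real.sin_zero] at this
    exact lt_irrefl _ this
  · by_contra hneg
    obtain ⟨s, hs, hs0⟩ := intermediate_value_Icc' hST hφ.continuousOn
      (show Real.pi ∈ Icc (φ T) (φ S) from ⟨hT.2.le, not_lt.1 hneg⟩)
    have := h1 s hs.1
    rw [hs0, Real.sin_pi] at this
    exact lt_irrefl _ this

variable {K₀ D₀ : ℝ} {γ : ℝ → ℂ}

theorem IsContour.continuous_deriv (h : IsContour K₀ D₀ γ) : Continuous (deriv γ) :=
  h.contDiff.continuous_deriv le_rfl

theorem IsFavourable.ne_zero {E : ℂ → ℂ} (h : IsFavourable K₀ D₀ E γ) (s : ℝ) : E (γ s) ≠ 0 :=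
  fun h0 => (h.2 _ h0).1 s rfl

/-- Far out, a favourable contour may be replaced by its chord. -/
theorem IsFavourable.chordEq {E : ℂ → ℂ} (hγ : IsFavourable K₀ D₀ E γ) {h : ℂ → ℂ}
    (hh : Differentiable ℂ h) (hE : Differentiable ℂ E) {w : ℂ} (hw : E w ≠ 0) {M : ℝ}
    (hM : ∀ z, E z = 0 → z.im < M) {S : ℝ} (hS : 0 ≤ S) (hγS : ∀ s, S ≤ |s| → M ≤ (γ s).im) :
    ChordEq γ (-S) S fun k => h k / E k := by
  refine chordEq_div hγ.1.contDiff (by linarith) hh hE hw fun z hz => ?_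
  obtain ⟨hne, φ, hφ, hφz, ht, hb⟩ := hγ.2 z hz
  -- For `|s| ≥ S` the contour is above the level of every zero. The sine of the argument is then
  -- positive, so an argument that is in `(0,π)` near the ends is there already at `±S`, as
  -- `ChordEq.inv_sub` requires.
  have hpos : ∀ s, S ≤ |s| → z.im < (γ s).im := fun s hs => (hM z hz).trans_le (hγS s hs)
  have hsin : ∀ s, S ≤ |s| → 0 < Real.sin (φ s) := by
    intro s hs
    have h1 : (γ s - z).im = ‖γ s - z‖ * Real.sin (φ s) := by
      conv_lhs => rw [hφz s]
      rw [Complex.im_ofReal_mul, mul_comm Complex.I, Complex.exp_ofReal_mul_I_im]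
    have h2 : 0 < (γ s - z).im := by rw [Complex.sub_im]; linarith [hpos s hs]
    rw [h1] at h2
    exact (pos_iff_pos_of_mul_pos h2).1 (norm_pos_iff.2 (sub_ne_zero.2 (hne s)))
  refine ChordEq.inv_sub hγ.1.contDiff hne hφ hφz ?_ ?_ (hpos _ ?_) (hpos _ ?_)
  · have h3 := arg_mem_of_eventually (φ := fun s => φ (-s)) (S := S) (by fun_prop)
      (fun s hs => hsin _ (by rw [abs_neg]; exact hs.trans (le_abs_self s)))
      (tendsto_neg_atTop_atBot.eventually hb)
    exact h3
  · exact arg_mem_of_eventually hφ (fun s hs => hsin _ (hs.trans (le_abs_self s))) ht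
  · rw [abs_neg]; exact le_abs_self S
  · exact le_abs_self S

/-- The integral of `h/E` along a favourable contour vanishes if `h/E` decays exponentially in the
upper half plane. -/
theorem IsFavourable.integral_eq_zero {E : ℂ → ℂ} (hγ : IsFavourable K₀ D₀ E γ) {h : ℂ → ℂ}
    (hh : Differentiable ℂ h) (hE : Differentiable ℂ E) {w : ℂ} (hw : E w ≠ 0) {M : ℝ}
    (hM : ∀ z, E z = 0 → z.im < M) {A δ : ℝ} {n : ℕ} (hA : 0 ≤ A) (hδ : 0 < δ)
    (hb : ∀ k : ℂ, M ≤ k.im → ‖h k / E k‖ ≤ A * (1 + ‖k‖) ^ n * Real.exp (-(δ * k.im)))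
    (hint : Integrable (pullback γ fun k => h k / E k)) :
    contourIntegral γ (fun k => h k / E k) = 0 := by
  obtain ⟨c, hc, C, hC, hγb⟩ := hγ.1.bounds
  have e1 := intervalIntegral_tendsto_integral hint tendsto_neg_atTop_atBot tendsto_id
  refine tendsto_nhds_unique e1 ?_
  obtain ⟨B, hB, hpow⟩ := exists_pow_mul_exp_le (mul_pos hδ hc) (n + 1)
  rw [tendsto_zero_iff_norm_tendsto_zero]
  have hlim : Tendsto (fun S : ℝ => A * (1 + C) ^ n * (2 * C) * Real.exp (δ * C) * B *
      Real.exp (-(δ * c / 2 * S))) atTop (𝓝 0) := by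
    simpa using (tendsto_exp_neg_mul (c := δ * c / 2) (by positivity)).const_mul
      (A * (1 + C) ^ n * (2 * C) * Real.exp (δ * C) * B)
  refine squeeze_zero' (Eventually.of_forall fun _ => norm_nonneg _) ?_ hlim
  filter_upwards [eventually_ge_atTop (max 0 ((M + C) / c))] with S hS
  have hS0 : 0 ≤ S := (le_max_left _ _).trans hS
  have hSM : M ≤ c * S - C := by
    have := (le_max_right _ _).trans hS
    rw [div_le_iff₀ hc] at this
    linarith
  -- The chord from `γ(-S)` to `γ(S)` lies above the level `cS - C` and has length `O(S)`, so its
  -- integral is `O(S^{n+1} e^{-δcS})`.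
  have hchord := hγ.chordEq hh hE hw hM hS0 fun s hs => by
    have := (hγb s).2.1
    nlinarith
  unfold ChordEq at hchord
  have e2 : ∫ s in (-S)..(id S), pullback γ (fun k => h k / E k) s
      = ∫ u in (0 : ℝ)..1, (fun k => h k / E k) (γ (-S) + u * (γ S - γ (-S))) * (γ S - γ (-S)) :=
    hchord
  rw [e2]
  have n1 : ‖γ S‖ ≤ C * (1 + S) := by have := (hγb S).1; rwa [abs_of_nonneg hS0] at this
  have n2 : ‖γ (-S)‖ ≤ C * (1 + S) := by
    have := (hγb (-S)).1; rwa [abs_neg, abs_of_nonneg hS0] at this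
  have i1 : c * S - C ≤ (γ S).im := by have := (hγb S).2.1; rwa [abs_of_nonneg hS0] at this
  have i2 : c * S - C ≤ (γ (-S)).im := by
    have := (hγb (-S)).2.1; rwa [abs_neg, abs_of_nonneg hS0] at this
  have hbound : ∀ u ∈ uIoc (0 : ℝ) 1,
      ‖(fun k => h k / E k) (γ (-S) + u * (γ S - γ (-S))) * (γ S - γ (-S))‖ ≤
        A * (1 + C * (1 + S)) ^ n * Real.exp (-(δ * (c * S - C))) * (2 * (C * (1 + S))) := by
    intro u hu
    rw [uIoc_of_le zero_le_one] at hu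
    set k := γ (-S) + u * (γ S - γ (-S)) with hk
    have hke : k = (1 - u : ℝ) * γ (-S) + (u : ℝ) * γ S := by rw [hk]; push_cast; ring
    have him : c * S - C ≤ k.im := by
      rw [hke, Complex.add_im, Complex.im_ofReal_mul, Complex.im_ofReal_mul]
      nlinarith [hu.1, hu.2]
    have hkn : ‖k‖ ≤ C * (1 + S) := by
      rw [hke]
      refine (norm_add_le _ _).trans ?_
      rw [norm_mul, norm_mul, Complex.norm_real, Complex.norm_real,
        Real.norm_of_nonneg (by linarith [hu.2]), Real.norm_of_nonneg hu.1.le]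
      nlinarith [hu.1, hu.2]
    rw [norm_mul]
    refine mul_le_mul ((hb k (hSM.trans him)).trans ?_) ?_ (norm_nonneg _) (by positivity)
    · gcongr
    · refine (norm_sub_le _ _).trans ?_
      linarith
  refine (intervalIntegral.norm_integral_le_of_norm_le_const hbound).trans ?_
  rw [sub_zero, abs_one, mul_one]
  have f1 : (1 + C * (1 + S)) ^ n ≤ ((1 + C) * (1 + S)) ^ n := by
    gcongr; nlinarith
  have f2 : Real.exp (-(δ * (c * S - C))) = Real.exp (δ * C) * Real.exp (-(δ * c * S)) := by
    rw [← Real.exp_add]; congr 1; ring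
  calc A * (1 + C * (1 + S)) ^ n * Real.exp (-(δ * (c * S - C))) * (2 * (C * (1 + S)))
      ≤ A * ((1 + C) * (1 + S)) ^ n * (Real.exp (δ * C) * Real.exp (-(δ * c * S)))
        * (2 * (C * (1 + S))) := by
        rw [f2]; gcongr
    _ = A * (1 + C) ^ n * (2 * C) * Real.exp (δ * C) *
        ((1 + S) ^ (n + 1) * Real.exp (-(δ * c * S))) := by
        rw [mul_pow, pow_succ]; ring
    _ ≤ A * (1 + C) ^ n * (2 * C) * Real.exp (δ * C) * (B * Real.exp (-(δ * c / 2 * S))) := by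
        exact mul_le_mul_of_nonneg_left (hpow S hS0) (by positivity)
    _ = _ := by ring

/-- On the vertical segments joining a contour to a horizontal line, `e^{-δ Im k - τ ω(k)}` decays
exponentially. -/
theorem IsContour.vertical_decay (hγ : IsContour K₀ D₀ γ) (hD : 0 < D₀) {δ τ : ℝ} (hδ : 0 < δ)
    (hτ : 0 < τ) (y₀ : ℝ) : ∃ c, 0 < c ∧ ∃ B, 0 < B ∧ ∀ s, ∀ v ∈ Icc (0 : ℝ) 1, ∀ k : ℂ,
      k.re = (γ s).re → k.im = (1 - v) * y₀ + v * (γ s).im →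
      Real.exp (-(δ * k.im)) * Real.exp (-(τ * (omega K₀ D₀ k).re)) ≤ B * Real.exp (-(c * |s|)) := by
  obtain ⟨c, hc, C, hC, hb⟩ := hγ.bounds
  -- With this `η` the possible growth of `e^{-τω}` along the contour uses up half of the decay of
  -- `e^{-δ Im k}`.
  obtain ⟨C', hC', hω⟩ := hγ.omega_lower hD (η := δ * c / (2 * τ)) (by positivity)
  set c₁ := min (2 * τ * D₀ * c) (δ * c / 2) with hc₁
  set B₁ := |-(δ * y₀) + τ * (D₀ * y₀ ^ 2 + K₀ * y₀) + τ * D₀ * (2 * C + 1)| with hB₁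
  set B₂ := δ * C + τ * C' with hB₂
  have hB₂0 : 0 ≤ B₂ := by positivity
  refine ⟨c₁, lt_min (by positivity) (by positivity), Real.exp (B₁ + B₂), Real.exp_pos _, ?_⟩
  intro s v hv k hre him
  rw [← Real.exp_add, ← Real.exp_add, Real.exp_le_exp]
  have l1 : c₁ ≤ 2 * τ * D₀ * c := min_le_left _ _
  have l2 : c₁ ≤ δ * c / 2 := min_le_right _ _
  have hs := abs_nonneg s
  set a := (γ s).re with ha
  set b := (γ s).im with hbdef
  have h1 : -(δ * y₀) - τ * (D₀ * (a ^ 2 - y₀ ^ 2) - K₀ * y₀) ≤ B₁ + -(c₁ * |s|) := by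
    -- From `a² ≥ 2|a| - 1`: on the horizontal line the Gaussian decay in `Re k` is weakened to an
    -- exponential one.
    have q1 : 2 * c * |s| - 2 * C - 1 ≤ a ^ 2 := by
      have q2 := (hb s).2.2
      have q3 : a ^ 2 = |a| ^ 2 := (sq_abs a).symm
      nlinarith [sq_nonneg (|a| - 1)]
    have q4 := mul_le_mul_of_nonneg_left q1 (by positivity : 0 ≤ τ * D₀)
    have q5 := le_abs_self (-(δ * y₀) + τ * (D₀ * y₀ ^ 2 + K₀ * y₀) + τ * D₀ * (2 * C + 1))
    have q6 := mul_le_mul_of_nonneg_right l1 hs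
    rw [← hB₁] at q5
    nlinarith
  have h2 : -(δ * b) - τ * (omega K₀ D₀ (γ s)).re ≤ B₂ + -(c₁ * |s|) := by
    have q1 := mul_le_mul_of_nonneg_left (hω s) hτ.le
    have q2 := mul_le_mul_of_nonneg_left (hb s).2.1 hδ.le
    have q3 : τ * (-(δ * c / (2 * τ) * |s|) - C') = -(δ * c / 2 * |s|) - τ * C' := by
      field_simp
    have q6 := mul_le_mul_of_nonneg_right l2 hs
    rw [q3] at q1
    rw [hB₂]
    nlinarith
  rw [re_omega] at h2
  have h3 : (omega K₀ D₀ k).re = D₀ * (a ^ 2 - k.im ^ 2) - K₀ * k.im := by rw [re_omega, hre]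
  -- At fixed `Re k` the exponent `-δ Im k - τ Re ω` is convex in `Im k`, so on a vertical segment
  -- it is bounded by the same convex combination of its values on the line and on the contour.
  have hconv : k.im ^ 2 ≤ (1 - v) * y₀ ^ 2 + v * b ^ 2 := by
    rw [him]
    nlinarith [mul_nonneg (mul_nonneg (sub_nonneg.2 hv.2) hv.1) (sq_nonneg (y₀ - b))]
  have h4 : -(δ * k.im) + -(τ * (omega K₀ D₀ k).re) ≤
      (1 - v) * (-(δ * y₀) - τ * (D₀ * (a ^ 2 - y₀ ^ 2) - K₀ * y₀)) +
      v * (-(δ * b) - τ * (D₀ * (a ^ 2 - b ^ 2) - K₀ * b)) := by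
    rw [h3]
    have := mul_le_mul_of_nonneg_left hconv (by positivity : 0 ≤ τ * D₀)
    have e : δ * k.im = (1 - v) * (δ * y₀) + v * (δ * b) := by rw [him]; ring
    have e' : τ * K₀ * k.im = (1 - v) * (τ * K₀ * y₀) + v * (τ * K₀ * b) := by rw [him]; ring
    nlinarith
  have h5 : (1 - v) * (-(δ * y₀) - τ * (D₀ * (a ^ 2 - y₀ ^ 2) - K₀ * y₀)) ≤
      (1 - v) * (B₁ + B₂ + -(c₁ * |s|)) :=
    mul_le_mul_of_nonneg_left (by linarith) (sub_nonneg.2 hv.2)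
  have h6 : v * (-(δ * b) - τ * (D₀ * (a ^ 2 - b ^ 2) - K₀ * b)) ≤
      v * (B₁ + B₂ + -(c₁ * |s|)) :=
    mul_le_mul_of_nonneg_left (by linarith [abs_nonneg (-(δ * y₀) + τ * (D₀ * y₀ ^ 2 + K₀ * y₀) + τ * D₀ * (2 * C + 1))]) hv.1
  linarith

/-- The growth condition under which a contour may be moved to a horizontal line. -/
def HeatBound (K₀ D₀ δ t₁ t₂ A : ℝ) (Ψ : ℂ → ℂ) : Prop :=
  ∀ k : ℂ, ‖Ψ k‖ ≤ A * (1 + ‖k‖) * Real.exp (-(δ * k.im)) *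
    (Real.exp (-(t₁ * (omega K₀ D₀ k).re)) + Real.exp (-(t₂ * (omega K₀ D₀ k).re)))

/-- Each of the two exponentials decays by `IsContour.vertical_decay`; the factor `1 + ‖k‖` grows
linearly in `s` and costs half of the rate. -/
theorem HeatBound.vertical_decay {δ t₁ t₂ A : ℝ} {Ψ : ℂ → ℂ} (hΨ : HeatBound K₀ D₀ δ t₁ t₂ A Ψ)
    (hA : 0 ≤ A) (hγ : IsContour K₀ D₀ γ) (hD : 0 < D₀) (hδ : 0 < δ) (h1 : 0 < t₁) (h2 : 0 < t₂)
    (y₀ : ℝ) : ∃ c, 0 < c ∧ ∃ B, 0 < B ∧ ∀ s, ∀ v ∈ Icc (0 : ℝ) 1, ∀ k : ℂ,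
      k.re = (γ s).re → k.im = (1 - v) * y₀ + v * (γ s).im → ‖Ψ k‖ ≤ B * Real.exp (-(c * |s|)) := by
  obtain ⟨c₁, hc₁, B₁, hB₁, e1⟩ := hγ.vertical_decay hD hδ h1 y₀
  obtain ⟨c₂, hc₂, B₂, hB₂, e2⟩ := hγ.vertical_decay hD hδ h2 y₀
  obtain ⟨c₃, -, C, hC, hb⟩ := hγ.bounds
  set c := min c₁ c₂ with hc
  have hc0 : 0 < c := lt_min hc₁ hc₂
  obtain ⟨B, hB, hpow⟩ := exists_pow_mul_exp_le hc0 1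
  refine ⟨c / 2, by positivity, A * (1 + 2 * C + |y₀|) * (B₁ + B₂) * B + 1, by positivity, ?_⟩
  intro s v hv k hre him
  have hs := abs_nonneg s
  have f1 := e1 s v hv k hre him
  have f2 := e2 s v hv k hre him
  have g1 : Real.exp (-(c₁ * |s|)) ≤ Real.exp (-(c * |s|)) :=
    Real.exp_le_exp.2 (by nlinarith [min_le_left c₁ c₂])
  have g2 : Real.exp (-(c₂ * |s|)) ≤ Real.exp (-(c * |s|)) :=
    Real.exp_le_exp.2 (by nlinarith [min_le_right c₁ c₂])
  have hk : 1 + ‖k‖ ≤ (1 + 2 * C + |y₀|) * (1 + |s|) := by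
    have q1 := Complex.norm_le_abs_re_add_abs_im k
    have q2 : |k.re| ≤ C * (1 + |s|) := by
      rw [hre]; exact (Complex.abs_re_le_norm _).trans (hb s).1
    have q3 : |k.im| ≤ |y₀| + C * (1 + |s|) := by
      rw [him]
      refine (abs_add_le _ _).trans ?_
      rw [abs_mul, abs_mul, abs_of_nonneg (sub_nonneg.2 hv.2), abs_of_nonneg hv.1]
      have q4 := (Complex.abs_im_le_norm (γ s)).trans (hb s).1
      have q5 := abs_nonneg (γ s).im
      nlinarith [hv.1, hv.2, abs_nonneg y₀]
    nlinarith [mul_nonneg (abs_nonneg y₀) hs]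
  calc ‖Ψ k‖ ≤ _ := hΨ k
    _ = A * (1 + ‖k‖) * (Real.exp (-(δ * k.im)) * Real.exp (-(t₁ * (omega K₀ D₀ k).re)) +
        Real.exp (-(δ * k.im)) * Real.exp (-(t₂ * (omega K₀ D₀ k).re))) := by ring
    _ ≤ A * ((1 + 2 * C + |y₀|) * (1 + |s|)) * (B₁ * Real.exp (-(c * |s|)) +
        B₂ * Real.exp (-(c * |s|))) := by
        refine mul_le_mul (mul_le_mul_of_nonneg_left hk hA) (add_le_add (f1.trans ?_) (f2.trans ?_))
          (by positivity) (by positivity)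
        · exact mul_le_mul_of_nonneg_left g1 hB₁.le
        · exact mul_le_mul_of_nonneg_left g2 hB₂.le
    _ = A * (1 + 2 * C + |y₀|) * (B₁ + B₂) * ((1 + |s|) ^ 1 * Real.exp (-(c * |s|))) := by ring
    _ ≤ A * (1 + 2 * C + |y₀|) * (B₁ + B₂) * (B * Real.exp (-(c / 2 * |s|))) := by
        exact mul_le_mul_of_nonneg_left (hpow _ hs) (by positivity)
    _ ≤ _ := by nlinarith [Real.exp_pos (-(c / 2 * |s|))]

theorem HeatBound.integrable_line {δ t₁ t₂ A : ℝ} {Ψ : ℂ → ℂ} (hΨ : HeatBound K₀ D₀ δ t₁ t₂ A Ψ)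
    (hA : 0 ≤ A) (hc : Continuous Ψ) (hD : 0 < D₀) (h1 : 0 < t₁) (h2 : 0 < t₂) (y₀ : ℝ) :
    Integrable fun r : ℝ => Ψ (r + y₀ * Complex.I) := by
  set c := min (2 * t₁ * D₀) (2 * t₂ * D₀) with hcdef
  have hc0 : 0 < c := lt_min (by positivity) (by positivity)
  obtain ⟨B, hB, hpow⟩ := exists_pow_mul_exp_le hc0 1
  set E : ℝ → ℝ := fun τ => Real.exp (τ * (D₀ * (1 + y₀ ^ 2) + K₀ * y₀)) with hE
  refine Integrable.mono' (g := fun r : ℝ => A * (1 + |y₀|) * Real.exp (-(δ * y₀)) *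
    (E t₁ + E t₂) * B * Real.exp (-(c / 2 * |r|)))
    ((integrable_exp_neg_abs (by positivity)).const_mul _)
    (Continuous.aestronglyMeasurable (by fun_prop)) (Eventually.of_forall fun r => ?_)
  have hr := abs_nonneg r
  set k : ℂ := r + y₀ * Complex.I with hk
  have hre : k.re = r := by simp [hk]
  have him : k.im = y₀ := by simp [hk]
  have hτ : ∀ τ, 0 < τ → c ≤ 2 * τ * D₀ →
      Real.exp (-(τ * (omega K₀ D₀ k).re)) ≤ E τ * Real.exp (-(c * |r|)) := by
    intro τ hτ hcτ
    rw [hE, ← Real.exp_add, Real.exp_le_exp, re_omega, hre, him]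
    have q1 : 2 * |r| - 1 ≤ r ^ 2 := by
      rw [← sq_abs r]; nlinarith [sq_nonneg (|r| - 1)]
    have q2 := mul_le_mul_of_nonneg_left q1 (by positivity : 0 ≤ τ * D₀)
    have q3 := mul_le_mul_of_nonneg_right hcτ hr
    nlinarith
  have hkn : 1 + ‖k‖ ≤ (1 + |y₀|) * (1 + |r|) := by
    have q1 := Complex.norm_le_abs_re_add_abs_im k
    rw [hre, him] at q1
    nlinarith [mul_nonneg hr (abs_nonneg y₀)]
  calc ‖Ψ k‖ ≤ _ := hΨ k
    _ ≤ A * ((1 + |y₀|) * (1 + |r|)) * Real.exp (-(δ * y₀)) *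
        (E t₁ * Real.exp (-(c * |r|)) + E t₂ * Real.exp (-(c * |r|))) := by
        rw [him]
        gcongr
        · exact hτ t₁ h1 (min_le_left _ _)
        · exact hτ t₂ h2 (min_le_right _ _)
    _ = A * (1 + |y₀|) * Real.exp (-(δ * y₀)) * (E t₁ + E t₂) *
        ((1 + |r|) ^ 1 * Real.exp (-(c * |r|))) := by ring
    _ ≤ A * (1 + |y₀|) * Real.exp (-(δ * y₀)) * (E t₁ + E t₂) *
        (B * Real.exp (-(c / 2 * |r|))) := by
        have : 0 ≤ E t₁ + E t₂ := by simp only [hE]; positivity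
        exact mul_le_mul_of_nonneg_left (hpow _ hr) (by positivity)
    _ = _ := by ring

/-- A contour may be moved to any horizontal line if the integrand has heat-kernel decay. -/
theorem HeatBound.contourIntegral_eq {δ t₁ t₂ A : ℝ} {Ψ : ℂ → ℂ}
    (hΨ : HeatBound K₀ D₀ δ t₁ t₂ A Ψ) (hA : 0 ≤ A) (hd : Differentiable ℂ Ψ)
    (hγ : IsContour K₀ D₀ γ) (hD : 0 < D₀) (hδ : 0 < δ) (h1 : 0 < t₁) (h2 : 0 < t₂) (y₀ : ℝ) :
    Integrable (pullback γ Ψ) ∧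
      contourIntegral γ Ψ = ∫ r : ℝ, Ψ (r + y₀ * Complex.I) := by
  obtain ⟨c, hc, B, hB, hv⟩ := hΨ.vertical_decay hA hγ hD hδ h1 h2 y₀
  obtain ⟨C', hC'⟩ := hγ.bounded_deriv
  obtain ⟨c₃, -, C, hC, hb⟩ := hγ.bounds
  have hγc := hγ.contDiff.continuous
  have hint : Integrable (pullback γ Ψ) := by
    refine Integrable.mono' (g := fun s => B * Real.exp (-(c * |s|)) * C')
      (((integrable_exp_neg_abs hc).const_mul B).mul_const C')
      (Continuous.aestronglyMeasurable ?_) (Eventually.of_forall fun s => ?_)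
    · exact (hd.continuous.comp hγc).mul hγ.continuous_deriv
    · rw [pullback, norm_mul]
      exact mul_le_mul (hv s 1 (by simp) _ rfl (by simp)) (hC' s) (norm_nonneg _) (by positivity)
  refine ⟨hint, ?_⟩
  -- An entire function has a primitive `P`, so both truncated integrals are increments of `P`. They
  -- differ by the increments over the vertical segments from `ρ s` to `γ s`, which tend to zero.
  obtain ⟨P, hP⟩ := hd.isExactOn_univ
  have hP' : ∀ k, HasDerivAt P (Ψ k) k := fun k => hP k (mem_univ k)
  set ρ : ℝ → ℂ := fun s => ((γ s).re : ℂ) + y₀ * Complex.I with hρ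
  have hdiff : ∀ s, ‖P (γ s) - P (ρ s)‖ ≤
      B * Real.exp (-(c * |s|)) * (C * (1 + |s|) + |y₀|) := by
    intro s
    have hsub : γ s - ρ s = ((γ s).im - y₀ : ℝ) * Complex.I := by
      apply Complex.ext <;> simp [hρ]
    have hmv := Convex.norm_image_sub_le_of_norm_deriv_le (f := P) (s := segment ℝ (ρ s) (γ s))
      (C := B * Real.exp (-(c * |s|))) (x := ρ s) (y := γ s)
      (fun k _ => (hP' k).differentiableAt) ?_ (convex_segment _ _) (left_mem_segment _ _ _)
      (right_mem_segment _ _ _)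
    · refine hmv.trans ?_
      gcongr
      rw [hsub, norm_mul, Complex.norm_I, mul_one, Complex.norm_real]
      refine (norm_sub_le _ _).trans ?_
      have := (Complex.abs_im_le_norm (γ s)).trans (hb s).1
      simpa using this
    · rintro k ⟨u, v, hu, hv', huv, rfl⟩
      rw [(hP' _).deriv]
      refine hv s v ⟨hv', by linarith⟩ _ ?_ ?_
      · simp [hρ]; rw [← add_mul, huv, one_mul]
      · have : u = 1 - v := by linarith
        simp [hρ, this]
  have hdlim : Tendsto (fun s : ℝ => B * Real.exp (-(c * |s|)) * (C * (1 + |s|) + |y₀|))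
      (atTop) (𝓝 0) := by
    obtain ⟨B', hB', hpow⟩ := exists_pow_mul_exp_le hc 1
    have hl : Tendsto (fun s : ℝ => B * (C + |y₀|) * B' * Real.exp (-(c / 2 * s))) atTop (𝓝 0) := by
      simpa using (tendsto_exp_neg_mul (half_pos hc)).const_mul (B * (C + |y₀|) * B')
    refine squeeze_zero' (Eventually.of_forall fun s => by positivity) ?_ hl
    filter_upwards [eventually_ge_atTop 0] with s hs
    rw [abs_of_nonneg hs]
    calc B * Real.exp (-(c * s)) * (C * (1 + s) + |y₀|)
        ≤ B * Real.exp (-(c * s)) * ((C + |y₀|) * (1 + s)) := by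
          gcongr; nlinarith [abs_nonneg y₀]
      _ = B * (C + |y₀|) * ((1 + s) ^ 1 * Real.exp (-(c * s))) := by ring
      _ ≤ B * (C + |y₀|) * (B' * Real.exp (-(c / 2 * s))) := by
          exact mul_le_mul_of_nonneg_left (hpow s hs) (by positivity)
      _ = _ := by ring
  have t1 : Tendsto (fun s => P (γ s) - P (ρ s)) atTop (𝓝 0) :=
    squeeze_zero_norm hdiff hdlim
  have t2 : Tendsto (fun s => P (γ (-s)) - P (ρ (-s))) atTop (𝓝 0) :=
    squeeze_zero_norm (fun s => by simpa using hdiff (-s)) hdlim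
  have l1 := intervalIntegral_tendsto_integral hint tendsto_neg_atTop_atBot tendsto_id
  -- The line is truncated at the real parts of `γ(±S)`, so that the segments closing the path are
  -- vertical.
  have l2 := intervalIntegral_tendsto_integral
    (hΨ.integrable_line hA hd.continuous hD h1 h2 y₀)
    (hγ.tendsto_re_atBot.comp tendsto_neg_atTop_atBot) hγ.tendsto_re_atTop
  have e1 : ∀ S : ℝ, ∫ s in (-S)..(id S), pullback γ Ψ s = P (γ S) - P (γ (-S)) := by
    intro S
    refine intervalIntegral.integral_eq_sub_of_hasDerivAt (f := fun s => P (γ s)) (fun s _ => ?_)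
      (hint.intervalIntegrable)
    exact (hP' _).comp_of_eq s
      ((hγ.contDiff.differentiable one_ne_zero).differentiableAt.hasDerivAt) rfl
  have e2 : ∀ S : ℝ, ∫ r in ((fun s => (γ s).re) ∘ Neg.neg) S..(γ S).re, Ψ (r + y₀ * Complex.I)
      = P (ρ S) - P (ρ (-S)) := by
    intro S
    refine intervalIntegral.integral_eq_sub_of_hasDerivAt
      (f := fun r : ℝ => P (r + y₀ * Complex.I)) (fun r _ => ?_)
      (Continuous.intervalIntegrable (by have := hd.continuous; fun_prop) _ _)
    have hr : HasDerivAt (fun r : ℝ => (r : ℂ) + y₀ * Complex.I) 1 r :=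
      (Complex.ofRealCLM.hasDerivAt (x := r)).add_const _
    simpa [Function.comp_def] using (hP' _).comp_of_eq r hr rfl
  have l3 := l1.sub l2
  have l4 : Tendsto (fun S : ℝ => (P (γ S) - P (ρ S)) - (P (γ (-S)) - P (ρ (-S)))) atTop
      (𝓝 (0 - 0)) := t1.sub t2
  have l5 := tendsto_nhds_unique (l3.congr fun S => by rw [e1, e2]; ring) l4
  rw [sub_zero] at l5
  exact sub_eq_zero.1 l5

end

/-! ### The general pair of boundary conditions -/

section

/-- Coefficients of the boundary conditions `a θ(0,t) - α θ_x(0,t) = f(t)` and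
`b θ(L,t) - β θ_x(L,t) = g(t)`. -/
structure BdryCoeff where
  a : ℝ
  α : ℝ
  b : ℝ
  β : ℝ

/-- Neither boundary condition is trivial. -/
def BdryCoeff.Nontrivial (q : BdryCoeff) : Prop := (q.a ≠ 0 ∨ q.α ≠ 0) ∧ (q.b ≠ 0 ∨ q.β ≠ 0)

/-- `F_γ(k,y)` for the boundary condition `a θ - c θ_x`. -/
def robinF (K₀ D₀ a c : ℝ) (k : ℂ) (y : ℝ) : ℂ :=
  (c * (K₀ / (2 * D₀)) - a) * Complex.sin (y * shift K₀ D₀ k)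
    - c * shift K₀ D₀ k * Complex.cos (y * shift K₀ D₀ k)

/-- The symbol of `a θ - c θ_x`. -/
def symb (a c : ℝ) (k : ℂ) : ℂ := a - Complex.I * c * k

/-- The denominator of the general representation. -/
def robinDelta (K₀ D₀ L : ℝ) (q : BdryCoeff) (k : ℂ) : ℂ :=
  Complex.exp (-Complex.I * k * L) * symb q.a q.α k * symb q.b q.β (nu K₀ D₀ k)
    - Complex.exp (-Complex.I * nu K₀ D₀ k * L) * symb q.a q.α (nu K₀ D₀ k) * symb q.b q.β k

/-- The coefficient of `θ̂₀(k)`. -/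
def numA (K₀ D₀ L : ℝ) (q : BdryCoeff) (x : ℝ) (k : ℂ) : ℂ :=
  robinF K₀ D₀ q.a q.α k x * symb q.b q.β k * Complex.exp (Complex.I * L * shift K₀ D₀ k)

/-- The coefficient of `θ̂₀(ν)`. -/
def numB (K₀ D₀ L : ℝ) (q : BdryCoeff) (x : ℝ) (k : ℂ) : ℂ :=
  -(robinF K₀ D₀ q.b q.β k (x - L) * symb q.a q.α (nu K₀ D₀ k))

/-- The coefficient of the transform of `f`. -/
def numf (K₀ D₀ L : ℝ) (q : BdryCoeff) (x : ℝ) (k : ℂ) : ℂ :=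
  (K₀ - 2 * Complex.I * k * D₀) * robinF K₀ D₀ q.b q.β k (x - L)

/-- The coefficient of the transform of `g`. -/
def numg (K₀ D₀ L : ℝ) (q : BdryCoeff) (x : ℝ) (k : ℂ) : ℂ :=
  -((K₀ - 2 * Complex.I * k * D₀) *
    (robinF K₀ D₀ q.a q.α k x * Complex.exp (-(K₀ / (2 * D₀)) * L)))

/-- The integrand of the general representation. -/
def robinIntegrand (K₀ D₀ L : ℝ) (q : BdryCoeff) (θ₀ f g : ℝ → ℝ) (x t : ℝ) (k : ℂ) : ℂ :=
  Complex.exp (-omega K₀ D₀ k * t) / robinDelta K₀ D₀ L q k *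
    (numA K₀ D₀ L q x k * hat L θ₀ k + numB K₀ D₀ L q x k * hat L θ₀ (nu K₀ D₀ k)
      + numf K₀ D₀ L q x k * tilde f (omega K₀ D₀ k) t
      + numg K₀ D₀ L q x k * tilde g (omega K₀ D₀ k) t)

variable {K₀ D₀ L : ℝ} {q : BdryCoeff} {x : ℝ}

theorem nu_nu (k : ℂ) : nu K₀ D₀ (nu K₀ D₀ k) = k := by unfold nu; ring

/-- `k` and `ν` are the two roots of `ω = const`. The global relations at `k` and `ν` therefore
involve the same time transforms of the boundary values. -/
theorem omega_nu (hD : D₀ ≠ 0) (k : ℂ) : omega K₀ D₀ (nu K₀ D₀ k) = omega K₀ D₀ k := by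
  have : (D₀ : ℂ) ≠ 0 := by exact_mod_cast hD
  unfold omega nu
  field_simp
  ring_nf

theorem nu_sub (k : ℂ) : nu K₀ D₀ k - k = -2 * shift K₀ D₀ k := by
  unfold nu shift
  ring

theorem im_nu (k : ℂ) : (nu K₀ D₀ k).im = -k.im - K₀ / D₀ := by
  rw [nu, ← Complex.ofReal_div]; simp

theorem im_shift (k : ℂ) : (shift K₀ D₀ k).im = k.im + K₀ / (2 * D₀) := by
  have : shift K₀ D₀ k = k + Complex.I * ((K₀ / (2 * D₀) : ℝ) : ℂ) := by unfold shift; push_cast; rfl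
  rw [this, Complex.add_im, Complex.I_mul_im, Complex.ofReal_re]

theorem differentiable_symb (a c : ℝ) : Differentiable ℂ (symb a c) := by unfold symb; fun_prop

theorem differentiable_robinF (a c y : ℝ) : Differentiable ℂ fun k => robinF K₀ D₀ a c k y := by
  have := differentiable_shift K₀ D₀
  unfold robinF
  fun_prop

theorem differentiable_robinDelta : Differentiable ℂ (robinDelta K₀ D₀ L q) := by
  have := differentiable_nu K₀ D₀
  have h1 := differentiable_symb q.a q.α
  have h2 := differentiable_symb q.b q.β
  unfold robinDelta
  fun_prop

theorem differentiable_numA : Differentiable ℂ (numA K₀ D₀ L q x) := by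
  have := differentiable_shift K₀ D₀
  have h1 := differentiable_robinF (K₀ := K₀) (D₀ := D₀) q.a q.α x
  have h2 := differentiable_symb q.b q.β
  unfold numA
  fun_prop

theorem differentiable_numB : Differentiable ℂ (numB K₀ D₀ L q x) := by
  have := differentiable_nu K₀ D₀
  have h1 := differentiable_robinF (K₀ := K₀) (D₀ := D₀) q.b q.β (x - L)
  have h2 := differentiable_symb q.a q.α
  unfold numB
  fun_prop

theorem differentiable_numf : Differentiable ℂ (numf K₀ D₀ L q x) := by
  have h1 := differentiable_robinF (K₀ := K₀) (D₀ := D₀) q.b q.β (x - L)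
  unfold numf
  fun_prop

theorem differentiable_numg : Differentiable ℂ (numg K₀ D₀ L q x) := by
  have h1 := differentiable_robinF (K₀ := K₀) (D₀ := D₀) q.a q.α x
  unfold numg
  fun_prop

/-! ### The algebraic identity behind the elimination of the unknown boundary values -/

/-- In exponential form the weights are the boundary symbols at `k` and `ν`. This shows `F` as a
combination of the two exponential solutions, and reduces `elimination` to algebra. -/
theorem robinF_eq (a c y : ℝ) (k : ℂ) : robinF K₀ D₀ a c k y =
    (symb a c k * Complex.exp (-(Complex.I * shift K₀ D₀ k * y))
      - symb a c (nu K₀ D₀ k) * Complex.exp (Complex.I * shift K₀ D₀ k * y)) / (2 * Complex.I) := by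
  have h1 : symb a c k = a - c * (K₀ / (2 * D₀)) - Complex.I * c * shift K₀ D₀ k := by
    unfold symb shift
    linear_combination ((c : ℂ) * (K₀ / (2 * D₀))) * Complex.I_mul_I
  have h2 : symb a c (nu K₀ D₀ k) = a - c * (K₀ / (2 * D₀)) + Complex.I * c * shift K₀ D₀ k := by
    unfold symb nu shift
    linear_combination ((c : ℂ) * (K₀ / (2 * D₀))) * Complex.I_mul_I
  rw [h1, h2, robinF, Complex.sin, Complex.cos]
  have e1 : -(y * shift K₀ D₀ k) * Complex.I = -(Complex.I * shift K₀ D₀ k * y) := by ring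
  have e2 : (y * shift K₀ D₀ k) * Complex.I = Complex.I * shift K₀ D₀ k * y := by ring
  rw [e1, e2]
  field_simp
  linear_combination (2 * ((c : ℂ) * (K₀ / (2 * D₀)) - a) *
    (Complex.exp (-(Complex.I * shift K₀ D₀ k * y)) - Complex.exp (Complex.I * shift K₀ D₀ k * y)))
    * Complex.I_mul_I

/-- The boundary values enter the global relations only through `u₁ - iν u₀` (at `k`) and `u₁ - ik
u₀` (at `ν`). The prescribed combination is recovered from these two, with `2i(k + iκ)` as the
determinant. -/
theorem symb_flux (a c : ℝ) (k u₀ u₁ : ℂ) :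
    2 * Complex.I * shift K₀ D₀ k * (a * u₀ - c * u₁)
      = symb a c k * (u₁ - Complex.I * nu K₀ D₀ k * u₀)
        - symb a c (nu K₀ D₀ k) * (u₁ - Complex.I * k * u₀) := by
  have h := nu_sub (K₀ := K₀) (D₀ := D₀) k
  unfold symb
  linear_combination (Complex.I * (a * u₀ - c * u₁)) * h

theorem exp_neg_I_mul (k : ℂ) (y : ℝ) : Complex.exp (-Complex.I * k * y) =
    Complex.exp (-(Complex.I * shift K₀ D₀ k * y)) * Complex.exp (-(K₀ / (2 * D₀)) * y) := by
  rw [← Complex.exp_add]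
  congr 1
  unfold shift
  linear_combination (K₀ / (2 * D₀) * y : ℂ) * Complex.I_mul_I

theorem exp_neg_I_nu_mul (k : ℂ) (y : ℝ) : Complex.exp (-Complex.I * nu K₀ D₀ k * y) =
    Complex.exp (Complex.I * shift K₀ D₀ k * y) * Complex.exp (-(K₀ / (2 * D₀)) * y) := by
  rw [← Complex.exp_add]
  congr 1
  unfold shift nu
  linear_combination (K₀ / (2 * D₀) * y : ℂ) * Complex.I_mul_I

theorem K_sub_eq (hD : D₀ ≠ 0) (k : ℂ) :
    (K₀ - 2 * Complex.I * k * D₀ : ℂ) = -(2 * Complex.I * shift K₀ D₀ k) * D₀ := by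
  have : (D₀ : ℂ) ≠ 0 := by exact_mod_cast hD
  unfold shift
  field_simp
  linear_combination (K₀ : ℂ) * Complex.I_mul_I

/-- The boundary flux of the global relation. -/
def flux (K₀ D₀ L : ℝ) (g₀ g₁ h₀ h₁ k : ℂ) : ℂ :=
  D₀ * (Complex.exp (-Complex.I * k * L) * (h₁ - Complex.I * nu K₀ D₀ k * h₀)
    - (g₁ - Complex.I * nu K₀ D₀ k * g₀))

/-- Cramer's rule for the two global relations: adding them with weights `numA`, `numB` and
subtracting the known data leaves the unknowns multiplied by `Δ` itself. The cofactor has no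
denominator in `k`, so the poles disappear after division by `Δ`. The identity is formal in `g₀, g₁,
h₀, h₁`. -/
theorem elimination (hD : D₀ ≠ 0) (q : BdryCoeff) (x : ℝ) (k g₀ g₁ h₀ h₁ : ℂ) :
    numA K₀ D₀ L q x k * flux K₀ D₀ L g₀ g₁ h₀ h₁ k
      + numB K₀ D₀ L q x k * flux K₀ D₀ L g₀ g₁ h₀ h₁ (nu K₀ D₀ k)
      - numf K₀ D₀ L q x k * (q.a * g₀ - q.α * g₁) - numg K₀ D₀ L q x k * (q.b * h₀ - q.β * h₁)
    = robinDelta K₀ D₀ L q k * (D₀ / (2 * Complex.I) * (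
        Complex.exp (Complex.I * shift K₀ D₀ k * L) / Complex.exp (Complex.I * shift K₀ D₀ k * x)
          * (h₁ - Complex.I * k * h₀)
        - Complex.exp (Complex.I * shift K₀ D₀ k * x) / Complex.exp (-(K₀ / (2 * D₀)) * L)
          * (g₁ - Complex.I * nu K₀ D₀ k * g₀))) := by
  have f1 := symb_flux (K₀ := K₀) (D₀ := D₀) q.a q.α k g₀ g₁
  have f2 := symb_flux (K₀ := K₀) (D₀ := D₀) q.b q.β k h₀ h₁
  have hF1 := robinF_eq (K₀ := K₀) (D₀ := D₀) q.a q.α x k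
  have hF2 := robinF_eq (K₀ := K₀) (D₀ := D₀) q.b q.β (x - L) k
  have e1 : Complex.exp (-(Complex.I * shift K₀ D₀ k * ((x - L : ℝ) : ℂ))) =
      Complex.exp (Complex.I * shift K₀ D₀ k * L) / Complex.exp (Complex.I * shift K₀ D₀ k * x) := by
    rw [← Complex.exp_sub]; congr 1; push_cast; ring
  have e2 : Complex.exp (Complex.I * shift K₀ D₀ k * ((x - L : ℝ) : ℂ)) =
      Complex.exp (Complex.I * shift K₀ D₀ k * x) / Complex.exp (Complex.I * shift K₀ D₀ k * L) := by
    rw [← Complex.exp_sub]; congr 1; push_cast; ring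
  have e3 : Complex.exp (Complex.I * L * shift K₀ D₀ k) =
      Complex.exp (Complex.I * shift K₀ D₀ k * L) := by congr 1; ring
  rw [e1, e2] at hF2
  simp only [numA, numB, numf, numg, flux, robinDelta, K_sub_eq hD, exp_neg_I_mul (K₀ := K₀) (D₀ := D₀) k,
    exp_neg_I_nu_mul, nu_nu, e3]
  have g1 : -(2 * Complex.I * shift K₀ D₀ k) * D₀ * robinF K₀ D₀ q.b q.β k (x - L)
      * (q.a * g₀ - q.α * g₁) = -D₀ * robinF K₀ D₀ q.b q.β k (x - L) *
      (symb q.a q.α k * (g₁ - Complex.I * nu K₀ D₀ k * g₀)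
        - symb q.a q.α (nu K₀ D₀ k) * (g₁ - Complex.I * k * g₀)) := by
    rw [← f1]; ring
  have g2 : -(-(2 * Complex.I * shift K₀ D₀ k) * D₀ * (robinF K₀ D₀ q.a q.α k x *
      Complex.exp (-(K₀ / (2 * D₀)) * L))) * (q.b * h₀ - q.β * h₁) =
      D₀ * (robinF K₀ D₀ q.a q.α k x * Complex.exp (-(K₀ / (2 * D₀)) * L)) *
      (symb q.b q.β k * (h₁ - Complex.I * nu K₀ D₀ k * h₀)
        - symb q.b q.β (nu K₀ D₀ k) * (h₁ - Complex.I * k * h₀)) := by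
    rw [← f2]; ring
  rw [g1, g2, hF1, hF2, Complex.exp_neg, Complex.exp_neg]
  have n1 := Complex.exp_ne_zero (Complex.I * shift K₀ D₀ k * L)
  have n2 := Complex.exp_ne_zero (Complex.I * shift K₀ D₀ k * x)
  have n3 := Complex.exp_ne_zero (-(K₀ / (2 * D₀)) * (L : ℂ))
  -- With exponentials, symbols and fluxes as independent variables, what remains is a rational
  -- identity.
  generalize Complex.exp (Complex.I * shift K₀ D₀ k * L) = E at *
  generalize Complex.exp (Complex.I * shift K₀ D₀ k * x) = e at *
  generalize Complex.exp (-(K₀ / (2 * D₀)) * (L : ℂ)) = c at *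
  generalize symb q.a q.α k = P
  generalize symb q.a q.α (nu K₀ D₀ k) = Q
  generalize symb q.b q.β k = R
  generalize symb q.b q.β (nu K₀ D₀ k) = S
  generalize h₁ - Complex.I * nu K₀ D₀ k * h₀ = Hν
  generalize h₁ - Complex.I * k * h₀ = Hk
  generalize g₁ - Complex.I * nu K₀ D₀ k * g₀ = Gν
  generalize g₁ - Complex.I * k * g₀ = Gk
  field_simp
  ring

/-! ### Bounds -/

theorem norm_sin_le (z : ℂ) : ‖Complex.sin z‖ ≤ Real.exp |z.im| := by
  have h1 : ‖Complex.exp (-z * Complex.I)‖ ≤ Real.exp |z.im| := by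
    rw [Complex.norm_exp]; exact Real.exp_le_exp.2 (by simpa using le_abs_self z.im)
  have h2 : ‖Complex.exp (z * Complex.I)‖ ≤ Real.exp |z.im| := by
    rw [Complex.norm_exp]; exact Real.exp_le_exp.2 (by simpa using neg_le_abs z.im)
  rw [Complex.sin, norm_div, norm_mul, Complex.norm_I, mul_one, Complex.norm_two,
    div_le_iff₀ (by norm_num)]
  exact (norm_sub_le _ _).trans (by linarith)

theorem norm_cos_le (z : ℂ) : ‖Complex.cos z‖ ≤ Real.exp |z.im| := by
  have h1 : ‖Complex.exp (-z * Complex.I)‖ ≤ Real.exp |z.im| := by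
    rw [Complex.norm_exp]; exact Real.exp_le_exp.2 (by simpa using le_abs_self z.im)
  have h2 : ‖Complex.exp (z * Complex.I)‖ ≤ Real.exp |z.im| := by
    rw [Complex.norm_exp]; exact Real.exp_le_exp.2 (by simpa using neg_le_abs z.im)
  rw [Complex.cos, norm_div, Complex.norm_two, div_le_iff₀ (by norm_num)]
  exact (norm_add_le _ _).trans (by linarith)

/-- The polynomial weight in the bounds. -/
def weight (K₀ D₀ : ℝ) (k : ℂ) : ℝ := 1 + 2 * |K₀ / (2 * D₀)| + ‖k‖

theorem weight_pos (k : ℂ) : 0 < weight K₀ D₀ k := by unfold weight; positivity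

theorem norm_shift_le (k : ℂ) : ‖shift K₀ D₀ k‖ ≤ ‖k‖ + |K₀ / (2 * D₀)| := by
  have : shift K₀ D₀ k = k + Complex.I * ((K₀ / (2 * D₀) : ℝ) : ℂ) := by unfold shift; push_cast; rfl
  rw [this]
  refine (norm_add_le _ _).trans ?_
  rw [norm_mul, Complex.norm_I, one_mul, Complex.norm_real, Real.norm_eq_abs]

theorem norm_nu_le (k : ℂ) : ‖nu K₀ D₀ k‖ ≤ ‖k‖ + 2 * |K₀ / (2 * D₀)| := by
  have : nu K₀ D₀ k = -k - Complex.I * ((2 * (K₀ / (2 * D₀)) : ℝ) : ℂ) := by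
    unfold nu; push_cast; ring
  rw [this]
  refine (norm_sub_le _ _).trans ?_
  rw [norm_mul, Complex.norm_I, one_mul, Complex.norm_real, Real.norm_eq_abs, norm_neg, abs_mul,
    abs_two]

theorem norm_symb_le (a c : ℝ) (k : ℂ) : ‖symb a c k‖ ≤ |a| + |c| * ‖k‖ := by
  refine (norm_sub_le _ _).trans ?_
  simp

theorem norm_symb_le_weight (a c : ℝ) (k : ℂ) :
    ‖symb a c k‖ ≤ (|a| + |c|) * weight K₀ D₀ k ∧
    ‖symb a c (nu K₀ D₀ k)‖ ≤ (|a| + |c|) * weight K₀ D₀ k := by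
  have h1 := norm_symb_le a c k
  have h2 := norm_symb_le a c (nu K₀ D₀ k)
  have h3 := norm_nu_le (K₀ := K₀) (D₀ := D₀) k
  have ha := abs_nonneg a
  have hc := abs_nonneg c
  have hk := norm_nonneg k
  have hκ := abs_nonneg (K₀ / (2 * D₀))
  unfold weight
  constructor
  · nlinarith [mul_nonneg ha hκ, mul_nonneg ha hk, mul_nonneg hc hκ]
  · have := mul_le_mul_of_nonneg_left h3 hc
    nlinarith [mul_nonneg ha hκ, mul_nonneg ha hk, mul_nonneg hc hκ]

theorem norm_robinF_le (a c : ℝ) {y : ℝ} (hy : |y| ≤ L) {k : ℂ} (hk : 0 ≤ k.im) :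
    ‖robinF K₀ D₀ a c k y‖ ≤ (|a| + |c|) * weight K₀ D₀ k *
      (Real.exp (L * |K₀ / (2 * D₀)|) * Real.exp (|y| * k.im)) := by
  set κ := |K₀ / (2 * D₀)| with hκ
  have hκ0 : 0 ≤ κ := abs_nonneg _
  have hexp : Real.exp |(y * shift K₀ D₀ k).im| ≤ Real.exp (L * κ) * Real.exp (|y| * k.im) := by
    rw [← Real.exp_add, Real.exp_le_exp, Complex.im_ofReal_mul, abs_mul, im_shift]
    have h1 : |k.im + K₀ / (2 * D₀)| ≤ k.im + κ := by
      refine (abs_add_le _ _).trans ?_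
      rw [abs_of_nonneg hk]
    have h2 := mul_le_mul_of_nonneg_left h1 (abs_nonneg y)
    have h3 := mul_le_mul_of_nonneg_right hy hκ0
    nlinarith
  have hs := (norm_sin_le (y * shift K₀ D₀ k)).trans hexp
  have hc := (norm_cos_le (y * shift K₀ D₀ k)).trans hexp
  set X := Real.exp (L * κ) * Real.exp (|y| * k.im) with hX
  have hX0 : 0 ≤ X := by positivity
  have h1 : ‖(c * (K₀ / (2 * D₀)) - a : ℂ)‖ ≤ |c| * κ + |a| := by
    have : (c * (K₀ / (2 * D₀)) - a : ℂ) = ((c * (K₀ / (2 * D₀)) - a : ℝ) : ℂ) := by push_cast; rfl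
    rw [this, Complex.norm_real]
    refine (norm_sub_le _ _).trans ?_
    simp [hκ, abs_mul, abs_div]
  have h2 : ‖(c : ℂ) * shift K₀ D₀ k‖ ≤ |c| * (‖k‖ + κ) := by
    rw [norm_mul, Complex.norm_real, Real.norm_eq_abs]
    exact mul_le_mul_of_nonneg_left (norm_shift_le k) (abs_nonneg c)
  calc ‖robinF K₀ D₀ a c k y‖
      ≤ (|c| * κ + |a|) * X + |c| * (‖k‖ + κ) * X := by
        refine (norm_sub_le _ _).trans (add_le_add ?_ ?_)
        · rw [norm_mul]; exact mul_le_mul h1 hs (norm_nonneg _) (by positivity)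
        · rw [norm_mul]; exact mul_le_mul h2 hc (norm_nonneg _) (by positivity)
    _ ≤ (|a| + |c|) * weight K₀ D₀ k * X := by
        rw [← add_mul]
        refine mul_le_mul_of_nonneg_right ?_ hX0
        unfold weight
        rw [← hκ]
        nlinarith [mul_nonneg (abs_nonneg a) hκ0, mul_nonneg (abs_nonneg a) (norm_nonneg k),
          abs_nonneg c]

/-- The bound for all coefficients of the representation, divided by the denominator. -/
def kerBound (K₀ D₀ L A c₀ δ : ℝ) (k : ℂ) : ℝ :=
  (1 + 2 * D₀) * (1 + A) ^ 2 * Real.exp (L * |K₀ / (2 * D₀)|) ^ 3 / c₀ * weight K₀ D₀ k ^ 2 *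
    Real.exp (-(δ * k.im))

-- The coefficients grow like `e^{x Im k}` or `e^{(L-x) Im k}`, apart from the factor `e^{iL(k+iκ)}`
-- in `numA`; the denominator grows like `e^{L Im k}`. The quotient decays like `e^{-δ Im k}`, with
-- `δ` at most the distance from `x` to the endpoints. The factors on the left for `numA` and `numB`
-- are those that bound `θ̂₀(k)` and `θ̂₀(ν)`. Only the bound `A` of the coefficients enters, which
-- gives uniformity for nearby boundary conditions.
set_option maxHeartbeats 1000000 in
theorem ker_bounds (hD : 0 < D₀) (hx : x ∈ Ioo 0 L) {A c₀ δ : ℝ} (hA₁ : |q.a| + |q.α| ≤ A)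
    (hA₂ : |q.b| + |q.β| ≤ A) (hc₀ : 0 < c₀) (hδ₁ : δ ≤ x) (hδ₂ : δ ≤ L - x) {k : ℂ}
    (hk : 0 ≤ k.im) (hΔ : c₀ * Real.exp (L * k.im) ≤ ‖robinDelta K₀ D₀ L q k‖) :
    ‖numA K₀ D₀ L q x k / robinDelta K₀ D₀ L q k‖ * Real.exp (L * k.im)
      ≤ kerBound K₀ D₀ L A c₀ δ k ∧
    ‖numB K₀ D₀ L q x k / robinDelta K₀ D₀ L q k‖ * Real.exp (L * |K₀ / (2 * D₀)|) ^ 2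
      ≤ kerBound K₀ D₀ L A c₀ δ k ∧
    ‖numf K₀ D₀ L q x k / robinDelta K₀ D₀ L q k‖ ≤ kerBound K₀ D₀ L A c₀ δ k ∧
    ‖numg K₀ D₀ L q x k / robinDelta K₀ D₀ L q k‖ ≤ kerBound K₀ D₀ L A c₀ δ k := by
  have hL : 0 < L := hx.1.trans hx.2
  set κ := |K₀ / (2 * D₀)| with hκ
  have hκ0 : 0 ≤ κ := abs_nonneg _
  set W := Real.exp (L * κ) with hW
  have hW1 : 1 ≤ W := Real.one_le_exp (by positivity)
  have hA₁' : |q.a| + |q.α| ≤ 1 + A := by linarith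
  have hA₂' : |q.b| + |q.β| ≤ 1 + A := by linarith
  have hA0 : 0 ≤ A := le_trans (by positivity) hA₁
  set m := weight K₀ D₀ k with hm
  have hm0 : 0 < m := weight_pos k
  have hm1 : ‖shift K₀ D₀ k‖ ≤ m := (norm_shift_le k).trans (by rw [hm, weight, ← hκ]; linarith)
  have hE0 : 0 < c₀ * Real.exp (L * k.im) := by positivity
  have hΔ0 : 0 < ‖robinDelta K₀ D₀ L q k‖ := hE0.trans_le hΔ
  have hxL : |x - L| = L - x := by
    rw [abs_of_neg (by linarith [hx.2] : x - L < 0)]; ring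
  have F1 := norm_robinF_le (K₀ := K₀) (D₀ := D₀) q.a q.α (y := x) (L := L)
    (by rw [abs_of_pos hx.1]; exact hx.2.le) hk
  have F2 := norm_robinF_le (K₀ := K₀) (D₀ := D₀) q.b q.β (y := x - L) (L := L)
    (by rw [hxL]; linarith [hx.1]) hk
  rw [abs_of_pos hx.1] at F1
  rw [hxL] at F2
  rw [← hm, ← hκ, ← hW] at F1 F2
  have F1' : ‖robinF K₀ D₀ q.a q.α k x‖ ≤ (1 + A) * m * (W * Real.exp (x * k.im)) :=
    F1.trans (mul_le_mul_of_nonneg_right (mul_le_mul_of_nonneg_right hA₁' hm0.le) (by positivity))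
  have F2' : ‖robinF K₀ D₀ q.b q.β k (x - L)‖ ≤ (1 + A) * m * (W * Real.exp ((L - x) * k.im)) :=
    F2.trans (mul_le_mul_of_nonneg_right (mul_le_mul_of_nonneg_right hA₂' hm0.le) (by positivity))
  have S1 : ‖symb q.b q.β k‖ ≤ (1 + A) * m :=
    (norm_symb_le_weight (K₀ := K₀) (D₀ := D₀) q.b q.β k).1.trans
      (mul_le_mul_of_nonneg_right hA₂' hm0.le)
  have S2 : ‖symb q.a q.α (nu K₀ D₀ k)‖ ≤ (1 + A) * m :=
    (norm_symb_le_weight (K₀ := K₀) (D₀ := D₀) q.a q.α k).2.trans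
      (mul_le_mul_of_nonneg_right hA₁' hm0.le)
  have E1 : ‖Complex.exp (Complex.I * L * shift K₀ D₀ k)‖ ≤ W * Real.exp (-(L * k.im)) := by
    rw [Complex.norm_exp, hW, ← Real.exp_add, Real.exp_le_exp]
    have : (Complex.I * L * shift K₀ D₀ k).re = -(L * (k.im + K₀ / (2 * D₀))) := by
      rw [← im_shift]; simp [mul_comm]
    rw [this]
    nlinarith [neg_abs_le (K₀ / (2 * D₀))]
  have E2 : ‖Complex.exp (-(K₀ / (2 * D₀)) * L)‖ ≤ W := by
    have : (-(K₀ / (2 * D₀)) * L : ℂ) = ((-(K₀ / (2 * D₀)) * L : ℝ) : ℂ) := by push_cast; rfl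
    rw [this, Complex.norm_exp, Complex.ofReal_re, hW, Real.exp_le_exp]
    nlinarith [neg_abs_le (K₀ / (2 * D₀))]
  have E3 : ‖(K₀ - 2 * Complex.I * k * D₀ : ℂ)‖ ≤ 2 * D₀ * m := by
    rw [K_sub_eq hD.ne', norm_mul, norm_neg, norm_mul, norm_mul, Complex.norm_two, Complex.norm_I,
      Complex.norm_real, Real.norm_of_nonneg hD.le]
    nlinarith
  have X1 : Real.exp (x * k.im) * Real.exp (-(L * k.im)) ≤ Real.exp (-(δ * k.im)) := by
    rw [← Real.exp_add, Real.exp_le_exp]; nlinarith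
  have X2 : Real.exp ((L - x) * k.im) * Real.exp (-(L * k.im)) ≤ Real.exp (-(δ * k.im)) := by
    rw [← Real.exp_add, Real.exp_le_exp]; nlinarith
  have X3 : Real.exp (L * k.im) * Real.exp (-(L * k.im)) = 1 := by rw [← Real.exp_add]; simp
  have X4 : ∀ r : ℝ, r * Real.exp (L * k.im) * Real.exp (-(L * k.im)) = r := fun r => by
    rw [mul_assoc, X3, mul_one]
  have hpos := Real.exp_pos (L * k.im)
  have hposn := Real.exp_pos (-(L * k.im))
  -- The lower bound for `Δ` reduces each claim to an estimate of the numerator times `e^{-L Im k}`.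
  have red : ∀ (z : ℂ) (u B : ℝ), 0 ≤ u → ‖z‖ * u * Real.exp (-(L * k.im)) ≤ c₀ * B →
      ‖z / robinDelta K₀ D₀ L q k‖ * u ≤ B := by
    intro z u B hu h
    rw [norm_div, div_mul_eq_mul_div, div_le_iff₀ hΔ0]
    have hB : 0 ≤ B := by
      have : 0 ≤ ‖z‖ * u * Real.exp (-(L * k.im)) := by positivity
      exact nonneg_of_mul_nonneg_right (this.trans h) hc₀
    calc ‖z‖ * u = (‖z‖ * u * Real.exp (-(L * k.im))) * Real.exp (L * k.im) := by
          rw [mul_assoc (‖z‖ * u), mul_comm (Real.exp (-(L * k.im))), X3, mul_one]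
      _ ≤ c₀ * B * Real.exp (L * k.im) := by gcongr
      _ = B * (c₀ * Real.exp (L * k.im)) := by ring
      _ ≤ _ := by gcongr
  have hKB : c₀ * kerBound K₀ D₀ L A c₀ δ k
      = (1 + 2 * D₀) * (1 + A) ^ 2 * W ^ 3 * m ^ 2 * Real.exp (-(δ * k.im)) := by
    unfold kerBound; rw [← hκ, ← hW, ← hm]; field_simp
  have hWW : W ^ 2 ≤ W ^ 3 := pow_le_pow_right₀ hW1 (by norm_num)
  have hZ : 0 ≤ W ^ 3 * ((1 + A) ^ 2 * m ^ 2 * Real.exp (-(δ * k.im))) := by positivity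
  have fin0 : (1 + 2 * D₀) * (1 + A) ^ 2 * W ^ 3 * m ^ 2 * Real.exp (-(δ * k.im)) =
      (1 + 2 * D₀) * (W ^ 3 * ((1 + A) ^ 2 * m ^ 2 * Real.exp (-(δ * k.im)))) := by ring
  have fin1 : W ^ 3 * ((1 + A) ^ 2 * m ^ 2 * Real.exp (-(δ * k.im))) ≤
      (1 + 2 * D₀) * (1 + A) ^ 2 * W ^ 3 * m ^ 2 * Real.exp (-(δ * k.im)) := by
    rw [fin0]; exact le_mul_of_one_le_left hZ (by linarith)
  have fin2 : 2 * D₀ * (W ^ 3 * (((1 + A) * (1 + A)) * m ^ 2 * Real.exp (-(δ * k.im)))) ≤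
      (1 + 2 * D₀) * (1 + A) ^ 2 * W ^ 3 * m ^ 2 * Real.exp (-(δ * k.im)) := by
    rw [fin0, ← sq]; exact mul_le_mul_of_nonneg_right (by linarith) hZ
  have hA1 : 1 ≤ 1 + A := by linarith
  refine ⟨red _ _ _ hpos.le ?_, red _ _ _ (by positivity) ?_, ?_, ?_⟩
  · rw [hKB, X4, numA, norm_mul, norm_mul]
    calc _ ≤ ((1 + A) * m * (W * Real.exp (x * k.im))) * ((1 + A) * m) *
          (W * Real.exp (-(L * k.im))) := by gcongr
      _ = W ^ 2 * ((1 + A) ^ 2 * m ^ 2 * (Real.exp (x * k.im) * Real.exp (-(L * k.im)))) := by ring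
      _ ≤ W ^ 3 * ((1 + A) ^ 2 * m ^ 2 * Real.exp (-(δ * k.im))) := by gcongr
      _ ≤ _ := fin1
  · rw [hKB, numB, norm_neg, norm_mul]
    calc _ ≤ ((1 + A) * m * (W * Real.exp ((L - x) * k.im))) * ((1 + A) * m) * W ^ 2 *
          Real.exp (-(L * k.im)) := by gcongr
      _ = W ^ 3 * ((1 + A) ^ 2 * m ^ 2 * (Real.exp ((L - x) * k.im) * Real.exp (-(L * k.im)))) := by
          ring
      _ ≤ W ^ 3 * ((1 + A) ^ 2 * m ^ 2 * Real.exp (-(δ * k.im))) := by gcongr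
      _ ≤ _ := fin1
  · rw [← mul_one ‖numf K₀ D₀ L q x k / robinDelta K₀ D₀ L q k‖]
    refine red _ _ _ zero_le_one ?_
    rw [hKB, mul_one, numf, norm_mul]
    calc _ ≤ (2 * D₀ * m) * ((1 + A) * m * (W * Real.exp ((L - x) * k.im))) *
          Real.exp (-(L * k.im)) := by gcongr
      _ = 2 * D₀ * (W * (((1 + A) * 1) * m ^ 2 *
          (Real.exp ((L - x) * k.im) * Real.exp (-(L * k.im))))) := by ring
      _ ≤ 2 * D₀ * (W ^ 3 * (((1 + A) * (1 + A)) * m ^ 2 * Real.exp (-(δ * k.im)))) := by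
          gcongr; exact le_self_pow₀ hW1 (by norm_num)
      _ ≤ _ := fin2
  · rw [← mul_one ‖numg K₀ D₀ L q x k / robinDelta K₀ D₀ L q k‖]
    refine red _ _ _ zero_le_one ?_
    rw [hKB, mul_one, numg, norm_neg, norm_mul, norm_mul]
    calc _ ≤ (2 * D₀ * m) * ((1 + A) * m * (W * Real.exp (x * k.im)) * W) *
          Real.exp (-(L * k.im)) := by gcongr
      _ = 2 * D₀ * (W ^ 2 * (((1 + A) * 1) * m ^ 2 *
          (Real.exp (x * k.im) * Real.exp (-(L * k.im))))) := by ring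
      _ ≤ 2 * D₀ * (W ^ 3 * (((1 + A) * (1 + A)) * m ^ 2 * Real.exp (-(δ * k.im)))) := by
          gcongr
      _ ≤ _ := fin2

end

/-! ### Lower bounds for the denominator and favourable contours -/

section

variable {K₀ D₀ L : ℝ} {γ : ℝ → ℂ}

/-- Far out, `symb a c ν` and `symb a c k` are comparable, locally uniformly in `a`. -/
theorem symb_far {a₀ c : ℝ} (h : a₀ ≠ 0 ∨ c ≠ 0) : ∃ M d, 0 < d ∧ ∀ᶠ a in 𝓝 a₀, ∀ k : ℂ,
    M ≤ ‖k‖ → d ≤ ‖symb a c k‖ ∧ ‖symb a c (nu K₀ D₀ k)‖ ≤ 5 * ‖symb a c k‖ := by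
  by_cases hc : c = 0
  · have ha : 0 < |a₀| := abs_pos.2 (h.resolve_right (by simpa using hc))
    refine ⟨0, |a₀| / 2, by positivity, ?_⟩
    have : ∀ᶠ a in 𝓝 a₀, |a₀| / 2 < |a| := (continuous_abs.tendsto a₀).eventually_const_lt (by linarith)
    filter_upwards [this] with a ha' k _
    simp only [symb, hc, Complex.ofReal_zero, mul_zero, zero_mul, sub_zero, Complex.norm_real,
      Real.norm_eq_abs]
    exact ⟨ha'.le, by linarith [abs_nonneg a]⟩
  · have hc' : 0 < |c| := abs_pos.2 hc
    set κ := |K₀ / (2 * D₀)| with hκ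
    -- Beyond this radius `|c|‖k‖ ≥ 2(|a₀| + 1)` and `‖ν‖ ≤ 2‖k‖`. The symbol at `k` is then at
    -- least `|c|‖k‖/2`, the one at `ν` at most `5|c|‖k‖/2`; hence the factor five.
    refine ⟨2 * (|a₀| + 1) / |c| + 2 * κ, |a₀| + 1, by positivity, ?_⟩
    have : ∀ᶠ a in 𝓝 a₀, |a| < |a₀| + 1 := (continuous_abs.tendsto a₀).eventually_lt_const (by linarith)
    filter_upwards [this] with a ha k hk
    have hκ0 : 0 ≤ κ := abs_nonneg _
    have h1 : 2 * (|a₀| + 1) ≤ |c| * ‖k‖ := by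
      have : 2 * (|a₀| + 1) / |c| ≤ ‖k‖ := by linarith
      rw [div_le_iff₀ hc'] at this
      linarith
    have h2 : 2 * κ ≤ ‖k‖ := by
      have : 0 ≤ 2 * (|a₀| + 1) / |c| := by positivity
      linarith
    have h3 : |c| * ‖k‖ - |a| ≤ ‖symb a c k‖ := by
      have := norm_sub_norm_le (Complex.I * c * k) (a : ℂ)
      rw [norm_sub_rev] at this
      simpa [symb] using this
    have h4 := norm_symb_le a c (nu K₀ D₀ k)
    have h5 := mul_le_mul_of_nonneg_left (norm_nu_le (K₀ := K₀) (D₀ := D₀) k) hc'.le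
    rw [← hκ] at h5
    have h6 := mul_le_mul_of_nonneg_left h2 hc'.le
    constructor <;> nlinarith

/-- The denominator is bounded below by `e^{L Im k}` far up, locally uniformly in `a` and `b`. -/
theorem robinDelta_far (hL : 0 < L) {q : BdryCoeff} (hq : q.Nontrivial) :
    ∃ M c₀, 0 < c₀ ∧ ∀ᶠ p : ℝ × ℝ in 𝓝 (q.a, q.b), ∀ k : ℂ, M ≤ k.im →
      c₀ * Real.exp (L * k.im) ≤ ‖robinDelta K₀ D₀ L ⟨p.1, q.α, p.2, q.β⟩ k‖ := by
  obtain ⟨M₁, d₁, hd₁, h₁⟩ := symb_far (K₀ := K₀) (D₀ := D₀) hq.1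
  obtain ⟨M₂, d₂, hd₂, h₂⟩ := symb_far (K₀ := K₀) (D₀ := D₀) hq.2
  set κ := |K₀ / (2 * D₀)| with hκ
  have hκ0 : 0 ≤ κ := abs_nonneg _
  -- `symb_far` is applied at `k` for the first condition and at `ν` for the second, where `‖ν‖ ≥
  -- ‖k‖ - 2κ`. The symbols in the second term of `Δ` are larger by a factor of at most 25, while
  -- `2/L + κ` makes its exponential at least 50 times smaller, as `e⁴ ≥ 50`. So at least half of
  -- the first term remains.
  refine ⟨max (max M₁ (M₂ + 2 * κ)) (2 / L + κ), d₁ * d₂ / 2, by positivity, ?_⟩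
  have hp := (continuous_fst.tendsto (q.a, q.b)).eventually h₁
  have hp' := (continuous_snd.tendsto (q.a, q.b)).eventually h₂
  filter_upwards [hp, hp'] with p hp hp' k hk
  have k1 : M₁ ≤ k.im := (le_max_left _ _).trans ((le_max_left _ _).trans hk)
  have k2 : M₂ + 2 * κ ≤ k.im := (le_max_right _ _).trans ((le_max_left _ _).trans hk)
  have k3 : 2 / L + κ ≤ k.im := (le_max_right _ _).trans hk
  have him := Complex.abs_im_le_norm k
  have him' := le_abs_self k.im
  obtain ⟨P1, P2⟩ := hp k (by linarith)
  have hnn := norm_nu_le (K₀ := K₀) (D₀ := D₀) (nu K₀ D₀ k)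
  rw [nu_nu, ← hκ] at hnn
  obtain ⟨S1, S2⟩ := hp' (nu K₀ D₀ k) (by linarith)
  rw [nu_nu] at S2
  simp only [robinDelta]
  set P := symb p.1 q.α k
  set Q := symb p.1 q.α (nu K₀ D₀ k)
  set R := symb p.2 q.β k
  set S := symb p.2 q.β (nu K₀ D₀ k)
  have e1 : ‖Complex.exp (-Complex.I * k * L)‖ = Real.exp (L * k.im) := by
    rw [Complex.norm_exp]; congr 1; simp [mul_comm]
  have e2 : ‖Complex.exp (-Complex.I * nu K₀ D₀ k * L)‖ = Real.exp (-(L * (k.im + K₀ / D₀))) := by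
    rw [Complex.norm_exp]; congr 1
    have : (-Complex.I * nu K₀ D₀ k * L).re = L * (nu K₀ D₀ k).im := by simp [mul_comm]
    rw [this, im_nu]; ring
  have e3 : 50 * Real.exp (-(L * (k.im + K₀ / D₀))) ≤ Real.exp (L * k.im) := by
    have h50 : (50 : ℝ) ≤ Real.exp 4 := by
      have h := Real.exp_one_gt_d9
      have : Real.exp 4 = Real.exp 1 ^ 4 := by rw [← Real.exp_nat_mul]; norm_num
      rw [this]
      calc (50 : ℝ) ≤ (2.7 : ℝ) ^ 4 := by norm_num
        _ ≤ _ := by gcongr; linarith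
    have h2 : 4 + -(L * (k.im + K₀ / D₀)) ≤ L * k.im := by
      have q1 : -κ ≤ K₀ / (2 * D₀) := neg_abs_le _
      have q2 : K₀ / D₀ = 2 * (K₀ / (2 * D₀)) := by ring
      have q3 := mul_le_mul_of_nonneg_left k3 hL.le
      have q4 : L * (2 / L + κ) = 2 + L * κ := by field_simp
      rw [q4] at q3
      rw [q2]
      nlinarith
    calc 50 * Real.exp (-(L * (k.im + K₀ / D₀)))
        ≤ Real.exp 4 * Real.exp (-(L * (k.im + K₀ / D₀))) := by gcongr
      _ = Real.exp (4 + -(L * (k.im + K₀ / D₀))) := by rw [Real.exp_add]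
      _ ≤ _ := Real.exp_le_exp.2 h2
  have hPS : d₁ * d₂ ≤ ‖P‖ * ‖S‖ := mul_le_mul P1 S1 hd₂.le (norm_nonneg _)
  have hQR : ‖Q‖ * ‖R‖ ≤ (5 * ‖P‖) * (5 * ‖S‖) := mul_le_mul P2 S2 (norm_nonneg _) (by positivity)
  have h1 := norm_sub_norm_le (Complex.exp (-Complex.I * k * L) * P * S)
    (Complex.exp (-Complex.I * nu K₀ D₀ k * L) * Q * R)
  rw [norm_mul, norm_mul, norm_mul, norm_mul, e1, e2] at h1
  refine le_trans ?_ h1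
  have hE1 := Real.exp_pos (L * k.im)
  have hE2 := Real.exp_pos (-(L * (k.im + K₀ / D₀)))
  generalize Real.exp (L * k.im) = X at *
  generalize Real.exp (-(L * (k.im + K₀ / D₀))) = Y at *
  have h2 : Y * ‖Q‖ * ‖R‖ ≤ X / 2 * (‖P‖ * ‖S‖) := by
    calc Y * ‖Q‖ * ‖R‖ = Y * (‖Q‖ * ‖R‖) := by ring
      _ ≤ Y * ((5 * ‖P‖) * (5 * ‖S‖)) := by gcongr
      _ = 25 * Y * (‖P‖ * ‖S‖) := by ring
      _ ≤ X / 2 * (‖P‖ * ‖S‖) := by gcongr; linarith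
  have h3 := mul_le_mul_of_nonneg_left hPS hE1.le
  linarith

/-- The previous bound at the unperturbed coefficients; it excludes zeros at height `M` and above.
-/
theorem robinDelta_zero_im (hL : 0 < L) {q : BdryCoeff} (hq : q.Nontrivial) :
    ∃ M c₀, 0 < c₀ ∧ (∀ k : ℂ, M ≤ k.im → c₀ * Real.exp (L * k.im) ≤ ‖robinDelta K₀ D₀ L q k‖) ∧
      ∀ z, robinDelta K₀ D₀ L q z = 0 → z.im < M := by
  obtain ⟨M, c₀, hc₀, h⟩ := robinDelta_far (K₀ := K₀) (D₀ := D₀) hL hq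
  have h' := h.self_of_nhds
  refine ⟨M, c₀, hc₀, h', fun z hz => ?_⟩
  by_contra hlt
  have := h' z (not_lt.1 hlt)
  rw [hz, norm_zero] at this
  have : 0 < c₀ * Real.exp (L * z.im) := by positivity
  linarith

theorem continuous_robinDelta_param (q : BdryCoeff) :
    Continuous fun w : (ℝ × ℝ) × ℂ => robinDelta K₀ D₀ L ⟨w.1.1, q.α, w.1.2, q.β⟩ w.2 := by
  have hν := (differentiable_nu K₀ D₀).continuous
  have e1 : Continuous fun w : (ℝ × ℝ) × ℂ => (w.1.1 : ℂ) := by fun_prop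
  have e2 : Continuous fun w : (ℝ × ℝ) × ℂ => (w.1.2 : ℂ) := by fun_prop
  have e3 : Continuous fun w : (ℝ × ℝ) × ℂ => nu K₀ D₀ w.2 := by fun_prop
  unfold robinDelta symb
  exact (((by fun_prop : Continuous fun w : (ℝ × ℝ) × ℂ => Complex.exp (-Complex.I * w.2 * L)).mul
    (e1.sub (by fun_prop))).mul (e2.sub (by fun_prop))).sub
    ((((by fun_prop : Continuous fun w : (ℝ × ℝ) × ℂ =>
      Complex.exp (-Complex.I * nu K₀ D₀ w.2 * L))).mul (e1.sub (by fun_prop))).mul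
      (e2.sub (by fun_prop)))

/-- The denominator is bounded below along a favourable contour, locally uniformly in `a`, `b`. -/
theorem robinDelta_contour (hL : 0 < L) {q : BdryCoeff} (hq : q.Nontrivial)
    (hγ : IsFavourable K₀ D₀ (robinDelta K₀ D₀ L q) γ) :
    ∃ c₀, 0 < c₀ ∧ ∀ᶠ p : ℝ × ℝ in 𝓝 (q.a, q.b), ∀ s,
      c₀ * Real.exp (L * (γ s).im) ≤ ‖robinDelta K₀ D₀ L ⟨p.1, q.α, p.2, q.β⟩ (γ s)‖ := by
  obtain ⟨M, c₁, hc₁, h⟩ := robinDelta_far (K₀ := K₀) (D₀ := D₀) hL hq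
  obtain ⟨c, hc, C, hC, hb⟩ := hγ.1.bounds
  have hγc := hγ.1.contDiff.continuous
  -- For `|s| > S` the contour is above level `M`, where `robinDelta_far` applies; on `[-S,S]`
  -- compactness bounds `Δ` away from zero, also for nearby coefficients.
  set S := (|M| + C) / c with hS
  have hS0 : 0 ≤ S := by positivity
  have hcont : Continuous fun w : (ℝ × ℝ) × ℝ =>
      ‖robinDelta K₀ D₀ L ⟨w.1.1, q.α, w.1.2, q.β⟩ (γ w.2)‖ * Real.exp (-(L * (γ w.2).im)) := by
    have := continuous_robinDelta_param (K₀ := K₀) (D₀ := D₀) (L := L) q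
    have h2 := this.comp (Continuous.prodMk continuous_fst (hγc.comp continuous_snd) :
      Continuous fun w : (ℝ × ℝ) × ℝ => (w.1, γ w.2))
    exact h2.norm.mul (by fun_prop)
  have hcont0 : Continuous fun s : ℝ =>
      ‖robinDelta K₀ D₀ L q (γ s)‖ * Real.exp (-(L * (γ s).im)) :=
    (differentiable_robinDelta.continuous.comp hγc).norm.mul (by fun_prop)
  obtain ⟨s₀, -, hs₀⟩ := (isCompact_Icc (a := -S) (b := S)).exists_isMinOn
    ⟨0, by constructor <;> linarith⟩ hcont0.continuousOn
  set m := ‖robinDelta K₀ D₀ L q (γ s₀)‖ * Real.exp (-(L * (γ s₀).im)) with hm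
  have hm0 : 0 < m := mul_pos (norm_pos_iff.2 (hγ.ne_zero s₀)) (Real.exp_pos _)
  have hcpt : ∀ᶠ p : ℝ × ℝ in 𝓝 (q.a, q.b), ∀ s ∈ Icc (-S) S,
      m / 2 < ‖robinDelta K₀ D₀ L ⟨p.1, q.α, p.2, q.β⟩ (γ s)‖ * Real.exp (-(L * (γ s).im)) := by
    refine isCompact_Icc.eventually_forall_of_forall_eventually fun s hs => ?_
    refine (hcont.tendsto ((q.a, q.b), s)).eventually_const_lt ?_
    have : m ≤ ‖robinDelta K₀ D₀ L q (γ s)‖ * Real.exp (-(L * (γ s).im)) := hs₀ hs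
    exact (half_lt_self hm0).trans_le this
  refine ⟨min c₁ (m / 2), lt_min hc₁ (half_pos hm0), ?_⟩
  filter_upwards [h, hcpt] with p hp hp' s
  have hE := Real.exp_pos (L * (γ s).im)
  by_cases hs : s ∈ Icc (-S) S
  · have h1 := (hp' s hs).le
    have h2 := mul_le_mul_of_nonneg_right h1 hE.le
    rw [mul_assoc, ← Real.exp_add, neg_add_cancel, Real.exp_zero, mul_one] at h2
    exact (mul_le_mul_of_nonneg_right (min_le_right _ _) hE.le).trans h2
  · refine (mul_le_mul_of_nonneg_right (min_le_left _ _) hE.le).trans (hp _ ?_)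
    have h1 : S < |s| := by
      by_contra hle
      exact hs (abs_le.1 (not_lt.1 hle))
    rw [hS, div_lt_iff₀ hc] at h1
    have := (hb s).2.1
    have := le_abs_self M
    linarith

/-- A contour that is favourable for one denominator is favourable for all nearby ones. -/
theorem favourable_nearby (hL : 0 < L) {q : BdryCoeff} (hq : q.Nontrivial)
    (hγ : IsFavourable K₀ D₀ (robinDelta K₀ D₀ L q) γ) :
    ∀ᶠ p : ℝ × ℝ in 𝓝 (q.a, q.b), IsFavourable K₀ D₀ (robinDelta K₀ D₀ L ⟨p.1, q.α, p.2, q.β⟩) γ := by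
  obtain ⟨M, c₁, hc₁, h⟩ := robinDelta_far (K₀ := K₀) (D₀ := D₀) hL hq
  obtain ⟨X, hX⟩ := hγ.1.passesAbove_far M
  -- Points of height at most `M` that the contour might fail to pass above form this compact set.
  -- `Δ` has no zero on it, and by compactness the same holds for nearby coefficients.
  set K : Set ℂ := (Icc (-X) X ×ℂ Icc 0 M) \ {z | PassesAbove γ z} with hK
  have hKc : IsCompact K := (isCompact_Icc.reProdIm isCompact_Icc).diff hγ.1.isOpen_passesAbove
  have hcpt : ∀ᶠ p : ℝ × ℝ in 𝓝 (q.a, q.b), ∀ z ∈ K,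
      robinDelta K₀ D₀ L ⟨p.1, q.α, p.2, q.β⟩ z ≠ 0 := by
    refine hKc.eventually_forall_of_forall_eventually fun z hz => ?_
    refine ((continuous_robinDelta_param q).tendsto ((q.a, q.b), z)).eventually_ne ?_
    exact fun h0 => hz.2 (hγ.2 z h0)
  filter_upwards [h, hcpt] with p hp hp'
  refine ⟨hγ.1, fun z hz => ?_⟩
  have hzM : z.im < M := by
    by_contra hlt
    have h1 := hp z (not_lt.1 hlt)
    rw [hz, norm_zero] at h1
    have : 0 < c₁ * Real.exp (L * z.im) := by positivity
    linarith
  by_contra hnot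
  have h0 : 0 ≤ z.im := by
    by_contra hneg
    exact hnot (hX z hzM.le (Or.inl (not_le.1 hneg)))
  have h1 : |z.re| ≤ X := by
    by_contra hneg
    exact hnot (hX z hzM.le (Or.inr (not_le.1 hneg)))
  exact hp' z ⟨⟨abs_le.1 h1, h0, hzM.le⟩, hnot⟩ hz

/-! ### Hyperbolic contours -/

/-- The curve `s + i (c √(s² + m²) + h)`. -/
def hyperbola (c m h : ℝ) (s : ℝ) : ℂ :=
  (s : ℂ) + Complex.I * ((c * Real.sqrt (s ^ 2 + m ^ 2) + h : ℝ) : ℂ)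

theorem hyperbola_re (c m h s : ℝ) : (hyperbola c m h s).re = s := by simp [hyperbola]

theorem hyperbola_im (c m h s : ℝ) :
    (hyperbola c m h s).im = c * Real.sqrt (s ^ 2 + m ^ 2) + h := by
  rw [hyperbola, Complex.add_im, Complex.I_mul_im, Complex.ofReal_re, Complex.ofReal_im, zero_add]

theorem tendsto_sqrt_sub (m : ℝ) :
    Tendsto (fun s : ℝ => Real.sqrt (s ^ 2 + m ^ 2) - s) atTop (𝓝 0) := by
  have h1 : Tendsto (fun s : ℝ => m ^ 2 / s) atTop (𝓝 0) := tendsto_const_nhds.div_atTop tendsto_id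
  refine squeeze_zero' ?_ ?_ h1
  · filter_upwards [eventually_ge_atTop 0] with s hs
    exact sub_nonneg.2 (Real.le_sqrt_of_sq_le (by nlinarith [sq_nonneg m]))
  · filter_upwards [eventually_gt_atTop 0] with s hs
    rw [sub_le_iff_le_add]
    refine Real.sqrt_le_iff.2 ⟨by positivity, ?_⟩
    have : (m ^ 2 / s + s) ^ 2 = (m ^ 2 / s) ^ 2 + 2 * m ^ 2 + s ^ 2 := by field_simp; ring
    rw [this]
    nlinarith [sq_nonneg (m ^ 2 / s), sq_nonneg m]

/-- The asymptotes are `ih + s(1 ± ic)`. The condition `m ≠ 0` keeps the curve smooth at `s = 0`,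
and stating `hout` through `|Re k|` covers both asymptotes at once. -/
theorem isContour_hyperbola {c m h : ℝ} (hc : 0 < c) (hm : m ≠ 0) (him : 0 ≤ c * |m| + h)
    (hout : ∀ᶠ s : ℝ in atTop, ∀ k : ℂ, |k.re| = s → k.im = c * s + h → k ∉ DPlus K₀ D₀) :
    IsContour K₀ D₀ (hyperbola c m h) := by
  have hpos : ∀ s : ℝ, 0 < s ^ 2 + m ^ 2 := fun s => by positivity
  have hder : ∀ s : ℝ, HasDerivAt (hyperbola c m h)
      (1 + Complex.I * ((c * (s / Real.sqrt (s ^ 2 + m ^ 2)) : ℝ) : ℂ)) s := by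
    intro s
    have h1 : HasDerivAt (fun s : ℝ => s ^ 2 + m ^ 2) (2 * s) s := by
      simpa using (hasDerivAt_pow 2 s).add_const (m ^ 2)
    have h2 := (((h1.sqrt (hpos s).ne').const_mul c).add_const h).ofReal_comp
    have h3 := (Complex.ofRealCLM.hasDerivAt (x := s)).add (h2.const_mul Complex.I)
    refine h3.congr_deriv ?_
    have : (2 * s / (2 * Real.sqrt (s ^ 2 + m ^ 2))) = s / Real.sqrt (s ^ 2 + m ^ 2) := by
      field_simp
    rw [this]; simp
  have hright : Tendsto (fun s : ℝ => hyperbola c m h s -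
      (Complex.I * h + s * (1 + Complex.I * c))) atTop (𝓝 0) := by
    have h1 := ((tendsto_sqrt_sub m).const_mul c).ofReal
    have h2 := h1.const_mul Complex.I
    simp only [mul_zero, Complex.ofReal_zero] at h2
    refine h2.congr fun s => ?_
    simp only [hyperbola]; push_cast; ring
  have hleft : Tendsto (fun s : ℝ => hyperbola c m h s -
      (Complex.I * h + s * (1 - Complex.I * c))) atBot (𝓝 0) := by
    have h1 := (((tendsto_sqrt_sub m).comp tendsto_neg_atBot_atTop).const_mul c).ofReal
    have h2 := h1.const_mul Complex.I
    simp only [mul_zero, Complex.ofReal_zero] at h2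
    refine h2.congr fun s => ?_
    simp only [hyperbola, Function.comp, neg_sq]; push_cast; ring
  refine ⟨?_, ⟨1 + |c|, fun s => ?_⟩, fun s => ?_, ⟨Complex.I * h, 1 + Complex.I * c, ?_, ?_, hright, ?_⟩,
    ⟨Complex.I * h, 1 - Complex.I * c, ?_, ?_, hleft, ?_⟩⟩
  · have h1 : ContDiff ℝ 1 fun s : ℝ => Real.sqrt (s ^ 2 + m ^ 2) :=
      ContDiff.sqrt (by fun_prop) fun s => (hpos s).ne'
    have h2 : ContDiff ℝ 1 fun s : ℝ => ((c * Real.sqrt (s ^ 2 + m ^ 2) + h : ℝ) : ℂ) :=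
      Complex.ofRealCLM.contDiff.comp ((contDiff_const.mul h1).add contDiff_const)
    have h3 : ContDiff ℝ 1 fun s : ℝ => (s : ℂ) := Complex.ofRealCLM.contDiff
    unfold hyperbola
    fun_prop
  · rw [(hder s).deriv]
    refine (norm_add_le _ _).trans ?_
    rw [norm_one, norm_mul, Complex.norm_I, one_mul, Complex.norm_real, norm_mul, Real.norm_eq_abs]
    have : ‖s / Real.sqrt (s ^ 2 + m ^ 2)‖ ≤ 1 := by
      rw [norm_div, Real.norm_of_nonneg (Real.sqrt_nonneg _)]
      refine div_le_one_of_le₀ (Real.le_sqrt_of_sq_le ?_) (Real.sqrt_nonneg _)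
      rw [Real.norm_eq_abs, sq_abs]; nlinarith [sq_nonneg m]
    nlinarith [abs_nonneg c]
  · rw [hyperbola_im]
    have : |m| ≤ Real.sqrt (s ^ 2 + m ^ 2) :=
      Real.le_sqrt_of_sq_le (by rw [sq_abs]; nlinarith [sq_nonneg s])
    nlinarith
  · simp
  · simpa using hc
  · filter_upwards [hout, eventually_ge_atTop 0] with s hs h0
    refine hs _ ?_ ?_
    · simp [abs_of_nonneg h0]
    · simp; ring
  · simp
  · simpa using hc
  · have := tendsto_neg_atBot_atTop.eventually (hout.and (eventually_ge_atTop 0))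
    filter_upwards [this] with s hs
    refine hs.1 _ ?_ ?_
    · simp only [Complex.add_re, Complex.mul_re]
      simp [abs_of_nonpos (neg_nonneg.1 hs.2)]
    · simp; ring

theorem exists_contour_above (hD : 0 < D₀) (M : ℝ) :
    ∃ γ, IsContour K₀ D₀ γ ∧ ∀ z : ℂ, z.im < M → PassesAbove γ z := by
  set h := |M| with hh
  -- The slope `1/2 < 1` makes `Re ω` positive far out on the asymptotes, where it is of order
  -- `(3/4) D₀ s²`; the shift `|M|` lifts the curve to level `M` or higher.
  have hc : IsContour K₀ D₀ (hyperbola (1 / 2) 1 h) := by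
    refine isContour_hyperbola (by norm_num) one_ne_zero (by positivity) ?_
    filter_upwards [eventually_ge_atTop (4 * (h + |K₀| / D₀) + 4)] with s hs k hre him hmem
    have hh0 : 0 ≤ h := abs_nonneg M
    have hK : 0 ≤ |K₀| / D₀ := by positivity
    have h1 := hmem.1
    rw [re_omega, ← sq_abs k.re, hre, him] at h1
    have h2 : K₀ ≤ D₀ * (|K₀| / D₀) := by
      rw [mul_div_cancel₀ _ hD.ne']; exact le_abs_self _
    have h3 : K₀ * (1 / 2 * s + h) ≤ D₀ * (|K₀| / D₀) * (1 / 2 * s + h) :=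
      mul_le_mul_of_nonneg_right h2 (by linarith)
    generalize |K₀| / D₀ = w at *
    have h4 : D₀ * (s ^ 2 - (1 / 2 * s + h) ^ 2 - w * (1 / 2 * s + h)) < 0 := by nlinarith
    have h5 : s ^ 2 - (1 / 2 * s + h) ^ 2 - w * (1 / 2 * s + h) < 0 := by
      by_contra hneg
      have := mul_nonneg hD.le (not_lt.1 hneg)
      linarith
    nlinarith [mul_nonneg hh0 hK, mul_nonneg hh0 hh0, mul_nonneg hK hK]
  refine ⟨_, hc, fun z hz => hc.passesAbove_of_ray fun s _ => ?_⟩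
  rw [hyperbola_im]
  have h1 := Real.sqrt_nonneg (s ^ 2 + 1 ^ 2)
  have h2 : M ≤ h := le_abs_self M
  have h3 : 0 ≤ 1 / 2 * Real.sqrt (s ^ 2 + 1 ^ 2) := by positivity
  exact hz.trans_le (h2.trans (le_add_of_nonneg_left h3))

theorem exists_favourable (hD : 0 < D₀) (hL : 0 < L) {q : BdryCoeff} (hq : q.Nontrivial) :
    ∃ γ, IsFavourable K₀ D₀ (robinDelta K₀ D₀ L q) γ := by
  obtain ⟨M, -, -, -, h⟩ := robinDelta_zero_im (K₀ := K₀) (D₀ := D₀) hL hq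
  obtain ⟨γ, hγ, hz⟩ := exists_contour_above (K₀ := K₀) hD M
  exact ⟨γ, hγ, fun z h0 => hz z (h z h0)⟩

theorem boundaryDPlus_eq : boundaryDPlus K₀ D₀ = hyperbola 1 (K₀ / (2 * D₀)) (-(K₀ / (2 * D₀))) := by
  funext s
  simp only [boundaryDPlus, hyperbola, one_mul, sub_eq_add_neg]

/-- Completing the square, `Re ω = D₀((Re k)² + κ² - (Im k + κ)²)`. -/
theorem mem_DPlus_of_lt (hD : 0 < D₀) {k : ℂ}
    (h : Real.sqrt (k.re ^ 2 + (K₀ / (2 * D₀)) ^ 2) - K₀ / (2 * D₀) < k.im) : k ∈ DPlus K₀ D₀ := by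
  set κ := K₀ / (2 * D₀) with hκ
  have h1 : |κ| ≤ Real.sqrt (k.re ^ 2 + κ ^ 2) :=
    Real.le_sqrt_of_sq_le (by rw [sq_abs]; nlinarith [sq_nonneg k.re])
  have h0 := Real.sqrt_nonneg (k.re ^ 2 + κ ^ 2)
  have h2 := Real.sq_sqrt (by positivity : 0 ≤ k.re ^ 2 + κ ^ 2)
  refine ⟨?_, by linarith [le_abs_self κ]⟩
  have hK : K₀ = 2 * D₀ * κ := by rw [hκ]; field_simp
  rw [re_omega]
  have h3 : k.re ^ 2 + κ ^ 2 < (k.im + κ) ^ 2 := by nlinarith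
  have h4 : D₀ * (k.re ^ 2 - k.im ^ 2) - K₀ * k.im = D₀ * (k.re ^ 2 + κ ^ 2 - (k.im + κ) ^ 2) := by
    rw [hK]; ring
  rw [h4]
  exact mul_neg_of_pos_of_neg hD (by linarith)

/-- Everything on or above `∂D₊` belongs to the closure of `D₊`, so the zeros lie strictly below the
curve and the ray criterion applies. The hypothesis `hE` says that `E` vanishes at `-iκ`. For `κ =
0` this is the point `0` of the closure, contrary to `h`; thus `κ ≠ 0`, and the hyperbola has no
corner. -/
theorem isFavourable_boundaryDPlus (hD : 0 < D₀) {E : ℂ → ℂ} (hE : E (nu K₀ D₀ 0 / 2) = 0)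
    (h : ∀ z ∈ closure (DPlus K₀ D₀), E z ≠ 0) : IsFavourable K₀ D₀ E (boundaryDPlus K₀ D₀) := by
  set κ := K₀ / (2 * D₀) with hκ
  have hK : K₀ = 2 * D₀ * κ := by rw [hκ]; field_simp
  have hclos : ∀ z : ℂ, Real.sqrt (z.re ^ 2 + κ ^ 2) - κ ≤ z.im → z ∈ closure (DPlus K₀ D₀) := by
    intro z hz
    have ht : Tendsto (fun u : ℝ => z + Complex.I * u) (𝓝[>] 0) (𝓝 z) := by
      have : Continuous fun u : ℝ => z + Complex.I * u := by fun_prop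
      simpa using (this.tendsto 0).mono_left nhdsWithin_le_nhds
    refine mem_closure_of_tendsto ht ?_
    filter_upwards [self_mem_nhdsWithin] with u hu
    refine mem_DPlus_of_lt hD ?_
    have : 0 < u := hu
    simp only [Complex.add_re, Complex.add_im, Complex.I_mul_re, Complex.I_mul_im,
      Complex.ofReal_re, Complex.ofReal_im]
    rw [← hκ]
    simp only [neg_zero, add_zero]
    linarith
  have hκ0 : κ ≠ 0 := by
    intro h0
    refine h _ (hclos _ ?_) hE
    have : K₀ = 0 := by rw [hK, h0]; ring
    simp [nu, h0, this]
  have hcont : IsContour K₀ D₀ (boundaryDPlus K₀ D₀) := by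
    rw [boundaryDPlus_eq]
    refine isContour_hyperbola one_pos hκ0 (by rw [one_mul]; linarith [le_abs_self (K₀ / (2 * D₀))]) ?_
    refine Eventually.of_forall fun s k hre him hmem => ?_
    have h1 := hmem.1
    rw [re_omega, ← sq_abs k.re, hre, him, ← hκ] at h1
    have : D₀ * (s ^ 2 - (1 * s + -κ) ^ 2) - K₀ * (1 * s + -κ) = D₀ * κ ^ 2 := by
      rw [hK]; ring
    rw [this] at h1
    have : 0 ≤ D₀ * κ ^ 2 := by positivity
    linarith
  refine ⟨hcont, fun z hz => hcont.passesAbove_of_ray fun s hs => ?_⟩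
  by_contra hle
  refine h z (hclos z ?_) hz
  rw [boundaryDPlus_eq] at hs hle
  rw [hyperbola_re] at hs
  rw [hyperbola_im, hs, ← hκ] at hle
  linarith

end

section

variable {K₀ D₀ L : ℝ} {q : BdryCoeff} {γ : ℝ → ℂ} {x t : ℝ}

/-! ### The transforms -/

theorem norm_exp_mul_ofReal (k : ℂ) (τ : ℝ) : ‖Complex.exp (k * (τ : ℂ))‖ = Real.exp (k.re * τ) := by
  rw [Complex.norm_exp]; simp

theorem exp_mul_le_of_mem {a b r τ : ℝ} (hτ : τ ∈ Ioo a b) :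
    Real.exp (r * τ) ≤ Real.exp (|r| * (|a| + |b|)) := by
  refine Real.exp_le_exp.2 ((le_abs_self _).trans ?_)
  rw [abs_mul]
  refine mul_le_mul_of_nonneg_left (abs_le.2 ⟨?_, ?_⟩) (abs_nonneg r)
  · linarith [hτ.1, neg_abs_le a, abs_nonneg b]
  · linarith [hτ.2, le_abs_self b, abs_nonneg a]

theorem integrable_laplace {a b : ℝ} {f : ℝ → ℝ} (hf : IntegrableOn f (Ioo a b)) (k : ℂ) :
    IntegrableOn (fun τ : ℝ => Complex.exp (k * (τ : ℂ)) * (f τ : ℂ)) (Ioo a b) := by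
  refine Integrable.bdd_mul (c := Real.exp (|k.re| * (|a| + |b|))) hf.ofReal
    (Continuous.aestronglyMeasurable (by fun_prop)) ?_
  refine (ae_restrict_iff' measurableSet_Ioo).2 (Eventually.of_forall fun τ hτ => ?_)
  rw [norm_exp_mul_ofReal]
  exact exp_mul_le_of_mem hτ

theorem norm_laplace_le {a b B : ℝ} {f : ℝ → ℝ} {k : ℂ} (hf : IntegrableOn f (Ioo a b))
    (hB : ∀ τ ∈ Ioo a b, Real.exp (k.re * τ) ≤ B) :
    ‖∫ τ in Ioo a b, Complex.exp (k * (τ : ℂ)) * (f τ : ℂ)‖ ≤ B * ∫ τ in Ioo a b, |f τ| := by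
  rw [← integral_const_mul]
  refine norm_integral_le_of_norm_le (hf.norm.const_mul B) ?_
  refine (ae_restrict_iff' measurableSet_Ioo).2 (Eventually.of_forall fun τ hτ => ?_)
  rw [norm_mul, norm_exp_mul_ofReal, Complex.norm_real]
  exact mul_le_mul_of_nonneg_right (hB τ hτ) (norm_nonneg _)

theorem differentiable_laplace {a b : ℝ} {f : ℝ → ℝ} (hf : IntegrableOn f (Ioo a b)) :
    Differentiable ℂ fun k : ℂ => ∫ τ in Ioo a b, Complex.exp (k * (τ : ℂ)) * (f τ : ℂ) := by
  intro k₀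
  set B := Real.exp ((|k₀.re| + 1) * (|a| + |b|)) with hB
  have hmeas : ∀ k : ℂ, AEStronglyMeasurable
      (fun τ : ℝ => Complex.exp (k * (τ : ℂ)) * (f τ : ℂ)) (volume.restrict (Ioo a b)) :=
    fun k => (integrable_laplace hf k).aestronglyMeasurable
  have h := hasDerivAt_integral_of_dominated_loc_of_deriv_le (μ := volume.restrict (Ioo a b))
    (F := fun (k : ℂ) (τ : ℝ) => Complex.exp (k * (τ : ℂ)) * (f τ : ℂ))
    (F' := fun (k : ℂ) (τ : ℝ) => (τ : ℂ) * (Complex.exp (k * (τ : ℂ)) * (f τ : ℂ)))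
    (bound := fun τ => (|a| + |b|) * (B * |f τ|)) (x₀ := k₀) (s := Metric.ball k₀ 1)
    (Metric.ball_mem_nhds k₀ one_pos) (Eventually.of_forall hmeas) (integrable_laplace hf k₀) ?_ ?_ ?_ ?_
  · exact h.2.differentiableAt
  · exact (Continuous.aestronglyMeasurable (by fun_prop)).mul (hmeas k₀)
  · refine (ae_restrict_iff' measurableSet_Ioo).2 (Eventually.of_forall fun τ hτ k hk => ?_)
    rw [norm_mul, norm_mul, norm_exp_mul_ofReal, Complex.norm_real, Complex.norm_real,
      Real.norm_eq_abs, Real.norm_eq_abs]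
    have hk' : |k.re| ≤ |k₀.re| + 1 := by
      have h1 := (Complex.abs_re_le_norm (k - k₀)).trans (le_of_lt (by
        rwa [Metric.mem_ball, dist_eq_norm] at hk))
      rw [Complex.sub_re] at h1
      have h2 := abs_sub_abs_le_abs_sub k.re k₀.re
      linarith
    have hτ' : |τ| ≤ |a| + |b| := by
      refine abs_le.2 ⟨?_, ?_⟩
      · linarith [hτ.1, neg_abs_le a, abs_nonneg b]
      · linarith [hτ.2, le_abs_self b, abs_nonneg a]
    have h3 : Real.exp (k.re * τ) ≤ B := (exp_mul_le_of_mem hτ).trans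
      (Real.exp_le_exp.2 (mul_le_mul_of_nonneg_right hk' (by positivity)))
    gcongr
  · exact (hf.norm.const_mul B).const_mul _
  · refine Eventually.of_forall fun τ k _ => ?_
    have h1 : HasDerivAt (fun k : ℂ => k * (τ : ℂ)) (τ : ℂ) k := by
      simpa using (hasDerivAt_id k).mul_const (τ : ℂ)
    refine (h1.cexp.mul_const (f τ : ℂ)).congr_deriv ?_
    ring

theorem differentiable_hat {φ : ℝ → ℝ} (hφ : IntegrableOn φ (Ioo 0 L)) :
    Differentiable ℂ (hat L φ) :=
  (differentiable_laplace hφ).comp (by fun_prop : Differentiable ℂ fun k : ℂ => -Complex.I * k)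

theorem differentiable_tilde {f : ℝ → ℝ} (hf : IntegrableOn f (Ioo 0 t)) :
    Differentiable ℂ fun k => tilde f (omega K₀ D₀ k) t :=
  (differentiable_laplace hf).comp (differentiable_omega K₀ D₀)

theorem norm_hat_le {φ : ℝ → ℝ} (hφ : IntegrableOn φ (Ioo 0 L)) {k : ℂ} (hk : 0 ≤ k.im) :
    ‖hat L φ k‖ ≤ Real.exp (L * k.im) * ∫ y in Ioo 0 L, |φ y| := by
  refine norm_laplace_le hφ fun τ hτ => Real.exp_le_exp.2 ?_
  simp only [neg_mul, Complex.neg_re, Complex.I_mul_re, neg_neg]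
  rw [mul_comm]
  exact mul_le_mul_of_nonneg_right hτ.2.le hk

theorem norm_hat_nu_le {φ : ℝ → ℝ} (hφ : IntegrableOn φ (Ioo 0 L)) {k : ℂ} (hk : 0 ≤ k.im) :
    ‖hat L φ (nu K₀ D₀ k)‖ ≤
      Real.exp (L * |K₀ / (2 * D₀)|) ^ 2 * ∫ y in Ioo 0 L, |φ y| := by
  refine norm_laplace_le hφ fun τ hτ => ?_
  rw [← Real.exp_nat_mul]
  refine Real.exp_le_exp.2 ?_
  simp only [neg_mul, Complex.neg_re, Complex.I_mul_re, neg_neg, im_nu]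
  have h1 : -(K₀ / (2 * D₀)) ≤ |K₀ / (2 * D₀)| := neg_le_abs _
  have h2 : K₀ / D₀ = 2 * (K₀ / (2 * D₀)) := by ring
  rw [h2]
  generalize K₀ / (2 * D₀) = κ at *
  push_cast
  have h3 : -k.im - 2 * κ ≤ 2 * |κ| := by linarith
  have h4 := mul_le_mul_of_nonneg_right h3 hτ.1.le
  have h5 := mul_le_mul_of_nonneg_left hτ.2.le (by positivity : 0 ≤ 2 * |κ|)
  linarith

/-- `Re ω` has no fixed sign on the contours. The exponential is monotone in `τ`, so one of the two
endpoint values dominates, and their sum always does. -/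
theorem exp_neg_mul_le_add {w τ t₁ t₂ : ℝ} (h₁ : t₁ ≤ τ) (h₂ : τ ≤ t₂) :
    Real.exp (-(τ * w)) ≤ Real.exp (-(t₁ * w)) + Real.exp (-(t₂ * w)) := by
  rcases le_total 0 w with hw | hw
  · have := Real.exp_le_exp.2 (neg_le_neg (mul_le_mul_of_nonneg_right h₁ hw))
    linarith [Real.exp_pos (-(t₂ * w))]
  · have := Real.exp_le_exp.2 (neg_le_neg (mul_le_mul_of_nonpos_right h₂ hw))
    linarith [Real.exp_pos (-(t₁ * w))]

/-- The factors have to be estimated together, as `e^{-w(t-τ)}`, because the elapsed time `t - τ`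
stays in `[t₁,t₂]`; separately they may be large. -/
theorem norm_exp_mul_laplace_le {a b t₁ t₂ : ℝ} {f : ℝ → ℝ} (hf : IntegrableOn f (Ioo a b))
    (h₁ : t₁ ≤ t - b) (h₂ : t - a ≤ t₂) (w : ℂ) :
    ‖Complex.exp (-w * t) * ∫ τ in Ioo a b, Complex.exp (w * (τ : ℂ)) * (f τ : ℂ)‖ ≤
      (Real.exp (-(t₁ * w.re)) + Real.exp (-(t₂ * w.re))) * ∫ τ in Ioo a b, |f τ| := by
  have h := norm_laplace_le (k := w) (B := (Real.exp (-(t₁ * w.re)) + Real.exp (-(t₂ * w.re))) *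
    Real.exp (w.re * t)) hf fun τ hτ => by
      have h1 := exp_neg_mul_le_add (w := w.re) (τ := t - τ) (t₁ := t₁) (t₂ := t₂)
        (by linarith [hτ.2]) (by linarith [hτ.1])
      have h2 := mul_le_mul_of_nonneg_right h1 (Real.exp_pos (w.re * t)).le
      rwa [← Real.exp_add, show -((t - τ) * w.re) + w.re * t = w.re * τ by ring] at h2
  rw [norm_mul]
  have e : ‖Complex.exp (-w * t)‖ = Real.exp (-(w.re * t)) := by
    rw [norm_exp_mul_ofReal]; simp
  rw [e]
  refine (mul_le_mul_of_nonneg_left h (Real.exp_pos _).le).trans (le_of_eq ?_)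
  have : Real.exp (-(w.re * t)) * Real.exp (w.re * t) = 1 := by rw [← Real.exp_add]; simp
  linear_combination ((Real.exp (-(t₁ * w.re)) + Real.exp (-(t₂ * w.re))) *
    ∫ τ in Ioo a b, |f τ|) * this

theorem norm_exp_mul_tilde_le {f : ℝ → ℝ} (hf : IntegrableOn f (Ioo 0 t)) (w : ℂ) :
    ‖Complex.exp (-w * t) * tilde f w t‖ ≤
      (1 + Real.exp (-(t * w.re))) * ∫ τ in Ioo 0 t, |f τ| := by
  have := norm_exp_mul_laplace_le (t := t) (t₁ := 0) (t₂ := t) hf (by simp) (by simp) w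
  simpa [tilde] using this

/-! ### The integrand with separate time for the initial value -/

/-- The integrand of the general representation, with a separate elapsed time `σ` in the terms
containing the initial value. -/
def heatIntegrand (K₀ D₀ L : ℝ) (q : BdryCoeff) (φ f g : ℝ → ℝ) (x σ t : ℝ) (k : ℂ) : ℂ :=
  Complex.exp (-omega K₀ D₀ k * σ) / robinDelta K₀ D₀ L q k *
      (numA K₀ D₀ L q x k * hat L φ k + numB K₀ D₀ L q x k * hat L φ (nu K₀ D₀ k))
    + Complex.exp (-omega K₀ D₀ k * t) / robinDelta K₀ D₀ L q k *
      (numf K₀ D₀ L q x k * tilde f (omega K₀ D₀ k) t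
      + numg K₀ D₀ L q x k * tilde g (omega K₀ D₀ k) t)

theorem robinIntegrand_eq (φ f g : ℝ → ℝ) :
    robinIntegrand K₀ D₀ L q φ f g x t = heatIntegrand K₀ D₀ L q φ f g x t t := by
  funext k
  unfold robinIntegrand heatIntegrand
  ring

theorem kerBound_nonneg (hD : 0 < D₀) {A c₀ δ : ℝ} (hc₀ : 0 < c₀) (k : ℂ) :
    0 ≤ kerBound K₀ D₀ L A c₀ δ k := by
  unfold kerBound; positivity

/-- The bound is uniform in `σ ∈ [0,t]`, depends on the coefficients only through `A` and `c₀`, and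
is linear in the `L¹` norms of the data. It is the source of all majorants below; the value `t = 0`
is allowed. -/
theorem norm_heatIntegrand_le (hD : 0 < D₀) (hx : x ∈ Ioo 0 L) {A c₀ δ σ : ℝ}
    (hA₁ : |q.a| + |q.α| ≤ A) (hA₂ : |q.b| + |q.β| ≤ A) (hc₀ : 0 < c₀) (hδ₁ : δ ≤ x)
    (hδ₂ : δ ≤ L - x) {k : ℂ} (hk : 0 ≤ k.im)
    (hΔ : c₀ * Real.exp (L * k.im) ≤ ‖robinDelta K₀ D₀ L q k‖) (hσ : σ ∈ Icc 0 t) {φ f g : ℝ → ℝ}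
    (hφ : IntegrableOn φ (Ioo 0 L)) (hf : IntegrableOn f (Ioo 0 t)) (hg : IntegrableOn g (Ioo 0 t)) :
    ‖heatIntegrand K₀ D₀ L q φ f g x σ t k‖ ≤ kerBound K₀ D₀ L A c₀ δ k *
      (1 + Real.exp (-(t * (omega K₀ D₀ k).re))) *
      (2 * (∫ y in Ioo 0 L, |φ y|) + (∫ τ in Ioo 0 t, |f τ|) + ∫ τ in Ioo 0 t, |g τ|) := by
  obtain ⟨b1, b2, b3, b4⟩ := ker_bounds hD hx hA₁ hA₂ hc₀ hδ₁ hδ₂ hk hΔ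
  have hKB := kerBound_nonneg (K₀ := K₀) (L := L) (A := A) (δ := δ) hD hc₀ k
  have h1 := norm_hat_le hφ hk
  have h2 := norm_hat_nu_le (K₀ := K₀) (D₀ := D₀) hφ hk
  have h3 := norm_exp_mul_tilde_le hf (omega K₀ D₀ k)
  have h4 := norm_exp_mul_tilde_le hg (omega K₀ D₀ k)
  have h5 : ‖Complex.exp (-omega K₀ D₀ k * σ)‖ ≤ 1 + Real.exp (-(t * (omega K₀ D₀ k).re)) := by
    have := exp_neg_mul_le_add (w := (omega K₀ D₀ k).re) hσ.1 hσ.2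
    rw [norm_exp_mul_ofReal, Complex.neg_re, neg_mul, mul_comm]
    simpa using this
  have hF : 0 ≤ ∫ y in Ioo 0 L, |φ y| := integral_nonneg fun _ => abs_nonneg _
  have e : heatIntegrand K₀ D₀ L q φ f g x σ t k =
      Complex.exp (-omega K₀ D₀ k * σ) * (numA K₀ D₀ L q x k / robinDelta K₀ D₀ L q k * hat L φ k)
      + Complex.exp (-omega K₀ D₀ k * σ) *
        (numB K₀ D₀ L q x k / robinDelta K₀ D₀ L q k * hat L φ (nu K₀ D₀ k))
      + numf K₀ D₀ L q x k / robinDelta K₀ D₀ L q k *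
        (Complex.exp (-omega K₀ D₀ k * t) * tilde f (omega K₀ D₀ k) t)
      + numg K₀ D₀ L q x k / robinDelta K₀ D₀ L q k *
        (Complex.exp (-omega K₀ D₀ k * t) * tilde g (omega K₀ D₀ k) t) := by
    unfold heatIntegrand; ring
  rw [e]
  set Y := 1 + Real.exp (-(t * (omega K₀ D₀ k).re)) with hY
  have hY0 : 0 ≤ Y := by positivity
  have p1 : ‖numA K₀ D₀ L q x k / robinDelta K₀ D₀ L q k * hat L φ k‖ ≤
      kerBound K₀ D₀ L A c₀ δ k * ∫ y in Ioo 0 L, |φ y| := by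
    rw [norm_mul]
    refine (mul_le_mul_of_nonneg_left h1 (norm_nonneg _)).trans ?_
    rw [← mul_assoc]
    exact mul_le_mul_of_nonneg_right b1 hF
  have p2 : ‖numB K₀ D₀ L q x k / robinDelta K₀ D₀ L q k * hat L φ (nu K₀ D₀ k)‖ ≤
      kerBound K₀ D₀ L A c₀ δ k * ∫ y in Ioo 0 L, |φ y| := by
    rw [norm_mul]
    refine (mul_le_mul_of_nonneg_left h2 (norm_nonneg _)).trans ?_
    rw [← mul_assoc]
    exact mul_le_mul_of_nonneg_right b2 hF
  have q1 := norm_mul_le_of_le h5 p1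
  have q2 := norm_mul_le_of_le h5 p2
  have q3 := norm_mul_le_of_le b3 h3
  have q4 := norm_mul_le_of_le b4 h4
  refine (norm_add₄_le).trans ?_
  linarith

/-- The majorant along a contour. -/
theorem IsContour.kerBound_decay (hγ : IsContour K₀ D₀ γ) (hD : 0 < D₀) (A : ℝ) {c₀ δ : ℝ}
    (hc₀ : 0 < c₀) (hδ : 0 < δ) (ht : 0 < t) : ∃ c, 0 < c ∧ ∃ B, ∀ s,
      kerBound K₀ D₀ L A c₀ δ (γ s) * (1 + Real.exp (-(t * (omega K₀ D₀ (γ s)).re))) ≤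
        B * Real.exp (-(c * |s|)) := by
  obtain ⟨c, hc, C, hC, hb⟩ := hγ.bounds
  -- As before, `η` is chosen so that `e^{-tω}` costs half of the decay of `e^{-δ Im k}`; the
  -- quadratic weight then takes half of what is left.
  obtain ⟨C', hC', hω⟩ := hγ.omega_lower hD (η := δ * c / (2 * t)) (by positivity)
  obtain ⟨B, hB, hpow⟩ := exists_pow_mul_exp_le (c := δ * c / 2) (by positivity) 2
  set N := (1 + 2 * D₀) * (1 + A) ^ 2 * Real.exp (L * |K₀ / (2 * D₀)|) ^ 3 / c₀ with hN
  have hN0 : 0 ≤ N := by positivity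
  set κ := |K₀ / (2 * D₀)| with hκ
  have hκ0 : 0 ≤ κ := abs_nonneg _
  set G := Real.exp (δ * C) + Real.exp (δ * C + t * C') with hG
  refine ⟨δ * c / 2 / 2, by positivity, N * (1 + 2 * κ + C) ^ 2 * G * B, fun s => ?_⟩
  have hs := abs_nonneg s
  have hw : weight K₀ D₀ (γ s) ≤ (1 + 2 * κ + C) * (1 + |s|) := by
    unfold weight
    rw [← hκ]
    nlinarith [(hb s).1, mul_nonneg hκ0 hs]
  have hw0 := (weight_pos (K₀ := K₀) (D₀ := D₀) (γ s)).le
  have hy : Real.exp (-(δ * (γ s).im)) * (1 + Real.exp (-(t * (omega K₀ D₀ (γ s)).re))) ≤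
      G * Real.exp (-(δ * c / 2 * |s|)) := by
    have q1 := mul_le_mul_of_nonneg_left (hb s).2.1 hδ.le
    have q2 := mul_le_mul_of_nonneg_left (hω s) ht.le
    have q3 : t * (-(δ * c / (2 * t) * |s|) - C') = -(δ * c / 2 * |s|) - t * C' := by
      field_simp
    rw [q3] at q2
    rw [mul_add, mul_one, ← Real.exp_add, hG, add_mul, ← Real.exp_add, ← Real.exp_add]
    have q4 : 0 ≤ δ * c / 2 * |s| := by positivity
    refine add_le_add (Real.exp_le_exp.2 ?_) (Real.exp_le_exp.2 ?_)
    · nlinarith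
    · nlinarith
  unfold kerBound
  rw [← hκ, ← hN]
  calc N * weight K₀ D₀ (γ s) ^ 2 * Real.exp (-(δ * (γ s).im)) *
        (1 + Real.exp (-(t * (omega K₀ D₀ (γ s)).re)))
      = N * weight K₀ D₀ (γ s) ^ 2 * (Real.exp (-(δ * (γ s).im)) *
        (1 + Real.exp (-(t * (omega K₀ D₀ (γ s)).re)))) := by ring
    _ ≤ N * ((1 + 2 * κ + C) * (1 + |s|)) ^ 2 * (G * Real.exp (-(δ * c / 2 * |s|))) :=
        mul_le_mul (mul_le_mul_of_nonneg_left (pow_le_pow_left₀ hw0 hw 2) hN0) hy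
          (by positivity) (by positivity)
    _ = N * (1 + 2 * κ + C) ^ 2 * G * ((1 + |s|) ^ 2 * Real.exp (-(δ * c / 2 * |s|))) := by ring
    _ ≤ N * (1 + 2 * κ + C) ^ 2 * G * (B * Real.exp (-(δ * c / 2 / 2 * |s|))) :=
        mul_le_mul_of_nonneg_left (hpow _ hs) (by positivity)
    _ = _ := by ring

theorem continuous_pullback_heatIntegrand (hγ : IsFavourable K₀ D₀ (robinDelta K₀ D₀ L q) γ)
    {φ f g : ℝ → ℝ} (σ : ℝ) (hφ : IntegrableOn φ (Ioo 0 L)) (hf : IntegrableOn f (Ioo 0 t))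
    (hg : IntegrableOn g (Ioo 0 t)) :
    Continuous (pullback γ (heatIntegrand K₀ D₀ L q φ f g x σ t)) := by
  have hγc := hγ.1.contDiff.continuous
  have c0 := (differentiable_omega K₀ D₀).continuous.comp hγc
  have c1 := (differentiable_robinDelta (K₀ := K₀) (D₀ := D₀) (L := L) (q := q)).continuous.comp hγc
  have c2 := (differentiable_numA (K₀ := K₀) (D₀ := D₀) (L := L) (q := q) (x := x)).continuous.comp hγc
  have c3 := (differentiable_numB (K₀ := K₀) (D₀ := D₀) (L := L) (q := q) (x := x)).continuous.comp hγc
  have c4 := (differentiable_numf (K₀ := K₀) (D₀ := D₀) (L := L) (q := q) (x := x)).continuous.comp hγc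
  have c5 := (differentiable_numg (K₀ := K₀) (D₀ := D₀) (L := L) (q := q) (x := x)).continuous.comp hγc
  have c6 := (differentiable_hat hφ).continuous.comp hγc
  have c7 := ((differentiable_hat hφ).continuous.comp (differentiable_nu K₀ D₀).continuous).comp hγc
  have c8 := (differentiable_tilde (K₀ := K₀) (D₀ := D₀) hf).continuous.comp hγc
  have c9 := (differentiable_tilde (K₀ := K₀) (D₀ := D₀) hg).continuous.comp hγc
  have hE : ∀ τ : ℝ, Continuous fun s => Complex.exp (-omega K₀ D₀ (γ s) * τ) := fun τ =>
    Complex.continuous_exp.comp (c0.neg.mul continuous_const)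
  refine Continuous.mul ?_ hγ.1.continuous_deriv
  exact (((hE σ).div c1 hγ.ne_zero).mul ((c2.mul c6).add (c3.mul c7))).add
    (((hE t).div c1 hγ.ne_zero).mul ((c4.mul c8).add (c5.mul c9)))

theorem integrable_heatIntegrand (hD : 0 < D₀) (hx : x ∈ Ioo 0 L) (ht : 0 < t) (hq : q.Nontrivial)
    (hγ : IsFavourable K₀ D₀ (robinDelta K₀ D₀ L q) γ) {σ : ℝ} (hσ : σ ∈ Icc 0 t) {φ f g : ℝ → ℝ}
    (hφ : IntegrableOn φ (Ioo 0 L)) (hf : IntegrableOn f (Ioo 0 t)) (hg : IntegrableOn g (Ioo 0 t)) :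
    Integrable (pullback γ (heatIntegrand K₀ D₀ L q φ f g x σ t)) := by
  obtain ⟨c₀, hc₀, hΔ⟩ := robinDelta_contour (hx.1.trans hx.2) hq hγ
  have hΔ' := hΔ.self_of_nhds
  set δ := min x (L - x) with hδ
  have hδ0 : 0 < δ := lt_min hx.1 (by linarith [hx.2])
  obtain ⟨c, hc, B, hdec⟩ := hγ.1.kerBound_decay (L := L) (t := t) hD
    (|q.a| + |q.α| + (|q.b| + |q.β|)) hc₀ hδ0 ht
  obtain ⟨C', hC'⟩ := hγ.1.bounded_deriv
  refine Integrable.mono' (g := fun s => B * Real.exp (-(c * |s|)) *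
    (2 * (∫ y in Ioo 0 L, |φ y|) + (∫ τ in Ioo 0 t, |f τ|) + ∫ τ in Ioo 0 t, |g τ|) * C')
    ((((integrable_exp_neg_abs hc).const_mul B).mul_const _).mul_const _)
    (continuous_pullback_heatIntegrand hγ σ hφ hf hg).aestronglyMeasurable
    (Eventually.of_forall fun s => ?_)
  have hb := norm_heatIntegrand_le hD hx (σ := σ) (A := |q.a| + |q.α| + (|q.b| + |q.β|))
    (le_add_of_nonneg_right (by positivity)) (le_add_of_nonneg_left (by positivity)) hc₀
    (min_le_left _ _) (min_le_right _ _) (hγ.1.im_nonneg s) (hΔ' s) hσ hφ hf hg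
  have hN : 0 ≤ 2 * (∫ y in Ioo 0 L, |φ y|) + (∫ τ in Ioo 0 t, |f τ|) + ∫ τ in Ioo 0 t, |g τ| := by
    have := integral_nonneg (μ := volume.restrict (Ioo 0 L)) (f := fun y => |φ y|) fun _ => abs_nonneg _
    have := integral_nonneg (μ := volume.restrict (Ioo 0 t)) (f := fun y => |f y|) fun _ => abs_nonneg _
    have := integral_nonneg (μ := volume.restrict (Ioo 0 t)) (f := fun y => |g y|) fun _ => abs_nonneg _
    linarith
  have h1 := hb.trans (mul_le_mul_of_nonneg_right (hdec s) hN)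
  rw [pullback, norm_mul]
  exact mul_le_mul h1 (hC' s) (norm_nonneg _) ((norm_nonneg _).trans h1)

/-- The vanishing of the contour integral at elapsed time zero. -/
theorem integral_heatIntegrand_zero (hD : 0 < D₀) (hx : x ∈ Ioo 0 L) (hq : q.Nontrivial)
    (hγ : IsFavourable K₀ D₀ (robinDelta K₀ D₀ L q) γ) (ht : 0 < t) {φ : ℝ → ℝ}
    (hφ : IntegrableOn φ (Ioo 0 L)) :
    contourIntegral γ (heatIntegrand K₀ D₀ L q φ 0 0 x 0 t) = 0 := by
  have hL := hx.1.trans hx.2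
  obtain ⟨M, c₀, hc₀, hfar, hzero⟩ := robinDelta_zero_im (K₀ := K₀) (D₀ := D₀) hL hq
  set δ := min x (L - x) with hδ
  have hδ0 : 0 < δ := lt_min hx.1 (by linarith [hx.2])
  set h : ℂ → ℂ := fun k => numA K₀ D₀ L q x k * hat L φ k +
    numB K₀ D₀ L q x k * hat L φ (nu K₀ D₀ k) with hh
  have hz : IntegrableOn (0 : ℝ → ℝ) (Ioo 0 t) := integrable_zero _ _ _
  have e : heatIntegrand K₀ D₀ L q φ 0 0 x 0 t = fun k => h k / robinDelta K₀ D₀ L q k := by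
    funext k
    simp [heatIntegrand, tilde, hh]
    ring
  -- Without boundary data and at `σ = 0` the integrand does not depend on `t`. Integrability is
  -- taken from a positive `t`. The pointwise bound is taken at `t = 0`, where `e^{-tω}` disappears
  -- and pure decay in `Im k` remains throughout the upper half plane above level `M`.
  have e0 : heatIntegrand K₀ D₀ L q φ 0 0 x 0 0 = fun k => h k / robinDelta K₀ D₀ L q k := by
    funext k
    simp [heatIntegrand, tilde, hh]
    ring
  have hint := integrable_heatIntegrand hD hx ht hq hγ (σ := 0) ⟨le_rfl, ht.le⟩ hφ hz hz
  rw [e] at hint ⊢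
  have hd : Differentiable ℂ h := (differentiable_numA.mul (differentiable_hat hφ)).add
    (differentiable_numB.mul ((differentiable_hat hφ).comp (differentiable_nu K₀ D₀)))
  have hw : robinDelta K₀ D₀ L q (Complex.I * M) ≠ 0 := by
    intro h0
    have := hzero _ h0
    simp at this
  set A := |q.a| + |q.α| + (|q.b| + |q.β|) with hA
  set N := (1 + 2 * D₀) * (1 + A) ^ 2 * Real.exp (L * |K₀ / (2 * D₀)|) ^ 3 / c₀ with hN
  have hN0 : 0 ≤ N := by positivity
  have hF : 0 ≤ ∫ y in Ioo 0 L, |φ y| := integral_nonneg fun _ => abs_nonneg _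
  refine hγ.integral_eq_zero (M := max M 0) (n := 2) (δ := δ)
    (A := N * (1 + 2 * |K₀ / (2 * D₀)|) ^ 2 * 2 * (2 * ∫ y in Ioo 0 L, |φ y|)) hd
    differentiable_robinDelta hw (fun z h0 => (hzero z h0).trans_le (le_max_left _ _)) (by positivity)
    hδ0 (fun k hk => ?_) hint
  have hz0 : IntegrableOn (0 : ℝ → ℝ) (Ioo 0 0) := integrable_zero _ _ _
  have hb := norm_heatIntegrand_le (t := 0) (σ := 0) (q := q) (K₀ := K₀) hD hx (A := A)
    (le_add_of_nonneg_right (by positivity)) (le_add_of_nonneg_left (by positivity)) hc₀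
    (min_le_left _ _) (min_le_right _ _) ((le_max_right _ _).trans hk)
    (hfar k ((le_max_left _ _).trans hk)) ⟨le_rfl, le_rfl⟩ hφ hz0 hz0
  rw [e0] at hb
  have hw1 : weight K₀ D₀ k ^ 2 ≤ (1 + 2 * |K₀ / (2 * D₀)|) ^ 2 * (1 + ‖k‖) ^ 2 := by
    rw [← mul_pow]
    refine pow_le_pow_left₀ (weight_pos k).le ?_ 2
    unfold weight
    nlinarith [mul_nonneg (abs_nonneg (K₀ / (2 * D₀))) (norm_nonneg k)]
  refine hb.trans ?_
  simp only [kerBound, ← hN, zero_mul, neg_zero, Real.exp_zero, Pi.zero_apply, abs_zero,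
    integral_zero, add_zero]
  have h3 := mul_le_mul_of_nonneg_left hw1 (by positivity :
    0 ≤ N * Real.exp (-(δ * k.im)) * 2 * (2 * ∫ y in Ioo 0 L, |φ y|))
  linarith

end

section

variable {K₀ D₀ L : ℝ} {q : BdryCoeff} {γ : ℝ → ℂ} {x t : ℝ}

/-! ### Continuity of the contour integral in the data -/

/-- Convergence in the mean on `(a,b)`. -/
structure MeanTendsto {ι : Type*} (l : Filter ι) (a b : ℝ) (φ : ι → ℝ → ℝ) (φ₀ : ℝ → ℝ) : Prop where
  integrable : ∀ᶠ i in l, IntegrableOn (φ i) (Ioo a b)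
  integrable_lim : IntegrableOn φ₀ (Ioo a b)
  tendsto : Tendsto (fun i => ∫ y in Ioo a b, |φ i y - φ₀ y|) l (𝓝 0)

namespace MeanTendsto

variable {ι : Type*} {l : Filter ι} {a b : ℝ} {φ : ι → ℝ → ℝ} {φ₀ : ℝ → ℝ}

theorem const (h : IntegrableOn φ₀ (Ioo a b)) : MeanTendsto l a b (fun _ => φ₀) φ₀ :=
  ⟨Eventually.of_forall fun _ => h, h, by simp [tendsto_const_nhds]⟩

theorem eventually_le (h : MeanTendsto l a b φ φ₀) :
    ∀ᶠ i in l, ∫ y in Ioo a b, |φ i y| ≤ (∫ y in Ioo a b, |φ₀ y|) + 1 := by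
  filter_upwards [h.integrable, h.tendsto.eventually (gt_mem_nhds one_pos)] with i hi h1
  have h2 : ∫ y in Ioo a b, |φ i y| ≤ ∫ y in Ioo a b, (|φ₀ y| + |φ i y - φ₀ y|) := by
    refine integral_mono hi.norm (h.integrable_lim.norm.add (hi.sub h.integrable_lim).norm)
      fun y => ?_
    simpa using abs_add_le (φ₀ y) (φ i y - φ₀ y)
  have h3 : ∫ y in Ioo a b, (|φ₀ y| + |φ i y - φ₀ y|) =
      (∫ y in Ioo a b, |φ₀ y|) + ∫ y in Ioo a b, |φ i y - φ₀ y| :=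
    integral_add h.integrable_lim.norm (hi.sub h.integrable_lim).norm
  linarith

theorem laplace (h : MeanTendsto l a b φ φ₀) (k : ℂ) :
    Tendsto (fun i => ∫ τ in Ioo a b, Complex.exp (k * (τ : ℂ)) * (φ i τ : ℂ)) l
      (𝓝 (∫ τ in Ioo a b, Complex.exp (k * (τ : ℂ)) * (φ₀ τ : ℂ))) := by
  rw [tendsto_iff_norm_sub_tendsto_zero]
  set B := Real.exp (|k.re| * (|a| + |b|))
  refine squeeze_zero' (Eventually.of_forall fun _ => norm_nonneg _) ?_
    (by simpa using h.tendsto.const_mul B)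
  filter_upwards [h.integrable] with i hi
  rw [← integral_sub (integrable_laplace hi k) (integrable_laplace h.integrable_lim k)]
  have := norm_laplace_le (k := k) (B := B) (hi.sub h.integrable_lim) fun τ hτ =>
    exp_mul_le_of_mem hτ
  simpa [mul_sub] using this

end MeanTendsto

/-- One dominated convergence argument for three limits: starting time to zero, starting time to
`t`, and `α → ∞` in the Neumann problem. The filter is therefore arbitrary, and the coefficients
`a`, `b` may vary too. -/
theorem tendsto_contourIntegral_heatIntegrand {ι : Type*} {l : Filter ι} [l.IsCountablyGenerated]
    (hD : 0 < D₀) (hx : x ∈ Ioo 0 L) (ht : 0 < t) (hq : q.Nontrivial)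
    (hγ : IsFavourable K₀ D₀ (robinDelta K₀ D₀ L q) γ)
    {a b σ : ι → ℝ} {σ₀ : ℝ} {φ f g : ι → ℝ → ℝ} {φ₀ f₀ g₀ : ℝ → ℝ}
    (ha : Tendsto a l (𝓝 q.a)) (hb : Tendsto b l (𝓝 q.b))
    (hσ : ∀ᶠ i in l, σ i ∈ Icc 0 t) (hσ₀ : Tendsto σ l (𝓝 σ₀))
    (hφ : MeanTendsto l 0 L φ φ₀) (hf : MeanTendsto l 0 t f f₀) (hg : MeanTendsto l 0 t g g₀) :
    Tendsto (fun i => contourIntegral γ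
        (heatIntegrand K₀ D₀ L ⟨a i, q.α, b i, q.β⟩ (φ i) (f i) (g i) x (σ i) t)) l
      (𝓝 (contourIntegral γ (heatIntegrand K₀ D₀ L q φ₀ f₀ g₀ x σ₀ t))) := by
  have hL := hx.1.trans hx.2
  obtain ⟨c₀, hc₀, hΔ⟩ := robinDelta_contour hL hq hγ
  set δ := min x (L - x) with hδ
  have hδ0 : 0 < δ := lt_min hx.1 (by linarith [hx.2])
  -- The extra ones leave room for the coefficients `a i`, `b i` close to the limit.
  set A := |q.a| + 1 + |q.α| + (|q.b| + 1 + |q.β|) with hA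
  obtain ⟨c, hc, B, hdec⟩ := hγ.1.kerBound_decay (L := L) (t := t) hD A hc₀ hδ0 ht
  obtain ⟨C', hC'⟩ := hγ.1.bounded_deriv
  have hab : Tendsto (fun i => (a i, b i)) l (𝓝 (q.a, q.b)) := ha.prodMk_nhds hb
  have haA := (ha.abs).eventually (gt_mem_nhds (lt_add_one |q.a|))
  have hbA := (hb.abs).eventually (gt_mem_nhds (lt_add_one |q.b|))
  set N := 2 * ((∫ y in Ioo 0 L, |φ₀ y|) + 1) + ((∫ y in Ioo 0 t, |f₀ y|) + 1)
    + ((∫ y in Ioo 0 t, |g₀ y|) + 1) with hN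
  refine tendsto_integral_filter_of_dominated_convergence
    (fun s => B * Real.exp (-(c * |s|)) * N * C') ?_ ?_
    ((((integrable_exp_neg_abs hc).const_mul B).mul_const _).mul_const _) ?_
  · filter_upwards [hab.eventually (favourable_nearby hL hq hγ), hφ.integrable, hf.integrable,
      hg.integrable] with i hi h1 h2 h3
    exact (continuous_pullback_heatIntegrand hi (σ i) h1 h2 h3).aestronglyMeasurable
  · filter_upwards [hab.eventually hΔ, hφ.integrable, hf.integrable, hg.integrable, haA, hbA, hσ,
      hφ.eventually_le, hf.eventually_le, hg.eventually_le] with i hi h1 h2 h3 h4 h5 h6 h7 h8 h9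
    refine Eventually.of_forall fun s => ?_
    have hbd := norm_heatIntegrand_le (q := ⟨a i, q.α, b i, q.β⟩) hD hx (σ := σ i) (A := A)
      (by simp only; linarith [abs_nonneg q.b, abs_nonneg q.β])
      (by simp only; linarith [abs_nonneg q.a, abs_nonneg q.α]) hc₀
      (min_le_left _ _) (min_le_right _ _) (hγ.1.im_nonneg s) (hi s) h6 h1 h2 h3
    have hN0 : 0 ≤ 2 * (∫ y in Ioo 0 L, |φ i y|) + (∫ τ in Ioo 0 t, |f i τ|) +
        ∫ τ in Ioo 0 t, |g i τ| :=
      add_nonneg (add_nonneg (mul_nonneg two_pos.le (integral_nonneg fun _ => abs_nonneg _))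
        (integral_nonneg fun _ => abs_nonneg _)) (integral_nonneg fun _ => abs_nonneg _)
    have hE0 : 0 ≤ B * Real.exp (-(c * |s|)) :=
      le_trans (mul_nonneg (kerBound_nonneg hD hc₀ _) (by positivity)) (hdec s)
    have hb1 := hbd.trans (mul_le_mul (hdec s)
      (add_le_add (add_le_add (mul_le_mul_of_nonneg_left h7 two_pos.le) h8) h9) hN0 hE0)
    rw [pullback, norm_mul]
    exact mul_le_mul hb1 (hC' s) (norm_nonneg _) ((norm_nonneg _).trans hb1)
  · refine Eventually.of_forall fun s => ?_
    refine Tendsto.mul_const _ ?_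
    have tσ : Tendsto (fun i => ((σ i : ℝ) : ℂ)) l (𝓝 σ₀) := (Complex.continuous_ofReal.tendsto _).comp hσ₀
    have ta : Tendsto (fun i => ((a i : ℝ) : ℂ)) l (𝓝 q.a) := (Complex.continuous_ofReal.tendsto _).comp ha
    have tb : Tendsto (fun i => ((b i : ℝ) : ℂ)) l (𝓝 q.b) := (Complex.continuous_ofReal.tendsto _).comp hb
    have t1 : Tendsto (fun i => hat L (φ i) (γ s)) l (𝓝 (hat L φ₀ (γ s))) := hφ.laplace _
    have t2 : Tendsto (fun i => hat L (φ i) (nu K₀ D₀ (γ s))) l (𝓝 (hat L φ₀ (nu K₀ D₀ (γ s)))) :=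
      hφ.laplace _
    have t3 : Tendsto (fun i => tilde (f i) (omega K₀ D₀ (γ s)) t) l
      (𝓝 (tilde f₀ (omega K₀ D₀ (γ s)) t)) := hf.laplace _
    have t4 : Tendsto (fun i => tilde (g i) (omega K₀ D₀ (γ s)) t) l
      (𝓝 (tilde g₀ (omega K₀ D₀ (γ s)) t)) := hg.laplace _
    have tS : ∀ k, Tendsto (fun i => symb (a i) q.α k) l (𝓝 (symb q.a q.α k)) :=
      fun k => ta.sub_const _
    have tS' : ∀ k, Tendsto (fun i => symb (b i) q.β k) l (𝓝 (symb q.b q.β k)) :=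
      fun k => tb.sub_const _
    have tF : ∀ k y, Tendsto (fun i => robinF K₀ D₀ (a i) q.α k y) l (𝓝 (robinF K₀ D₀ q.a q.α k y)) :=
      fun k y => ((ta.const_sub _).mul_const _).sub_const _
    have tF' : ∀ k y, Tendsto (fun i => robinF K₀ D₀ (b i) q.β k y) l (𝓝 (robinF K₀ D₀ q.b q.β k y)) :=
      fun k y => ((tb.const_sub _).mul_const _).sub_const _
    have tΔ : Tendsto (fun i => robinDelta K₀ D₀ L ⟨a i, q.α, b i, q.β⟩ (γ s)) l
        (𝓝 (robinDelta K₀ D₀ L q (γ s))) :=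
      (((tS _).const_mul _).mul (tS' _)).sub (((tS _).const_mul _).mul (tS' _))
    have tA : Tendsto (fun i => numA K₀ D₀ L ⟨a i, q.α, b i, q.β⟩ x (γ s)) l
        (𝓝 (numA K₀ D₀ L q x (γ s))) := ((tF _ _).mul (tS' _)).mul_const _
    have tB : Tendsto (fun i => numB K₀ D₀ L ⟨a i, q.α, b i, q.β⟩ x (γ s)) l
        (𝓝 (numB K₀ D₀ L q x (γ s))) := ((tF' _ _).mul (tS _)).neg
    have tf : Tendsto (fun i => numf K₀ D₀ L ⟨a i, q.α, b i, q.β⟩ x (γ s)) l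
        (𝓝 (numf K₀ D₀ L q x (γ s))) := (tF' _ _).const_mul _
    have tg : Tendsto (fun i => numg K₀ D₀ L ⟨a i, q.α, b i, q.β⟩ x (γ s)) l
        (𝓝 (numg K₀ D₀ L q x (γ s))) := (((tF _ _).mul_const _).const_mul _).neg
    have tE : Tendsto (fun i => Complex.exp (-omega K₀ D₀ (γ s) * (σ i : ℝ))) l
        (𝓝 (Complex.exp (-omega K₀ D₀ (γ s) * σ₀))) :=
      (Complex.continuous_exp.tendsto _).comp (tσ.const_mul _)
    exact ((tE.div tΔ (hγ.ne_zero s)).mul ((tA.mul t1).add (tB.mul t2))).add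
      ((tendsto_const_nhds.div tΔ (hγ.ne_zero s)).mul ((tf.mul t3).add (tg.mul t4)))

end

section

variable {K₀ D₀ L : ℝ} {θ₀ : ℝ → ℝ} {θ : ℝ → ℝ → ℝ}

/-! ### The global relation -/

theorem intervalIntegral_swap {a b c d : ℝ} (hab : a ≤ b) (hcd : c ≤ d) {r : ℝ → ℝ → ℂ}
    (hr : ContinuousOn (Function.uncurry r) (Icc a b ×ˢ Icc c d)) :
    ∫ y in a..b, ∫ τ in c..d, r y τ = ∫ τ in c..d, ∫ y in a..b, r y τ := by
  simp only [intervalIntegral.integral_of_le hab, intervalIntegral.integral_of_le hcd]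
  refine integral_integral_swap ?_
  rw [Measure.prod_restrict]
  exact (hr.integrableOn_compact (isCompact_Icc.prod isCompact_Icc)).mono_set
    (prod_mono Ioc_subset_Icc_self Ioc_subset_Icc_self)

/-- As `u_t = W_x = r`, both sides are iterated integrals of the continuous function `r`, in the two
orders. -/
theorem green_rectangle_interior {a b c d : ℝ} (hab : a ≤ b) (hcd : c ≤ d) {u W r : ℝ → ℝ → ℂ}
    (hr : ContinuousOn (Function.uncurry r) (Icc a b ×ˢ Icc c d))
    (hu : ∀ y ∈ Icc a b, ∀ τ ∈ Icc c d, HasDerivAt (u y) (r y τ) τ)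
    (hW : ∀ y ∈ Icc a b, ∀ τ ∈ Icc c d, HasDerivAt (fun y => W y τ) (r y τ) y) :
    ∫ y in a..b, (u y d - u y c) = ∫ τ in c..d, (W b τ - W a τ) := by
  have h1 : ∫ y in a..b, (u y d - u y c) = ∫ y in a..b, ∫ τ in c..d, r y τ := by
    refine intervalIntegral.integral_congr fun y hy => ?_
    rw [uIcc_of_le hab] at hy
    refine (intervalIntegral.integral_eq_sub_of_hasDerivAt (fun τ hτ => ?_) ?_).symm
    · rw [uIcc_of_le hcd] at hτ
      exact hu y hy τ hτ
    · refine ContinuousOn.intervalIntegrable ?_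
      rw [uIcc_of_le hcd]
      exact hr.comp (f := fun τ => (y, τ)) (by fun_prop) fun τ hτ => ⟨hy, hτ⟩
  have h2 : ∫ τ in c..d, (W b τ - W a τ) = ∫ τ in c..d, ∫ y in a..b, r y τ := by
    refine intervalIntegral.integral_congr fun τ hτ => ?_
    rw [uIcc_of_le hcd] at hτ
    refine (intervalIntegral.integral_eq_sub_of_hasDerivAt (f := fun y => W y τ) (fun y hy => ?_)
      ?_).symm
    · rw [uIcc_of_le hab] at hy
      exact hW y hy τ hτ
    · refine ContinuousOn.intervalIntegrable ?_
      rw [uIcc_of_le hab]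
      exact hr.comp (f := fun y => (y, τ)) (by fun_prop) fun y hy => ⟨hy, hτ⟩
  rw [h1, h2, intervalIntegral_swap hab hcd hr]

/-- Clamping both coordinates to the rectangle. Global continuity makes the limit in
`green_rectangle` a matter of evaluating continuous functions. -/
theorem exists_continuous_extension {a b c d : ℝ} (hab : a ≤ b) (hcd : c ≤ d) {u : ℝ → ℝ → ℂ}
    (hu : ContinuousOn (Function.uncurry u) (Icc a b ×ˢ Icc c d)) :
    ∃ v : ℝ → ℝ → ℂ, Continuous (Function.uncurry v) ∧
      ∀ y ∈ Icc a b, ∀ τ ∈ Icc c d, v y τ = u y τ := by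
  refine ⟨fun y τ => u (projIcc a b hab y) (projIcc c d hcd τ), ?_, fun y hy τ hτ => ?_⟩
  · refine hu.comp_continuous (f := fun p : ℝ × ℝ =>
      ((projIcc a b hab p.1 : ℝ), (projIcc c d hcd p.2 : ℝ))) ?_ fun p => ?_
    · exact (continuous_subtype_val.comp (continuous_projIcc.comp continuous_fst)).prodMk
        (continuous_subtype_val.comp (continuous_projIcc.comp continuous_snd))
    · exact ⟨Subtype.coe_prop _, Subtype.coe_prop _⟩
  · simp only [projIcc_of_mem hab hy, projIcc_of_mem hcd hτ]

/-- Derivatives are available only for interior `y`. The formula holds on `[a + ε, b - ε]`, and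
continuity of `u` and `W` up to the sides permits `ε → 0`. -/
theorem green_rectangle {a b c d : ℝ} (hab : a < b) (hcd : c ≤ d) {u W r : ℝ → ℝ → ℂ}
    (hr : ContinuousOn (Function.uncurry r) (Ioo a b ×ˢ Icc c d))
    (hu : ∀ y ∈ Ioo a b, ∀ τ ∈ Icc c d, HasDerivAt (u y) (r y τ) τ)
    (hW : ∀ y ∈ Ioo a b, ∀ τ ∈ Icc c d, HasDerivAt (fun y => W y τ) (r y τ) y)
    (huc : ContinuousOn (Function.uncurry u) (Icc a b ×ˢ Icc c d))
    (hWc : ContinuousOn (Function.uncurry W) (Icc a b ×ˢ Icc c d)) :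
    ∫ y in a..b, (u y d - u y c) = ∫ τ in c..d, (W b τ - W a τ) := by
  obtain ⟨v, hv, hvu⟩ := exists_continuous_extension hab.le hcd huc
  obtain ⟨V, hV, hVW⟩ := exists_continuous_extension hab.le hcd hWc
  have hv1 : Continuous fun y => v y d - v y c :=
    (hv.comp (continuous_id.prodMk continuous_const)).sub
      (hv.comp (continuous_id.prodMk continuous_const))
  have key : ∀ ε ∈ Ioc 0 ((b - a) / 2), (∫ y in a..b - ε, (v y d - v y c)) -
      (∫ y in a..a + ε, (v y d - v y c)) - ∫ τ in c..d, (V (b - ε) τ - V (a + ε) τ) = 0 := by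
    intro ε hε
    have hsub : Icc (a + ε) (b - ε) ⊆ Ioo a b := fun y hy =>
      ⟨by linarith [hy.1, hε.1], by linarith [hy.2, hε.1]⟩
    have hle : a + ε ≤ b - ε := by linarith [hε.2]
    rw [intervalIntegral.integral_interval_sub_left (hv1.intervalIntegrable _ _)
      (hv1.intervalIntegrable _ _)]
    have h := green_rectangle_interior hle hcd (u := u) (W := W) (r := r)
      (hr.mono (prod_mono hsub subset_rfl)) (fun y hy => hu y (hsub hy)) fun y hy => hW y (hsub hy)
    have h1 : ∫ y in a + ε..b - ε, (v y d - v y c) = ∫ y in a + ε..b - ε, (u y d - u y c) := by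
      refine intervalIntegral.integral_congr fun y hy => ?_
      rw [uIcc_of_le hle] at hy
      have hy' := Ioo_subset_Icc_self (hsub hy)
      simp only [hvu y hy' d ⟨hcd, le_rfl⟩, hvu y hy' c ⟨le_rfl, hcd⟩]
    have h2 : ∫ τ in c..d, (V (b - ε) τ - V (a + ε) τ) =
        ∫ τ in c..d, (W (b - ε) τ - W (a + ε) τ) := by
      refine intervalIntegral.integral_congr fun τ hτ => ?_
      rw [uIcc_of_le hcd] at hτ
      simp only [hVW _ (Ioo_subset_Icc_self (hsub ⟨hle, le_rfl⟩)) τ hτ,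
        hVW _ (Ioo_subset_Icc_self (hsub ⟨le_rfl, hle⟩)) τ hτ]
    rw [h1, h2, h, sub_self]
  have hprim := intervalIntegral.continuous_primitive
    (fun a b => hv1.intervalIntegrable (μ := volume) a b) a
  have hcont : Continuous fun ε : ℝ => (∫ y in a..b - ε, (v y d - v y c)) -
      (∫ y in a..a + ε, (v y d - v y c)) - ∫ τ in c..d, (V (b - ε) τ - V (a + ε) τ) := by
    refine ((hprim.comp (continuous_const.sub continuous_id)).sub
      (hprim.comp (continuous_const.add continuous_id))).sub ?_
    refine intervalIntegral.continuous_parametric_intervalIntegral_of_continuous'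
      (f := fun ε τ => V (b - ε) τ - V (a + ε) τ) ?_ c d
    exact (hV.comp (f := fun p : ℝ × ℝ => (b - p.1, p.2)) (by fun_prop)).sub
      (hV.comp (f := fun p : ℝ × ℝ => (a + p.1, p.2)) (by fun_prop))
  have hlim := (hcont.tendsto 0).mono_left (nhdsWithin_le_nhds (s := Ioi 0))
  have hzero : Tendsto (fun ε : ℝ => (∫ y in a..b - ε, (v y d - v y c)) -
      (∫ y in a..a + ε, (v y d - v y c)) - ∫ τ in c..d, (V (b - ε) τ - V (a + ε) τ)) (𝓝[>] 0)
      (𝓝 0) := by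
    refine tendsto_const_nhds.congr' ?_
    filter_upwards [Ioc_mem_nhdsGT (by linarith : (0:ℝ) < (b - a) / 2)] with ε hε
    exact (key ε hε).symm
  have h := tendsto_nhds_unique hlim hzero
  simp only [sub_zero, add_zero, intervalIntegral.integral_same] at h
  have h1 : ∫ y in a..b, (v y d - v y c) = ∫ y in a..b, (u y d - u y c) := by
    refine intervalIntegral.integral_congr fun y hy => ?_
    rw [uIcc_of_le hab.le] at hy
    simp only [hvu y hy d ⟨hcd, le_rfl⟩, hvu y hy c ⟨le_rfl, hcd⟩]
  have h2 : ∫ τ in c..d, (V b τ - V a τ) = ∫ τ in c..d, (W b τ - W a τ) := by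
    refine intervalIntegral.integral_congr fun τ hτ => ?_
    rw [uIcc_of_le hcd] at hτ
    simp only [hVW _ ⟨hab.le, le_rfl⟩ τ hτ, hVW _ ⟨le_rfl, hab.le⟩ τ hτ]
  rw [← h1, ← h2]
  exact sub_eq_zero.1 h

namespace IsSolution

theorem hasDerivAt_x (h : IsSolution K₀ D₀ L θ₀ θ) {y τ : ℝ} (hy : y ∈ Ioo 0 L) (hτ : 0 < τ) :
    HasDerivAt (fun y => θ y τ) (dx L θ y τ) y := by
  have hn : Icc 0 L ∈ 𝓝 y := Icc_mem_nhds hy.1 hy.2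
  have := ((h.differentiable_x τ hτ) y (Ioo_subset_Icc_self hy)).differentiableAt hn
  rw [dx, derivWithin_of_mem_nhds hn]
  exact this.hasDerivAt

theorem hasDerivAt_xx (h : IsSolution K₀ D₀ L θ₀ θ) {y τ : ℝ} (hy : y ∈ Ioo 0 L) (hτ : 0 < τ) :
    HasDerivAt (fun y => dx L θ y τ) (dxx L θ y τ) y :=
  (((h.differentiable_xx τ hτ) y hy).differentiableAt (Ioo_mem_nhds hy.1 hy.2)).hasDerivAt

theorem hasDerivAt_t (h : IsSolution K₀ D₀ L θ₀ θ) {y τ : ℝ} (hy : y ∈ Ioo 0 L) (hτ : 0 < τ) :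
    HasDerivAt (θ y) (dt θ y τ) τ :=
  (((h.differentiable_t y hy) τ hτ).differentiableAt (Ioi_mem_nhds hτ)).hasDerivAt

theorem continuousOn_slice (h : IsSolution K₀ D₀ L θ₀ θ) {τ : ℝ} (hτ : 0 < τ) :
    ContinuousOn (fun y => θ y τ) (Icc 0 L) :=
  h.continuous_theta.comp (f := fun y : ℝ => (y, τ)) (by fun_prop) fun _ hy => ⟨hy, hτ⟩

theorem integrableOn_slice (h : IsSolution K₀ D₀ L θ₀ θ) {τ : ℝ} (hτ : 0 ≤ τ) :
    IntegrableOn (fun y => θ y τ) (Ioo 0 L) := by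
  rcases hτ.eq_or_lt with rfl | hτ
  · exact h.integrable_initial.congr_fun (fun y hy => (h.initial y hy).symm) measurableSet_Ioo
  · exact ((h.continuousOn_slice hτ).integrableOn_Icc).mono_set Ioo_subset_Icc_self

theorem continuousOn_theta_bdry (h : IsSolution K₀ D₀ L θ₀ θ) {y : ℝ} (hy : y ∈ Icc 0 L) :
    ContinuousOn (θ y) (Ioi 0) :=
  h.continuous_theta.comp (f := fun τ : ℝ => (y, τ)) (by fun_prop) fun _ hτ => ⟨hy, hτ⟩

theorem continuousOn_dx_bdry (h : IsSolution K₀ D₀ L θ₀ θ) {y : ℝ} (hy : y ∈ Icc 0 L) :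
    ContinuousOn (dx L θ y) (Ioi 0) :=
  h.continuous_dx.comp (f := fun τ : ℝ => (y, τ)) (by fun_prop) fun _ hτ => ⟨hy, hτ⟩

/-- The exponential `e^{-iky + ωτ}` solves the adjoint equation. Multiplying by it puts the equation
in divergence form, `(eθ)_τ = (e D₀(θ_y - iνθ))_y`, because `iν D₀ = K₀ - ik D₀`; Green's formula
does the rest. -/
theorem global_relation (h : IsSolution K₀ D₀ L θ₀ θ) (hD : 0 < D₀) (hL : 0 < L) {s₁ s₂ : ℝ}
    (hs₁ : 0 < s₁) (hs : s₁ ≤ s₂) (k : ℂ) :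
    Complex.exp (omega K₀ D₀ k * s₂) * hat L (fun y => θ y s₂) k
        - Complex.exp (omega K₀ D₀ k * s₁) * hat L (fun y => θ y s₁) k =
      flux K₀ D₀ L
        (∫ τ in s₁..s₂, Complex.exp (omega K₀ D₀ k * τ) * θ 0 τ)
        (∫ τ in s₁..s₂, Complex.exp (omega K₀ D₀ k * τ) * dx L θ 0 τ)
        (∫ τ in s₁..s₂, Complex.exp (omega K₀ D₀ k * τ) * θ L τ)
        (∫ τ in s₁..s₂, Complex.exp (omega K₀ D₀ k * τ) * dx L θ L τ) k := by
  set w := omega K₀ D₀ k with hw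
  have hDc : (D₀ : ℂ) ≠ 0 := by exact_mod_cast hD.ne'
  have hsub : Icc s₁ s₂ ⊆ Ioi 0 := fun τ hτ => hs₁.trans_le hτ.1
  have hIcc : ∀ {S}, S ×ˢ Icc s₁ s₂ ⊆ S ×ˢ Ioi (0:ℝ) := fun {S : Set ℝ} => prod_mono subset_rfl hsub
  set u : ℝ → ℝ → ℂ := fun y τ => Complex.exp (-Complex.I * k * y + w * τ) * θ y τ with hu
  set W : ℝ → ℝ → ℂ := fun y τ => Complex.exp (-Complex.I * k * y + w * τ) *
    (D₀ * (dx L θ y τ - Complex.I * nu K₀ D₀ k * θ y τ)) with hW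
  set r : ℝ → ℝ → ℂ := fun y τ => Complex.exp (-Complex.I * k * y + w * τ) *
    (w * θ y τ + dt θ y τ) with hr
  have hE : Continuous fun p : ℝ × ℝ => Complex.exp (-Complex.I * k * p.1 + w * p.2) := by fun_prop
  have cθ : ContinuousOn (fun p : ℝ × ℝ => (θ p.1 p.2 : ℂ)) (Icc 0 L ×ˢ Icc s₁ s₂) :=
    Complex.continuous_ofReal.comp_continuousOn (h.continuous_theta.mono hIcc)
  have cdx : ContinuousOn (fun p : ℝ × ℝ => (dx L θ p.1 p.2 : ℂ)) (Icc 0 L ×ˢ Icc s₁ s₂) :=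
    Complex.continuous_ofReal.comp_continuousOn (h.continuous_dx.mono hIcc)
  have cdt : ContinuousOn (fun p : ℝ × ℝ => (dt θ p.1 p.2 : ℂ)) (Ioo 0 L ×ˢ Icc s₁ s₂) :=
    Complex.continuous_ofReal.comp_continuousOn (h.continuous_dt.mono hIcc)
  have hEt : ∀ y τ : ℝ, HasDerivAt (fun τ : ℝ => Complex.exp (-Complex.I * k * y + w * τ))
      (Complex.exp (-Complex.I * k * y + w * τ) * w) τ := fun y τ => by
    have h1 : HasDerivAt (fun τ : ℝ => -Complex.I * k * y + w * (τ : ℂ)) w τ := by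
      simpa using ((Complex.ofRealCLM.hasDerivAt (x := τ)).const_mul w).const_add (-Complex.I * k * y)
    exact h1.cexp
  have hEx : ∀ y τ : ℝ, HasDerivAt (fun y : ℝ => Complex.exp (-Complex.I * k * y + w * τ))
      (Complex.exp (-Complex.I * k * y + w * τ) * (-Complex.I * k)) y := fun y τ => by
    have h1 : HasDerivAt (fun y : ℝ => -Complex.I * k * (y : ℂ) + w * τ) (-Complex.I * k) y := by
      simpa using ((Complex.ofRealCLM.hasDerivAt (x := y)).const_mul (-Complex.I * k)).add_const (w * τ)
    exact h1.cexp
  have hgreen := green_rectangle hL hs (u := u) (W := W) (r := r) ?_ ?_ ?_ ?_ ?_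
  rotate_left
  · exact hE.continuousOn.mul ((continuousOn_const.mul
      (cθ.mono (prod_mono Ioo_subset_Icc_self subset_rfl))).add cdt)
  · intro y hy τ hτ
    refine ((hEt y τ).mul (h.hasDerivAt_t hy (hsub hτ)).ofReal_comp).congr_deriv ?_
    simp only [hr]; ring
  · intro y hy τ hτ
    have h1 := (h.hasDerivAt_x hy (hsub hτ)).ofReal_comp
    have h2 := (h.hasDerivAt_xx hy (hsub hτ)).ofReal_comp
    refine ((hEx y τ).mul ((h2.sub (h1.const_mul (Complex.I * nu K₀ D₀ k))).const_mul
      (D₀ : ℂ))).congr_deriv ?_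
    have hp : (dt θ y τ : ℂ) + K₀ * dx L θ y τ = D₀ * dxx L θ y τ := by
      exact_mod_cast h.pde y hy τ (hsub hτ)
    have e1 : (D₀ : ℂ) * (Complex.I * nu K₀ D₀ k) = -Complex.I * k * D₀ + K₀ := by
      unfold nu
      field_simp
      linear_combination (-(K₀ : ℂ)) * Complex.I_mul_I
    simp only [hr, Pi.sub_apply]
    have e2 : w = D₀ * k ^ 2 + Complex.I * K₀ * k := by rw [hw, omega]
    generalize Complex.exp (-Complex.I * k * y + w * τ) = e
    rw [e2]
    linear_combination (-e) * hp + e * (Complex.I * k * θ y τ - dx L θ y τ) * e1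
      - e * D₀ * k ^ 2 * (θ y τ) * Complex.I_mul_I
  · exact hE.continuousOn.mul cθ
  · exact hE.continuousOn.mul (continuousOn_const.mul (cdx.sub (continuousOn_const.mul cθ)))
  have hint : ∀ {φ : ℝ → ℝ}, ContinuousOn φ (Ioi 0) →
      IntervalIntegrable (fun τ => Complex.exp (w * τ) * (φ τ : ℂ)) volume s₁ s₂ := fun hφ => by
    refine ContinuousOn.intervalIntegrable ?_
    rw [uIcc_of_le hs]
    exact (Continuous.continuousOn (by fun_prop)).mul
      (Complex.continuous_ofReal.comp_continuousOn (hφ.mono hsub))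
  have hhat : ∀ {s : ℝ}, 0 < s → Complex.exp (w * s) * hat L (fun y => θ y s) k =
      ∫ y in (0:ℝ)..L, u y s ∧ IntervalIntegrable (fun y => u y s) volume 0 L := fun {s} hs0 => by
    constructor
    · rw [hat, intervalIntegral.integral_of_le hL.le, integral_Ioc_eq_integral_Ioo,
        ← integral_const_mul]
      refine integral_congr_ae (Eventually.of_forall fun y => ?_)
      simp only [hu, Complex.exp_add]
      ring
    · refine ContinuousOn.intervalIntegrable ?_
      rw [uIcc_of_le hL.le]
      exact (Continuous.continuousOn (by fun_prop)).mul
        (Complex.continuous_ofReal.comp_continuousOn (h.continuousOn_slice hs0))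
  have b1 := hhat hs₁
  have b2 := hhat (hs₁.trans_le hs)
  rw [b1.1, b2.1, ← intervalIntegral.integral_sub b2.2 b1.2, hgreen]
  have i1 := hint (h.continuousOn_theta_bdry (left_mem_Icc.2 hL.le))
  have i2 := hint (h.continuousOn_dx_bdry (left_mem_Icc.2 hL.le))
  have i3 := hint (h.continuousOn_theta_bdry (right_mem_Icc.2 hL.le))
  have i4 := hint (h.continuousOn_dx_bdry (right_mem_Icc.2 hL.le))
  rw [flux, ← intervalIntegral.integral_const_mul (Complex.I * nu K₀ D₀ k),
    ← intervalIntegral.integral_const_mul (Complex.I * nu K₀ D₀ k),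
    ← intervalIntegral.integral_sub i4 (i3.const_mul _),
    ← intervalIntegral.integral_sub i2 (i1.const_mul _),
    ← intervalIntegral.integral_const_mul (Complex.exp (-Complex.I * k * L)),
    ← intervalIntegral.integral_sub ((i4.sub (i3.const_mul _)).const_mul _) (i2.sub (i1.const_mul _)),
    ← intervalIntegral.integral_const_mul]
  refine intervalIntegral.integral_congr fun τ _ => ?_
  simp only [hW, Complex.exp_add, Complex.ofReal_zero, mul_zero, Complex.exp_zero]
  ring

end IsSolution

end

section

variable {K₀ D₀ L : ℝ} {q : BdryCoeff} {γ : ℝ → ℂ} {x t : ℝ} {θ₀ : ℝ → ℝ} {θ : ℝ → ℝ → ℝ}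

/-! ### The representation restarted at a positive time -/

/-- `∫_a^b e^{kτ} f(τ) dτ`. -/
def laplaceOn (a b : ℝ) (f : ℝ → ℝ) (k : ℂ) : ℂ :=
  ∫ τ in Ioo a b, Complex.exp (k * (τ : ℂ)) * (f τ : ℂ)

theorem laplaceOn_eq_interval {a b : ℝ} (hab : a ≤ b) (f : ℝ → ℝ) (k : ℂ) :
    laplaceOn a b f k = ∫ τ in a..b, Complex.exp (k * τ) * f τ := by
  rw [laplaceOn, intervalIntegral.integral_of_le hab, integral_Ioc_eq_integral_Ioo]

theorem laplaceOn_sub {a b c : ℝ} (hab : a ≤ b) (hbc : b ≤ c) {f : ℝ → ℝ}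
    (hf : IntegrableOn f (Ioo a c)) (k : ℂ) :
    laplaceOn a c f k - laplaceOn b c f k = laplaceOn a b f k := by
  have h := integrable_laplace hf k
  rw [← integrableOn_Ioc_iff_integrableOn_Ioo,
    ← intervalIntegrable_iff_integrableOn_Ioc_of_le (hab.trans hbc)] at h
  rw [laplaceOn_eq_interval (hab.trans hbc), laplaceOn_eq_interval hbc, laplaceOn_eq_interval hab,
    sub_eq_iff_eq_add]
  refine (intervalIntegral.integral_add_adjacent_intervals (h.mono_set ?_) (h.mono_set ?_)).symm
  · rw [uIcc_of_le hab, uIcc_of_le (hab.trans hbc)]; exact Icc_subset_Icc_right hbc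
  · rw [uIcc_of_le hbc, uIcc_of_le (hab.trans hbc)]; exact Icc_subset_Icc_left hab

theorem tilde_indicator {s : ℝ} (hs : 0 ≤ s) (f : ℝ → ℝ) (k : ℂ) :
    tilde ((Ioi s).indicator f) k t = laplaceOn s t f k := by
  have h : (fun τ : ℝ => Complex.exp (k * (τ : ℂ)) * (((Ioi s).indicator f τ : ℝ) : ℂ)) =
      (Ioi s).indicator fun τ : ℝ => Complex.exp (k * (τ : ℂ)) * (f τ : ℂ) := by
    funext τ
    by_cases hτ : τ ∈ Ioi s
    · simp [hτ]
    · simp [hτ]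
  rw [tilde, h, setIntegral_indicator measurableSet_Ioi, laplaceOn]
  congr 2
  ext τ
  simp only [mem_inter_iff, mem_Ioo, mem_Ioi]
  constructor
  · exact fun h => ⟨h.2, h.1.2⟩
  · exact fun h => ⟨⟨hs.trans_lt h.1, h.2⟩, h.1⟩

theorem re_omega_ofReal (r : ℝ) : (omega K₀ D₀ (r : ℂ)).re = D₀ * r ^ 2 := by
  rw [re_omega]; simp

theorem norm_hat_ofReal_le {φ : ℝ → ℝ} (hφ : IntegrableOn φ (Ioo 0 L)) (r : ℝ) :
    ‖hat L φ r‖ ≤ ∫ y in Ioo 0 L, |φ y| := by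
  simpa using norm_hat_le hφ (k := (r : ℂ)) (by simp)

theorem norm_lineIntegrand_le {φ : ℝ → ℝ} (hφ : IntegrableOn φ (Ioo 0 L)) (σ r : ℝ) :
    ‖lineIntegrand K₀ D₀ L φ x σ r‖ ≤ Real.exp (-(D₀ * σ) * r ^ 2) * ∫ y in Ioo 0 L, |φ y| := by
  rw [lineIntegrand, norm_mul]
  refine mul_le_mul (le_of_eq ?_) (norm_hat_ofReal_le hφ r) (norm_nonneg _) (Real.exp_pos _).le
  rw [Complex.norm_exp, Complex.sub_re, Complex.re_mul_ofReal _ σ, re_omega_ofReal]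
  congr 1
  simp
  ring

theorem continuous_lineIntegrand {φ : ℝ → ℝ} (hφ : IntegrableOn φ (Ioo 0 L)) (σ : ℝ) :
    Continuous (lineIntegrand K₀ D₀ L φ x σ) := by
  have h1 := (differentiable_omega K₀ D₀).continuous
  have h2 := (differentiable_hat hφ).continuous
  unfold lineIntegrand
  fun_prop

theorem integrable_lineIntegrand (hD : 0 < D₀) {φ : ℝ → ℝ} (hφ : IntegrableOn φ (Ioo 0 L)) {σ : ℝ}
    (hσ : 0 < σ) : Integrable (lineIntegrand K₀ D₀ L φ x σ) :=
  ((integrable_exp_neg_mul_sq (mul_pos hD hσ)).mul_const _).mono'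
    (continuous_lineIntegrand hφ σ).aestronglyMeasurable
    (Eventually.of_forall fun r => norm_lineIntegrand_le hφ σ r)

/-- Only data at times in `(s₁,s₂)` enter, so the elapsed time lies between `t - s₂` and `t - s₁`.
For `s₂ < t` it is bounded away from zero, which provides the decay needed to move contours. The
multiplier `m` stands for `k` or `ν`. -/
theorem heatBound_bdry {s₁ s₂ : ℝ} {φ₀ φ₁ : ℝ → ℝ} (h₀ : IntegrableOn φ₀ (Ioo s₁ s₂))
    (h₁ : IntegrableOn φ₁ (Ioo s₁ s₂)) {m e : ℂ → ℂ} (hm : ∀ k, ‖m k‖ ≤ ‖k‖ + 2 * |K₀ / (2 * D₀)|)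
    {C δ : ℝ} (hC : 0 ≤ C) (he : ∀ k, ‖e k‖ ≤ C * Real.exp (-(δ * k.im))) :
    HeatBound K₀ D₀ δ (t - s₂) (t - s₁)
      (C * ((1 + 2 * |K₀ / (2 * D₀)|) * ((∫ τ in Ioo s₁ s₂, |φ₀ τ|) + ∫ τ in Ioo s₁ s₂, |φ₁ τ|)))
      fun k => e k * (Complex.exp (-omega K₀ D₀ k * t) *
        (laplaceOn s₁ s₂ φ₁ (omega K₀ D₀ k) - Complex.I * m k * laplaceOn s₁ s₂ φ₀ (omega K₀ D₀ k))) := by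
  intro k
  set E := Real.exp (-((t - s₂) * (omega K₀ D₀ k).re)) + Real.exp (-((t - s₁) * (omega K₀ D₀ k).re))
  have hE : 0 ≤ E := by positivity
  set N₀ := ∫ τ in Ioo s₁ s₂, |φ₀ τ|
  set N₁ := ∫ τ in Ioo s₁ s₂, |φ₁ τ|
  have hN₀ : 0 ≤ N₀ := integral_nonneg fun _ => abs_nonneg _
  have hN₁ : 0 ≤ N₁ := integral_nonneg fun _ => abs_nonneg _
  have b0 : ‖Complex.exp (-omega K₀ D₀ k * t) * laplaceOn s₁ s₂ φ₀ (omega K₀ D₀ k)‖ ≤ E * N₀ :=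
    norm_exp_mul_laplace_le h₀ le_rfl le_rfl _
  have b1 : ‖Complex.exp (-omega K₀ D₀ k * t) * laplaceOn s₁ s₂ φ₁ (omega K₀ D₀ k)‖ ≤ E * N₁ :=
    norm_exp_mul_laplace_le h₁ le_rfl le_rfl _
  have hκ : 0 ≤ |K₀ / (2 * D₀)| := abs_nonneg _
  have hk := norm_nonneg k
  have b2 : ‖Complex.exp (-omega K₀ D₀ k * t) * (laplaceOn s₁ s₂ φ₁ (omega K₀ D₀ k)
      - Complex.I * m k * laplaceOn s₁ s₂ φ₀ (omega K₀ D₀ k))‖ ≤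
      (1 + 2 * |K₀ / (2 * D₀)|) * (N₀ + N₁) * (1 + ‖k‖) * E := by
    rw [show Complex.exp (-omega K₀ D₀ k * t) * (laplaceOn s₁ s₂ φ₁ (omega K₀ D₀ k)
      - Complex.I * m k * laplaceOn s₁ s₂ φ₀ (omega K₀ D₀ k)) =
      Complex.exp (-omega K₀ D₀ k * t) * laplaceOn s₁ s₂ φ₁ (omega K₀ D₀ k) -
      Complex.I * m k * (Complex.exp (-omega K₀ D₀ k * t) * laplaceOn s₁ s₂ φ₀ (omega K₀ D₀ k)) by ring]
    refine (norm_sub_le _ _).trans ?_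
    rw [norm_mul (Complex.I * m k), norm_mul Complex.I, Complex.norm_I, one_mul]
    have b3 := mul_le_mul (hm k) b0 (norm_nonneg _) (by positivity)
    have b4 : E * N₁ ≤ (1 + 2 * |K₀ / (2 * D₀)|) * (1 + ‖k‖) * (E * N₁) :=
      le_mul_of_one_le_left (by positivity)
        (by nlinarith [mul_nonneg hκ hk])
    have b5 : (‖k‖ + 2 * |K₀ / (2 * D₀)|) * (E * N₀) ≤
        (1 + 2 * |K₀ / (2 * D₀)|) * (1 + ‖k‖) * (E * N₀) :=
      mul_le_mul_of_nonneg_right (by nlinarith [mul_nonneg hκ hk]) (by positivity)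
    linarith
  rw [norm_mul]
  refine (mul_le_mul (he k) b2 (norm_nonneg _) (by positivity)).trans (le_of_eq ?_)
  ring

theorem differentiable_bdry {s₁ s₂ : ℝ} {φ₀ φ₁ : ℝ → ℝ} (h₀ : IntegrableOn φ₀ (Ioo s₁ s₂))
    (h₁ : IntegrableOn φ₁ (Ioo s₁ s₂)) {m e : ℂ → ℂ} (hm : Differentiable ℂ m)
    (he : Differentiable ℂ e) :
    Differentiable ℂ fun k => e k * (Complex.exp (-omega K₀ D₀ k * t) *
        (laplaceOn s₁ s₂ φ₁ (omega K₀ D₀ k) - Complex.I * m k * laplaceOn s₁ s₂ φ₀ (omega K₀ D₀ k))) := by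
  have hw := differentiable_omega K₀ D₀
  have d0 : Differentiable ℂ fun k => laplaceOn s₁ s₂ φ₀ (omega K₀ D₀ k) :=
    (differentiable_laplace h₀).comp hw
  have d1 : Differentiable ℂ fun k => laplaceOn s₁ s₂ φ₁ (omega K₀ D₀ k) :=
    (differentiable_laplace h₁).comp hw
  fun_prop

/-- The representation of `θ(x,t)` restarted at time `s`. -/
def restarted (K₀ D₀ L : ℝ) (q : BdryCoeff) (γ : ℝ → ℂ) (θ : ℝ → ℝ → ℝ) (f g : ℝ → ℝ) (x t s : ℝ) : ℂ :=
  representation K₀ D₀ L (fun y => θ y s) (-(Complex.I / Real.pi)) γ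
    (heatIntegrand K₀ D₀ L q (fun y => θ y s) ((Ioi s).indicator f) ((Ioi s).indicator g) x (t - s) t)
    x (t - s)

theorem exp_I_shift (k : ℂ) (y : ℝ) : Complex.exp (Complex.I * shift K₀ D₀ k * y) =
    Complex.exp (Complex.I * k * y) * Complex.exp (-(K₀ / (2 * D₀)) * y) := by
  rw [← Complex.exp_add]
  congr 1
  unfold shift
  linear_combination (K₀ / (2 * D₀) * y : ℂ) * Complex.I_mul_I

/-- The jump of the integrand between two starting times, after elimination of the unknown boundary
values. -/
theorem heatIntegrand_sub (hθ : IsSolution K₀ D₀ L θ₀ θ) (hD : 0 < D₀) (hx : x ∈ Ioo 0 L)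
    {f g : ℝ → ℝ} (hf : IntegrableOn f (Ioo 0 t)) (hg : IntegrableOn g (Ioo 0 t))
    (hbf : ∀ τ, 0 < τ → q.a * θ 0 τ - q.α * dx L θ 0 τ = f τ)
    (hbg : ∀ τ, 0 < τ → q.b * θ L τ - q.β * dx L θ L τ = g τ) {s₁ s₂ : ℝ} (hs₁ : 0 < s₁)
    (hs : s₁ ≤ s₂) (hs₂ : s₂ < t) {k : ℂ} (hk : robinDelta K₀ D₀ L q k ≠ 0) :
    Complex.exp (-(K₀ / (2 * D₀)) * (L - x)) *
      (heatIntegrand K₀ D₀ L q (fun y => θ y s₂) ((Ioi s₂).indicator f) ((Ioi s₂).indicator g) x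
          (t - s₂) t k
        - heatIntegrand K₀ D₀ L q (fun y => θ y s₁) ((Ioi s₁).indicator f) ((Ioi s₁).indicator g) x
          (t - s₁) t k) =
      D₀ / (2 * Complex.I) *
      (Complex.exp (Complex.I * nu K₀ D₀ k * (x - L)) * (Complex.exp (-omega K₀ D₀ k * t) *
        (laplaceOn s₁ s₂ (dx L θ L) (omega K₀ D₀ k)
          - Complex.I * k * laplaceOn s₁ s₂ (θ L) (omega K₀ D₀ k)))
      - Complex.exp (Complex.I * k * x) * (Complex.exp (-omega K₀ D₀ k * t) *
        (laplaceOn s₁ s₂ (dx L θ 0) (omega K₀ D₀ k)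
          - Complex.I * nu K₀ D₀ k * laplaceOn s₁ s₂ (θ 0) (omega K₀ D₀ k)))) := by
  have hL := hx.1.trans hx.2
  set w := omega K₀ D₀ k with hw
  -- Since `ω(ν) = ω(k)`, both relations contain the same four transforms.
  have r1 := hθ.global_relation hD hL hs₁ hs k
  have r2 := hθ.global_relation hD hL hs₁ hs (nu K₀ D₀ k)
  simp only [omega_nu hD.ne', ← hw, ← laplaceOn_eq_interval hs] at r1 r2
  set g₀ := laplaceOn s₁ s₂ (θ 0) w
  set g₁ := laplaceOn s₁ s₂ (dx L θ 0) w
  set h₀ := laplaceOn s₁ s₂ (θ L) w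
  set h₁ := laplaceOn s₁ s₂ (dx L θ L) w
  have hsub : Ioo s₁ s₂ ⊆ Icc s₁ s₂ := Ioo_subset_Icc_self
  have hsub' : Icc s₁ s₂ ⊆ Ioi 0 := fun τ hτ => hs₁.trans_le hτ.1
  -- The transform of the data may be split into those of `θ` and `θ_x` only on `(s₁,s₂)`, away from
  -- time zero, where both are integrable.
  have hcomb : ∀ (a c : ℝ) (y : ℝ), y ∈ Icc 0 L → ∀ f : ℝ → ℝ,
      (∀ τ, 0 < τ → a * θ y τ - c * dx L θ y τ = f τ) →
      laplaceOn s₁ s₂ f w = a * laplaceOn s₁ s₂ (θ y) w - c * laplaceOn s₁ s₂ (dx L θ y) w := by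
    intro a c y hy f hf
    have i0 : IntegrableOn (θ y) (Ioo s₁ s₂) :=
      ((hθ.continuousOn_theta_bdry hy).mono hsub').integrableOn_Icc.mono_set hsub
    have i1 : IntegrableOn (dx L θ y) (Ioo s₁ s₂) :=
      ((hθ.continuousOn_dx_bdry hy).mono hsub').integrableOn_Icc.mono_set hsub
    unfold laplaceOn
    rw [← integral_const_mul, ← integral_const_mul, ← integral_sub
      ((integrable_laplace i0 w).const_mul _) ((integrable_laplace i1 w).const_mul _)]
    refine setIntegral_congr_fun measurableSet_Ioo fun τ hτ => ?_
    simp only [← hf τ (hs₁.trans hτ.1)]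
    push_cast
    ring
  have cf := hcomb q.a q.α 0 (left_mem_Icc.2 hL.le) f hbf
  have cg := hcomb q.b q.β L (right_mem_Icc.2 hL.le) g hbg
  have hsplit : ∀ {φ : ℝ → ℝ}, IntegrableOn φ (Ioo 0 t) →
      laplaceOn s₁ t φ w - laplaceOn s₂ t φ w = laplaceOn s₁ s₂ φ w := fun hφ =>
    laplaceOn_sub hs hs₂.le (hφ.mono_set (Ioo_subset_Ioo_left hs₁.le)) w
  have sf := hsplit hf
  have sg := hsplit hg
  have hel := elimination (K₀ := K₀) (L := L) hD.ne' q x k g₀ g₁ h₀ h₁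
  rw [← r1, ← r2, ← cf, ← cg, ← sf, ← sg] at hel
  have hexp : ∀ s : ℝ, Complex.exp (-w * ((t - s : ℝ) : ℂ)) =
      Complex.exp (-w * t) * Complex.exp (w * s) := fun s => by
    rw [← Complex.exp_add]; congr 1; push_cast; ring
  unfold heatIntegrand
  simp only [tilde_indicator hs₁.le, tilde_indicator (hs₁.le.trans hs), ← hw, hexp]
  have e1 := exp_I_shift (K₀ := K₀) (D₀ := D₀) k L
  have e2 := exp_I_shift (K₀ := K₀) (D₀ := D₀) k x
  have e3 : Complex.exp (Complex.I * nu K₀ D₀ k * (x - L)) =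
      Complex.exp (Complex.I * k * L) / Complex.exp (Complex.I * k * x) *
        (Complex.exp (-(K₀ / (2 * D₀)) * (L - x)) * Complex.exp (-(K₀ / (2 * D₀)) * (L - x))) := by
    rw [← Complex.exp_sub, ← Complex.exp_add, ← Complex.exp_add]
    congr 1
    unfold nu
    linear_combination (-(K₀ / D₀ * (x - L) : ℂ)) * Complex.I_mul_I
  have e4 : Complex.exp (-(K₀ / (2 * D₀)) * (L - x) : ℂ) =
      Complex.exp (-(K₀ / (2 * D₀)) * L) / Complex.exp (-(K₀ / (2 * D₀)) * x) := by
    rw [← Complex.exp_sub]; congr 1; ring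
  rw [e1, e2] at hel
  rw [e3, e4]
  have n1 := Complex.exp_ne_zero (Complex.I * k * x)
  have n2 := Complex.exp_ne_zero (-(K₀ / (2 * D₀)) * x)
  have n3 := Complex.exp_ne_zero (-(K₀ / (2 * D₀)) * L)
  generalize Complex.exp (Complex.I * k * x) = X at *
  generalize Complex.exp (-(K₀ / (2 * D₀)) * x) = Y at *
  generalize Complex.exp (-(K₀ / (2 * D₀)) * L) = Z at *
  generalize Complex.exp (Complex.I * k * L) = V at *
  generalize Complex.exp (-w * t) = T at *
  have hI := Complex.I_ne_zero
  -- The eliminated relation is multiplied by `e^{-ωt}/Δ` and by the outer factor `e^{-κ(L-x)}`,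
  -- which is `Z / Y`; this is where `Δ` cancels.
  have hel' := congrArg (fun z => T / robinDelta K₀ D₀ L q k * (Z / Y) * z) hel
  rw [show T / robinDelta K₀ D₀ L q k * (Z / Y) * (robinDelta K₀ D₀ L q k * (D₀ / (2 * Complex.I) *
    (V * Z / (X * Y) * (h₁ - Complex.I * k * h₀) - X * Y / Z * (g₁ - Complex.I * nu K₀ D₀ k * g₀)))) =
    D₀ / (2 * Complex.I) * (V / X * (Z / Y * (Z / Y)) * (T * (h₁ - Complex.I * k * h₀)) -
      X * (T * (g₁ - Complex.I * nu K₀ D₀ k * g₀))) by field_simp] at hel'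
  rw [← hel']
  ring

/-- By `heatIntegrand_sub` the jump of the contour integrand consists of two entire terms. `Ψ₁`,
from `x = 0`, decays like `e^{-x Im k}`, and `Ψ₂`, from `x = L`, like `e^{-(L-x) Im k}`. Moved to
suitable horizontal lines, they cancel the jump of the integral over the real line. -/
theorem restarted_eq (hθ : IsSolution K₀ D₀ L θ₀ θ) (hD : 0 < D₀) (hx : x ∈ Ioo 0 L)
    (hq : q.Nontrivial) (hγ : IsFavourable K₀ D₀ (robinDelta K₀ D₀ L q) γ)
    {f g : ℝ → ℝ} (hf : IntegrableOn f (Ioo 0 t)) (hg : IntegrableOn g (Ioo 0 t))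
    (hbf : ∀ τ, 0 < τ → q.a * θ 0 τ - q.α * dx L θ 0 τ = f τ)
    (hbg : ∀ τ, 0 < τ → q.b * θ L τ - q.β * dx L θ L τ = g τ) {s₁ s₂ : ℝ} (hs₁ : 0 < s₁)
    (hs : s₁ ≤ s₂) (hs₂ : s₂ < t) :
    restarted K₀ D₀ L q γ θ f g x t s₂ = restarted K₀ D₀ L q γ θ f g x t s₁ := by
  have hL := hx.1.trans hx.2
  have ht : 0 < t := hs₁.trans_le (hs.trans hs₂.le)
  have hsub : Ioo s₁ s₂ ⊆ Icc s₁ s₂ := Ioo_subset_Icc_self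
  have hsub' : Icc s₁ s₂ ⊆ Ioi 0 := fun τ hτ => hs₁.trans_le hτ.1
  have i0 : ∀ {y}, y ∈ Icc 0 L → IntegrableOn (θ y) (Ioo s₁ s₂) := fun hy =>
    ((hθ.continuousOn_theta_bdry hy).mono hsub').integrableOn_Icc.mono_set hsub
  have i1 : ∀ {y}, y ∈ Icc 0 L → IntegrableOn (dx L θ y) (Ioo s₁ s₂) := fun hy =>
    ((hθ.continuousOn_dx_bdry hy).mono hsub').integrableOn_Icc.mono_set hsub
  have m0 := left_mem_Icc.2 hL.le
  have mL := right_mem_Icc.2 hL.le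
  set Ψ₁ : ℂ → ℂ := fun k => Complex.exp (Complex.I * k * x) * (Complex.exp (-omega K₀ D₀ k * t) *
    (laplaceOn s₁ s₂ (dx L θ 0) (omega K₀ D₀ k)
      - Complex.I * nu K₀ D₀ k * laplaceOn s₁ s₂ (θ 0) (omega K₀ D₀ k))) with hΨ₁
  set Ψ₂ : ℂ → ℂ := fun k => Complex.exp (Complex.I * nu K₀ D₀ k * (x - L)) *
    (Complex.exp (-omega K₀ D₀ k * t) * (laplaceOn s₁ s₂ (dx L θ L) (omega K₀ D₀ k)
      - Complex.I * k * laplaceOn s₁ s₂ (θ L) (omega K₀ D₀ k))) with hΨ₂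
  have hκ := abs_nonneg (K₀ / (2 * D₀))
  have B₁ := heatBound_bdry (K₀ := K₀) (D₀ := D₀) (t := t) (i0 m0) (i1 m0) (m := nu K₀ D₀)
    (e := fun k => Complex.exp (Complex.I * k * x)) (C := 1) (δ := x) norm_nu_le zero_le_one
    fun k => by
      rw [Complex.norm_exp, one_mul]
      refine Real.exp_le_exp.2 (le_of_eq ?_)
      simp; ring
  have B₂ := heatBound_bdry (K₀ := K₀) (D₀ := D₀) (t := t) (i0 mL) (i1 mL) (m := fun k => k)
    (e := fun k => Complex.exp (Complex.I * nu K₀ D₀ k * (x - L)))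
    (C := Real.exp (K₀ / D₀ * (x - L))) (δ := L - x)
    (fun k => by linarith) (Real.exp_pos _).le fun k => by
      rw [Complex.norm_exp, ← Real.exp_add]
      refine Real.exp_le_exp.2 (le_of_eq ?_)
      rw [← Complex.ofReal_sub, Complex.re_mul_ofReal, Complex.I_mul_re, im_nu]
      ring
  have d₁ : Differentiable ℂ Ψ₁ := differentiable_bdry (i0 m0) (i1 m0) (differentiable_nu K₀ D₀)
    (by fun_prop)
  have d₂ : Differentiable ℂ Ψ₂ := differentiable_bdry (i0 mL) (i1 mL) differentiable_fun_id
    (by have := differentiable_nu K₀ D₀; fun_prop)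
  have hN : ∀ y, 0 ≤ (∫ τ in Ioo s₁ s₂, |θ y τ|) + ∫ τ in Ioo s₁ s₂, |dx L θ y τ| := fun y =>
    add_nonneg (integral_nonneg fun _ => abs_nonneg _) (integral_nonneg fun _ => abs_nonneg _)
  obtain ⟨c₁, e₁⟩ := B₁.contourIntegral_eq (mul_nonneg zero_le_one (mul_nonneg (by positivity) (hN 0)))
    d₁ hγ.1 hD hx.1 (by linarith) (by linarith) 0
  obtain ⟨c₂, e₂⟩ := B₂.contourIntegral_eq
    (mul_nonneg (Real.exp_pos _).le (mul_nonneg (by positivity) (hN L)))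
    d₂ hγ.1 hD (by linarith [hx.2]) (by linarith) (by linarith) (-(K₀ / D₀))
  have l₁ := B₁.integrable_line (mul_nonneg zero_le_one (mul_nonneg (by positivity) (hN 0)))
    d₁.continuous hD (by linarith) (by linarith) 0
  have l₂ := B₂.integrable_line
    (mul_nonneg (Real.exp_pos _).le (mul_nonneg (by positivity) (hN L)))
    d₂.continuous hD (by linarith) (by linarith) (-(K₀ / D₀))
  change Integrable fun r : ℝ => Ψ₁ _ at l₁
  change Integrable fun r : ℝ => Ψ₂ _ at l₂
  change contourIntegral γ Ψ₁ = ∫ r : ℝ, Ψ₁ _ at e₁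
  change contourIntegral γ Ψ₂ = ∫ r : ℝ, Ψ₂ _ at e₂
  simp only [Complex.ofReal_zero, zero_mul, add_zero] at l₁ e₁
  -- The line `Im k = -K₀/D₀`, run backwards, is the image of the real line under `ν`. On it `Ψ₂`
  -- becomes the flux at `L` in the global relation for real `k`.
  have hν : ∀ r : ℝ, (((-r : ℝ) : ℂ) + ((-(K₀ / D₀) : ℝ) : ℂ) * Complex.I) = nu K₀ D₀ r := fun r => by
    unfold nu; push_cast; ring
  have l₂' : Integrable fun r : ℝ => Ψ₂ (nu K₀ D₀ r) := by
    simpa only [hν] using l₂.comp_neg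
  have e₂' : contourIntegral γ Ψ₂ = ∫ r : ℝ, Ψ₂ (nu K₀ D₀ r) := by
    rw [e₂, ← integral_neg_eq_self (fun r : ℝ => Ψ₂ (r + ((-(K₀ / D₀) : ℝ) : ℂ) * Complex.I))]
    simp only [hν]
  have hline : (∫ r : ℝ, lineIntegrand K₀ D₀ L (fun y => θ y s₂) x (t - s₂) r)
      - ∫ r : ℝ, lineIntegrand K₀ D₀ L (fun y => θ y s₁) x (t - s₁) r =
      D₀ * ((∫ r : ℝ, Ψ₂ (nu K₀ D₀ r)) - ∫ r : ℝ, Ψ₁ r) := by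
    rw [← integral_sub (integrable_lineIntegrand hD (hθ.integrableOn_slice (hs₁.le.trans hs))
      (by linarith)) (integrable_lineIntegrand hD (hθ.integrableOn_slice hs₁.le) (by linarith)),
      ← integral_sub l₂' l₁, ← integral_const_mul]
    refine integral_congr_ae (Eventually.of_forall fun r => ?_)
    have r1 := hθ.global_relation hD hL hs₁ hs r
    simp only [← laplaceOn_eq_interval hs, flux] at r1
    simp only [lineIntegrand, hΨ₁, hΨ₂, nu_nu, omega_nu hD.ne']
    have hexp : ∀ s : ℝ, Complex.exp (Complex.I * r * x - omega K₀ D₀ r * ((t - s : ℝ) : ℂ)) =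
        Complex.exp (Complex.I * r * x) * Complex.exp (-omega K₀ D₀ r * t) *
          Complex.exp (omega K₀ D₀ r * s) := fun s => by
      rw [← Complex.exp_add, ← Complex.exp_add]; congr 1; push_cast; ring
    have hexp2 : Complex.exp (Complex.I * r * (x - L)) =
        Complex.exp (Complex.I * r * x) * Complex.exp (-Complex.I * r * L) := by
      rw [← Complex.exp_add]; congr 1; ring
    rw [hexp, hexp, hexp2]
    linear_combination (Complex.exp (Complex.I * r * x) * Complex.exp (-omega K₀ D₀ r * t)) * r1
  have hcont : Complex.exp (-(K₀ / (2 * D₀)) * (L - x)) * contourIntegral γ (heatIntegrand K₀ D₀ L q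
        (fun y => θ y s₂) ((Ioi s₂).indicator f) ((Ioi s₂).indicator g) x (t - s₂) t)
      - Complex.exp (-(K₀ / (2 * D₀)) * (L - x)) * contourIntegral γ (heatIntegrand K₀ D₀ L q
        (fun y => θ y s₁) ((Ioi s₁).indicator f) ((Ioi s₁).indicator g) x (t - s₁) t) =
      D₀ / (2 * Complex.I) * (contourIntegral γ Ψ₂ - contourIntegral γ Ψ₁) := by
    have hi : ∀ {s}, 0 ≤ s → s ≤ t → Integrable (pullback γ (heatIntegrand K₀ D₀ L q
        (fun y => θ y s) ((Ioi s).indicator f) ((Ioi s).indicator g) x (t - s) t)) := fun h0 h1 =>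
      integrable_heatIntegrand hD hx ht hq hγ ⟨by linarith, by linarith⟩ (hθ.integrableOn_slice h0)
        (hf.indicator measurableSet_Ioi) (hg.indicator measurableSet_Ioi)
    unfold contourIntegral
    rw [← mul_sub, ← integral_sub (hi (hs₁.le.trans hs) hs₂.le) (hi hs₁.le (hs.trans hs₂.le)),
      ← integral_sub c₂ c₁, ← integral_const_mul, ← integral_const_mul]
    refine integral_congr_ae (Eventually.of_forall fun r => ?_)
    have := heatIntegrand_sub hθ hD hx hf hg hbf hbg hs₁ hs hs₂ (hγ.ne_zero r)
    simp only [pullback]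
    linear_combination (deriv γ r) * this
  unfold restarted representation
  rw [← sub_eq_zero]
  have hpi : (Real.pi : ℂ) ≠ 0 := by exact_mod_cast Real.pi_ne_zero
  rw [e₁, e₂'] at hcont
  -- Then `-(i/π) · D₀/(2i) = -D₀/(2π)`, the opposite of the constant in front of the jump on the
  -- real line.
  have hI : (D₀ : ℂ) / (2 * Complex.I) = -(Complex.I * D₀ / 2) := by
    field_simp; linear_combination (D₀ : ℂ) * Complex.I_sq
  rw [hI] at hcont
  linear_combination (1 / (2 * Real.pi) : ℂ) * hline + (-(Complex.I / Real.pi)) * hcont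
    + (D₀ / (2 * Real.pi) * ((∫ r : ℝ, Ψ₂ (nu K₀ D₀ r)) - ∫ r : ℝ, Ψ₁ r) : ℂ) * Complex.I_mul_I

end

section

variable {K₀ D₀ L : ℝ} {q : BdryCoeff} {γ : ℝ → ℂ} {x t : ℝ} {θ₀ : ℝ → ℝ} {θ : ℝ → ℝ → ℝ}

/-! ### The integral over the real line -/

theorem tendsto_integral_lineIntegrand {ι : Type*} {l : Filter ι} [l.IsCountablyGenerated]
    (hD : 0 < D₀) {σ : ι → ℝ} {σ₀ : ℝ} (hσ₀ : 0 < σ₀) (hσ : Tendsto σ l (𝓝 σ₀)) {φ : ι → ℝ → ℝ}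
    {φ₀ : ℝ → ℝ} (hφ : MeanTendsto l 0 L φ φ₀) :
    Tendsto (fun i => ∫ r, lineIntegrand K₀ D₀ L (φ i) x (σ i) r) l
      (𝓝 (∫ r, lineIntegrand K₀ D₀ L φ₀ x σ₀ r)) := by
  refine tendsto_integral_filter_of_dominated_convergence
    (fun r => Real.exp (-(D₀ * (σ₀ / 2)) * r ^ 2) * ((∫ y in Ioo 0 L, |φ₀ y|) + 1)) ?_ ?_
    ((integrable_exp_neg_mul_sq (by positivity)).mul_const _) ?_
  · filter_upwards [hφ.integrable] with i hi
    exact (continuous_lineIntegrand hi _).aestronglyMeasurable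
  · filter_upwards [hφ.integrable, hφ.eventually_le, hσ.eventually (lt_mem_nhds (half_lt_self hσ₀))]
      with i h1 h2 h3
    refine Eventually.of_forall fun r => (norm_lineIntegrand_le h1 _ r).trans ?_
    refine mul_le_mul (Real.exp_le_exp.2 ?_) h2 (integral_nonneg fun _ => abs_nonneg _)
      (Real.exp_pos _).le
    have := mul_le_mul_of_nonneg_left h3.le (mul_nonneg hD.le (sq_nonneg r))
    linarith
  · refine Eventually.of_forall fun r => ?_
    have h1 : Tendsto (fun i => hat L (φ i) r) l (𝓝 (hat L φ₀ r)) := hφ.laplace _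
    have h2 : Tendsto (fun i => ((σ i : ℝ) : ℂ)) l (𝓝 σ₀) :=
      (Complex.continuous_ofReal.tendsto _).comp hσ
    exact ((Complex.continuous_exp.tendsto _).comp ((h2.const_mul _).const_sub _)).mul h1

/-- The heat kernel form of the integral over the real line. -/
theorem integral_lineIntegrand_eq (hD : 0 < D₀) {σ : ℝ} (hσ : 0 < σ) {φ : ℝ → ℝ}
    (hφ : IntegrableOn φ (Ioo 0 L)) :
    ∫ r, lineIntegrand K₀ D₀ L φ x σ r = ((Real.sqrt (Real.pi / D₀) *
      ∫ z, (Ioo 0 L).indicator φ (x - K₀ * σ - Real.sqrt σ * z) *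
        Real.exp (-(1 / (4 * D₀)) * z ^ 2) : ℝ) : ℂ) := by
  have hb : 0 < D₀ * σ := mul_pos hD hσ
  set e : ℝ → ℂ := fun r => Complex.exp (Complex.I * r * x - omega K₀ D₀ r * σ) with he
  have hω := (differentiable_omega K₀ D₀).continuous
  have hei : Integrable e := by
    refine (integrable_exp_neg_mul_sq hb).mono'
      (Continuous.aestronglyMeasurable (by fun_prop)) (Eventually.of_forall fun r => le_of_eq ?_)
    simp only [he]
    rw [Complex.norm_exp, Complex.sub_re, Complex.re_mul_ofReal _ σ, re_omega_ofReal]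
    congr 1
    simp
    ring
  -- Fubini: the Gaussian in `r` times the `L¹` function `φ`, up to a factor of modulus one.
  have hint : Integrable (Function.uncurry fun (r y : ℝ) =>
      Complex.exp (-Complex.I * r * y) * (e r * (φ y : ℂ)))
      (volume.prod (volume.restrict (Ioo 0 L))) := by
    refine (hei.mul_prod hφ.ofReal).bdd_mul (c := 1)
      (Continuous.aestronglyMeasurable (f := fun p : ℝ × ℝ => Complex.exp (-Complex.I * p.1 * p.2))
        (by fun_prop)) (Eventually.of_forall fun p => ?_)
    rw [Complex.norm_exp]
    simp
  have h1 : ∫ r, lineIntegrand K₀ D₀ L φ x σ r =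
      ∫ r : ℝ, ∫ y in Ioo 0 L, Complex.exp (-Complex.I * r * y) * (e r * (φ y : ℂ)) := by
    refine integral_congr_ae (Eventually.of_forall fun r => ?_)
    simp only [lineIntegrand, hat]
    rw [← integral_const_mul]
    refine integral_congr_ae (Eventually.of_forall fun y => ?_)
    simp only [he]
    ring
  have hgauss : ∀ y : ℝ, ∫ r : ℝ, Complex.exp (-Complex.I * r * y) * (e r * (φ y : ℂ)) =
      ((Real.sqrt (Real.pi / (D₀ * σ)) * (φ y *
        Real.exp (-(1 / (4 * (D₀ * σ))) * (x - K₀ * σ - y) ^ 2)) : ℝ) : ℂ) := by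
    intro y
    have h2 : ∀ r : ℝ, Complex.exp (-Complex.I * r * y) * (e r * (φ y : ℂ)) =
        (Complex.exp (Complex.I * ((x - K₀ * σ - y : ℝ) : ℂ) * r) *
          Complex.exp (-((D₀ * σ : ℝ) : ℂ) * r ^ 2)) * φ y := fun r => by
      simp only [he]
      rw [← mul_assoc, ← Complex.exp_add, ← Complex.exp_add]
      congr 2
      unfold omega
      push_cast
      ring
    simp only [h2]
    rw [integral_mul_const, fourierIntegral_gaussian (by simpa using hb)]
    rw [← Complex.ofReal_div, show (1 / 2 : ℂ) = ((1 / 2 : ℝ) : ℂ) by push_cast; rfl,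
      ← Complex.ofReal_cpow (by positivity), ← Real.sqrt_eq_rpow]
    push_cast
    rw [mul_assoc, mul_comm (Complex.exp _)]
    congr 4
    ring
  rw [h1, integral_integral_swap hint]
  simp only [hgauss]
  refine (integral_ofReal (f := fun y => Real.sqrt (Real.pi / (D₀ * σ)) * (φ y *
    Real.exp (-(1 / (4 * (D₀ * σ))) * (x - K₀ * σ - y) ^ 2)))).trans (congrArg Complex.ofReal ?_)
  rw [integral_const_mul]
  set F : ℝ → ℝ := fun y => (Ioo 0 L).indicator φ y *
    Real.exp (-(1 / (4 * (D₀ * σ))) * (x - K₀ * σ - y) ^ 2) with hF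
  have h3 : ∫ y in Ioo 0 L, φ y * Real.exp (-(1 / (4 * (D₀ * σ))) * (x - K₀ * σ - y) ^ 2) =
      ∫ y, F y := by
    rw [← integral_indicator measurableSet_Ioo]
    refine integral_congr_ae (Eventually.of_forall fun y => ?_)
    simp only [hF]
    by_cases hy : y ∈ Ioo 0 L <;> simp [hy]
  have hs : 0 < Real.sqrt σ := Real.sqrt_pos.2 hσ
  -- The substitution `y = x - K₀σ - √σ z` makes the Gaussian weight independent of `σ`, as needed
  -- for the limit `σ → 0`.
  have h4 := Measure.integral_comp_mul_left (fun u => F (x - K₀ * σ - u)) (Real.sqrt σ)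
  rw [integral_sub_left_eq_self F volume (x - K₀ * σ), abs_of_pos (inv_pos.2 hs), smul_eq_mul] at h4
  have h5 : ∀ z, F (x - K₀ * σ - Real.sqrt σ * z) =
      (Ioo 0 L).indicator φ (x - K₀ * σ - Real.sqrt σ * z) * Real.exp (-(1 / (4 * D₀)) * z ^ 2) := by
    intro z
    simp only [hF]
    congr 2
    rw [sub_sub_cancel, mul_pow, Real.sq_sqrt hσ.le]
    field_simp
  simp only [h5] at h4
  rw [h3, h4, ← mul_assoc]
  rw [← div_div, Real.sqrt_div (by positivity), div_eq_mul_inv]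
  rfl

/-- In the rescaled form the evaluation point tends to the interior point `x` for each `z`, and `θ`
is bounded on `[0,L] × [t/2,t]`. Dominated convergence leaves `θ(x,t)` times the mass of a fixed
Gaussian. -/
theorem IsSolution.tendsto_integral_lineIntegrand_end (hθ : IsSolution K₀ D₀ L θ₀ θ) (hD : 0 < D₀)
    (hx : x ∈ Ioo 0 L) (ht : 0 < t) :
    Tendsto (fun s => ∫ r, lineIntegrand K₀ D₀ L (fun y => θ y s) x (t - s) r) (𝓝[<] t)
      (𝓝 (2 * Real.pi * θ x t)) := by
  have hnear : ∀ᶠ s in 𝓝[<] t, s ∈ Ioo (t / 2) t := Ioo_mem_nhdsLT (half_lt_self ht)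
  obtain ⟨M, hM⟩ := (isCompact_Icc.prod isCompact_Icc).exists_bound_of_continuousOn
    (hθ.continuous_theta.mono (prod_mono subset_rfl fun s (hs : s ∈ Icc (t / 2) t) =>
      (half_pos ht).trans_le hs.1))
  have hM0 : 0 ≤ M := (norm_nonneg _).trans
    (hM (x, t) ⟨Ioo_subset_Icc_self hx, (half_lt_self ht).le, le_rfl⟩)
  have key : Tendsto (fun s => ∫ z, (Ioo 0 L).indicator (fun y => θ y s)
      (x - K₀ * (t - s) - Real.sqrt (t - s) * z) * Real.exp (-(1 / (4 * D₀)) * z ^ 2)) (𝓝[<] t)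
      (𝓝 (∫ z, θ x t * Real.exp (-(1 / (4 * D₀)) * z ^ 2))) := by
    refine tendsto_integral_filter_of_dominated_convergence
      (fun z => M * Real.exp (-(1 / (4 * D₀)) * z ^ 2)) ?_ ?_
      ((integrable_exp_neg_mul_sq (by positivity)).const_mul _) ?_
    · filter_upwards [hnear] with s hs
      have h1 := (hθ.integrableOn_slice ((half_pos ht).trans hs.1).le).integrable_indicator
        measurableSet_Ioo
      have h2 := (h1.comp_sub_left (x - K₀ * (t - s))).comp_mul_left'
        (Real.sqrt_pos.2 (sub_pos.2 hs.2)).ne'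
      exact h2.aestronglyMeasurable.mul (Continuous.aestronglyMeasurable (by fun_prop))
    · filter_upwards [hnear] with s hs
      refine Eventually.of_forall fun z => ?_
      rw [norm_mul, Real.norm_of_nonneg (Real.exp_pos _).le]
      refine mul_le_mul_of_nonneg_right ?_ (Real.exp_pos _).le
      rw [norm_indicator_eq_indicator_norm]
      refine indicator_le' (fun y hy => ?_) (fun _ _ => hM0) _
      exact hM (y, s) ⟨Ioo_subset_Icc_self hy, Ioo_subset_Icc_self hs⟩
    · refine Eventually.of_forall fun z => Tendsto.mul_const _ ?_
      have hc : Continuous fun s => x - K₀ * (t - s) - Real.sqrt (t - s) * z := by fun_prop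
      have h1 : Tendsto (fun s => x - K₀ * (t - s) - Real.sqrt (t - s) * z) (𝓝[<] t) (𝓝 x) := by
        have := (hc.tendsto t).mono_left (nhdsWithin_le_nhds (s := Iio t))
        simpa using this
      have h2 : ContinuousAt (fun p : ℝ × ℝ => θ p.1 p.2) (x, t) :=
        hθ.continuous_theta.continuousAt (prod_mem_nhds (Icc_mem_nhds hx.1 hx.2) (Ioi_mem_nhds ht))
      have h3 : Tendsto (fun s => θ (x - K₀ * (t - s) - Real.sqrt (t - s) * z) s) (𝓝[<] t)
          (𝓝 (θ x t)) :=
        h2.tendsto.comp (h1.prodMk_nhds (tendsto_id.mono_left nhdsWithin_le_nhds))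
      refine h3.congr' ?_
      filter_upwards [h1.eventually (Ioo_mem_nhds hx.1 hx.2)] with s hs
      exact (indicator_of_mem (s := Ioo 0 L) hs (fun y => θ y s)).symm
  have h := (Complex.continuous_ofReal.tendsto _).comp (key.const_mul (Real.sqrt (Real.pi / D₀)))
  rw [integral_const_mul, integral_gaussian] at h
  -- The total mass is `√(π/D₀) · √(4πD₀) = 2π`.
  have e : Real.sqrt (Real.pi / D₀) * (θ x t * Real.sqrt (Real.pi / (1 / (4 * D₀)))) =
      2 * Real.pi * θ x t := by
    rw [mul_left_comm, ← Real.sqrt_mul (by positivity),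
      show Real.pi / D₀ * (Real.pi / (1 / (4 * D₀))) = (2 * Real.pi) ^ 2 by field_simp; ring,
      Real.sqrt_sq (by positivity)]
    ring
  rw [e] at h
  push_cast at h
  refine h.congr' ?_
  filter_upwards [hnear] with s hs
  rw [integral_lineIntegrand_eq hD (sub_pos.2 hs.2)
    (hθ.integrableOn_slice ((half_pos ht).trans hs.1).le)]
  simp only [Function.comp_apply]

/-! ### The two limits of the restarted representation -/

theorem IsSolution.meanTendsto_zero (hθ : IsSolution K₀ D₀ L θ₀ θ) :
    MeanTendsto (𝓝[>] 0) 0 L (fun s y => θ y s) θ₀ :=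
  ⟨eventually_mem_nhdsWithin.mono fun _ hs => hθ.integrableOn_slice (le_of_lt hs),
    hθ.integrable_initial, hθ.initial_mean⟩

theorem IsSolution.meanTendsto_left (hθ : IsSolution K₀ D₀ L θ₀ θ) (ht : 0 < t) :
    MeanTendsto (𝓝[<] t) 0 L (fun s y => θ y s) (fun y => θ y t) := by
  have hnear : ∀ᶠ s in 𝓝[<] t, s ∈ Ioo (t / 2) t := Ioo_mem_nhdsLT (half_lt_self ht)
  refine ⟨hnear.mono fun s hs => hθ.integrableOn_slice ((half_pos ht).trans hs.1).le,
    hθ.integrableOn_slice ht.le, ?_⟩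
  obtain ⟨M, hM⟩ := (isCompact_Icc.prod isCompact_Icc).exists_bound_of_continuousOn
    (hθ.continuous_theta.mono (prod_mono subset_rfl fun s (hs : s ∈ Icc (t / 2) t) =>
      (half_pos ht).trans_le hs.1))
  have h0 : Tendsto (fun s => ∫ y in Ioo 0 L, |θ y s - θ y t|) (𝓝[<] t)
      (𝓝 (∫ y in Ioo 0 L, |θ y t - θ y t|)) := by
    refine tendsto_integral_filter_of_dominated_convergence (fun _ => M + M) ?_ ?_
      (integrableOn_const (by simp)) ?_
    · filter_upwards [hnear] with s hs
      exact ((hθ.integrableOn_slice ((half_pos ht).trans hs.1).le).sub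
        (hθ.integrableOn_slice ht.le)).norm.aestronglyMeasurable
    · filter_upwards [hnear] with s hs
      refine (ae_restrict_iff' measurableSet_Ioo).2 (Eventually.of_forall fun y hy => ?_)
      have h1 := hM (y, s) ⟨Ioo_subset_Icc_self hy, Ioo_subset_Icc_self hs⟩
      have h2 := hM (y, t) ⟨Ioo_subset_Icc_self hy, (half_lt_self ht).le, le_rfl⟩
      rw [Real.norm_eq_abs, abs_abs]
      exact (norm_sub_le _ _).trans (add_le_add h1 h2)
    · refine (ae_restrict_iff' measurableSet_Ioo).2 (Eventually.of_forall fun y hy => ?_)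
      have h1 : ContinuousAt (θ y) t :=
        (hθ.continuousOn_theta_bdry (Ioo_subset_Icc_self hy)).continuousAt (Ioi_mem_nhds ht)
      exact ((h1.tendsto.mono_left nhdsWithin_le_nhds).sub_const _).abs
  simpa using h0

theorem meanTendsto_indicator_zero {f : ℝ → ℝ} (hf : IntegrableOn f (Ioo 0 t)) :
    MeanTendsto (𝓝[>] 0) 0 t (fun s => (Ioi s).indicator f) f := by
  refine ⟨Eventually.of_forall fun s => hf.indicator measurableSet_Ioi, hf, ?_⟩
  have h0 : Tendsto (fun s => ∫ y in Ioo 0 t, |(Ioi s).indicator f y - f y|) (𝓝[>] 0)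
      (𝓝 (∫ y in Ioo 0 t, (0 : ℝ))) := by
    refine tendsto_integral_filter_of_dominated_convergence (fun y => |f y|) ?_ ?_ hf.norm ?_
    · exact Eventually.of_forall fun s =>
        ((hf.indicator measurableSet_Ioi).sub hf).norm.aestronglyMeasurable
    · refine Eventually.of_forall fun s => Eventually.of_forall fun y => ?_
      by_cases hy : y ∈ Ioi s <;> simp [hy]
    · refine (ae_restrict_iff' measurableSet_Ioo).2 (Eventually.of_forall fun y hy => ?_)
      refine tendsto_const_nhds.congr' ?_
      filter_upwards [Ioo_mem_nhdsGT hy.1] with s hs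
      rw [indicator_of_mem (show y ∈ Ioi s from hs.2)]
      simp
  simpa using h0

theorem meanTendsto_indicator_left {f : ℝ → ℝ} (hf : IntegrableOn f (Ioo 0 t)) :
    MeanTendsto (𝓝[<] t) 0 t (fun s => (Ioi s).indicator f) 0 := by
  refine ⟨Eventually.of_forall fun s => hf.indicator measurableSet_Ioi, integrable_zero _ _ _, ?_⟩
  have h0 : Tendsto (fun s => ∫ y in Ioo 0 t, |(Ioi s).indicator f y|) (𝓝[<] t)
      (𝓝 (∫ y in Ioo 0 t, (0 : ℝ))) := by
    refine tendsto_integral_filter_of_dominated_convergence (fun y => |f y|) ?_ ?_ hf.norm ?_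
    · exact Eventually.of_forall fun s => (hf.indicator measurableSet_Ioi).norm.aestronglyMeasurable
    · refine Eventually.of_forall fun s => Eventually.of_forall fun y => ?_
      by_cases hy : y ∈ Ioi s <;> simp [hy]
    · refine (ae_restrict_iff' measurableSet_Ioo).2 (Eventually.of_forall fun y hy => ?_)
      refine tendsto_const_nhds.congr' ?_
      filter_upwards [Ioo_mem_nhdsLT hy.2] with s hs
      rw [indicator_of_notMem (show y ∉ Ioi s from not_lt.2 hs.1.le)]
      simp
  simpa using h0

/-- The restarted representation is constant in `s ∈ (0,t)`, so its limits at the two ends agree: at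
`0` the formula, at `t` the value `θ(x,t)`. -/
theorem IsSolution.isRepresentedBy (hθ : IsSolution K₀ D₀ L θ₀ θ) (hD : 0 < D₀)
    (hq : q.Nontrivial) (hγ : IsFavourable K₀ D₀ (robinDelta K₀ D₀ L q) γ) {f g : ℝ → ℝ}
    (hf : IsBoundaryData f) (hg : IsBoundaryData g)
    (hbf : ∀ τ, 0 < τ → q.a * θ 0 τ - q.α * dx L θ 0 τ = f τ)
    (hbg : ∀ τ, 0 < τ → q.b * θ L τ - q.β * dx L θ L τ = g τ) :
    IsRepresentedBy K₀ D₀ L θ₀ θ (-(Complex.I / Real.pi)) γ (robinIntegrand K₀ D₀ L q θ₀ f g) := by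
  intro x hx t ht
  have hf' := hf t ht
  have hg' := hg t ht
  refine ⟨integrable_lineIntegrand hD hθ.integrable_initial ht, ?_, ?_⟩
  · rw [robinIntegrand_eq]
    exact integrable_heatIntegrand hD hx ht hq hγ ⟨ht.le, le_rfl⟩ hθ.integrable_initial hf' hg'
  rw [robinIntegrand_eq]
  have h0 : Tendsto (restarted K₀ D₀ L q γ θ f g x t) (𝓝[>] 0)
      (𝓝 (representation K₀ D₀ L θ₀ (-(Complex.I / Real.pi)) γ
        (heatIntegrand K₀ D₀ L q θ₀ f g x t t) x t)) := by
    have hσ : Tendsto (fun s => t - s) (𝓝[>] 0) (𝓝 t) := by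
      have : Continuous fun s => t - s := by fun_prop
      simpa using (this.tendsto 0).mono_left (nhdsWithin_le_nhds (s := Ioi 0))
    have hσ' : ∀ᶠ s in 𝓝[>] (0 : ℝ), t - s ∈ Icc 0 t := by
      filter_upwards [Ioo_mem_nhdsGT ht] with s hs
      exact ⟨by linarith [hs.2], by linarith [hs.1]⟩
    have h1 := tendsto_integral_lineIntegrand (K₀ := K₀) (x := x) hD ht hσ hθ.meanTendsto_zero
    have h2 := tendsto_contourIntegral_heatIntegrand hD hx ht hq hγ tendsto_const_nhds
      tendsto_const_nhds hσ' hσ hθ.meanTendsto_zero (meanTendsto_indicator_zero hf')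
      (meanTendsto_indicator_zero hg')
    exact (h1.const_mul _).add (h2.const_mul _)
  have ht' : Tendsto (restarted K₀ D₀ L q γ θ f g x t) (𝓝[<] t) (𝓝 (θ x t : ℂ)) := by
    have hσ : Tendsto (fun s => t - s) (𝓝[<] t) (𝓝 0) := by
      have : Continuous fun s => t - s := by fun_prop
      simpa using (this.tendsto t).mono_left (nhdsWithin_le_nhds (s := Iio t))
    have hσ' : ∀ᶠ s in 𝓝[<] t, t - s ∈ Icc 0 t := by
      filter_upwards [Ioo_mem_nhdsLT ht] with s hs
      exact ⟨by linarith [hs.2], by linarith [hs.1]⟩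
    have h1 := hθ.tendsto_integral_lineIntegrand_end hD hx ht
    have h2 := tendsto_contourIntegral_heatIntegrand hD hx ht hq hγ tendsto_const_nhds
      tendsto_const_nhds hσ' hσ (hθ.meanTendsto_left ht) (meanTendsto_indicator_left hf')
      (meanTendsto_indicator_left hg')
    rw [integral_heatIntegrand_zero hD hx hq hγ ht (hθ.integrableOn_slice ht.le)] at h2
    have h3 := (h1.const_mul (1 / (2 * Real.pi : ℂ))).add
      (h2.const_mul (-(Complex.I / Real.pi) * Complex.exp (-(K₀ / (2 * D₀)) * (L - x))))
    rw [mul_zero, add_zero, ← mul_assoc, one_div_mul_cancel (by simp), one_mul] at h3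
    exact h3
  -- Comparison with the midpoint `t/2` gives a common constant for both one-sided limits.
  have hconst : ∀ s ∈ Ioo 0 t, restarted K₀ D₀ L q γ θ f g x t s =
      restarted K₀ D₀ L q γ θ f g x t (t / 2) := fun s hs => by
    rcases le_total s (t / 2) with h | h
    · exact (restarted_eq hθ hD hx hq hγ hf' hg' hbf hbg hs.1 h (half_lt_self ht)).symm
    · exact restarted_eq hθ hD hx hq hγ hf' hg' hbf hbg (half_pos ht) h hs.2
  have c0 := tendsto_nhds_unique h0 (tendsto_const_nhds.congr' (by
    filter_upwards [Ioo_mem_nhdsGT ht] with s hs using (hconst s hs).symm))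
  have ct := tendsto_nhds_unique ht' (tendsto_const_nhds.congr' (by
    filter_upwards [Ioo_mem_nhdsLT ht] with s hs using (hconst s hs).symm))
  rw [ct, c0]

end

section

variable {K₀ D₀ L : ℝ} {γ : ℝ → ℂ}

/-! ### The special cases -/

theorem IsFavourable.congr {E E' : ℂ → ℂ} (h : IsFavourable K₀ D₀ E γ)
    (hE : ∀ z, E' z = 0 → E z = 0) : IsFavourable K₀ D₀ E' γ :=
  ⟨h.1, fun z hz => h.2 z (hE z hz)⟩

theorem Delta_eq (α β : ℝ) : Delta K₀ D₀ L α β = robinDelta K₀ D₀ L ⟨1, α, 1, β⟩ := by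
  funext k
  simp [Delta, robinDelta, symb]

theorem F_eq (c y : ℝ) (k : ℂ) : F K₀ D₀ c k y = robinF K₀ D₀ 1 c k y := by
  simp [F, robinF]

theorem integrandRR_eq (α β : ℝ) (θ₀ f g : ℝ → ℝ) (x t : ℝ) :
    integrandRR K₀ D₀ L α β θ₀ f g x t = robinIntegrand K₀ D₀ L ⟨1, α, 1, β⟩ θ₀ f g x t := by
  funext k
  simp only [integrandRR, robinIntegrand, Delta_eq, F_eq, numA, numB, numf, numg, symb,
    Complex.ofReal_one]
  ring

theorem DeltaRD_eq (α : ℝ) : DeltaRD K₀ D₀ L α = Delta K₀ D₀ L α 0 := by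
  funext k
  simp [DeltaRD, Delta]

theorem Delta0_eq : Delta0 K₀ D₀ L = Delta K₀ D₀ L 0 0 := by
  funext k
  simp [Delta0, Delta]

theorem F_zero (y : ℝ) (k : ℂ) : F K₀ D₀ 0 k y = -Complex.sin (y * shift K₀ D₀ k) := by
  simp [F]

theorem F_zero_sub (x : ℝ) (k : ℂ) :
    F K₀ D₀ 0 k (x - L) = Complex.sin ((L - x) * shift K₀ D₀ k) := by
  rw [F_zero, ← Complex.sin_neg]
  congr 1
  push_cast
  ring

theorem integrandRR_zero_right (α : ℝ) (θ₀ f g : ℝ → ℝ) (x t : ℝ) :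
    integrandRR K₀ D₀ L α 0 θ₀ f g x t = integrandRD K₀ D₀ L α θ₀ f g x t := by
  funext k
  simp only [integrandRR, integrandRD, DeltaRD_eq, F_zero_sub, Complex.ofReal_zero]
  ring

theorem integrandRR_zero (θ₀ f g : ℝ → ℝ) (x t : ℝ) :
    integrandRR K₀ D₀ L 0 0 θ₀ f g x t = integrandDD K₀ D₀ L θ₀ f g x t := by
  funext k
  simp only [integrandRR, integrandDD, Delta0_eq, F_zero_sub, F_zero x, Complex.ofReal_zero]
  ring

/-- The boundary conditions of the Neumann–Neumann problem. -/
def neumann : BdryCoeff := ⟨0, 1, 0, 1⟩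

theorem neumann_nontrivial : neumann.Nontrivial := ⟨Or.inr one_ne_zero, Or.inr one_ne_zero⟩

/-- The Neumann symbol is `-ik`; the product of two of them contributes `-kν` to each term. -/
theorem robinDelta_neumann (k : ℂ) :
    robinDelta K₀ D₀ L neumann k = -(k * nu K₀ D₀ k * Delta0 K₀ D₀ L k) := by
  simp only [robinDelta, neumann, symb, Delta0, Complex.ofReal_zero, Complex.ofReal_one]
  linear_combination (k * nu K₀ D₀ k * (Complex.exp (-Complex.I * k * L)
    - Complex.exp (-Complex.I * nu K₀ D₀ k * L))) * Complex.I_mul_I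

theorem isFavourable_neumann_iff :
    IsFavourable K₀ D₀ (robinDelta K₀ D₀ L neumann) γ ↔
      IsFavourable K₀ D₀ (fun k => k * nu K₀ D₀ k * Delta0 K₀ D₀ L k) γ := by
  constructor <;> intro h <;> refine h.congr fun z hz => ?_
  · rw [robinDelta_neumann, hz, neg_zero]
  · rwa [robinDelta_neumann, neg_eq_zero] at hz

theorem tilde_neg (f : ℝ → ℝ) (k : ℂ) (t : ℝ) : tilde (fun τ => -f τ) k t = -tilde f k t := by
  simp [tilde, integral_neg]

/-- With `a = 0` and `α = 1` the condition reads `-θ_x = f`, hence the negated data. The factor `-i`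
accounts for the constant `1/π` in place of `-i/π`. -/
theorem integrandNN_eq (θ₀ fN gN : ℝ → ℝ) (x t : ℝ) (k : ℂ) :
    integrandNN K₀ D₀ L θ₀ fN gN x t k = -Complex.I *
      robinIntegrand K₀ D₀ L neumann θ₀ (fun τ => -fN τ) (fun τ => -gN τ) x t k := by
  have hG : ∀ y : ℝ, robinF K₀ D₀ 0 1 k y = G K₀ D₀ k y := fun y => by simp [robinF, G]
  simp only [robinIntegrand, robinDelta_neumann, numA, numB, numf, numg, tilde_neg, integrandNN]
  simp only [neumann, hG, symb, Complex.ofReal_zero, Complex.ofReal_one, div_eq_mul_inv, inv_neg,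
    mul_inv]
  linear_combination (Complex.exp (-omega K₀ D₀ k * t) * (Delta0 K₀ D₀ L k)⁻¹ * k⁻¹ *
    (nu K₀ D₀ k)⁻¹ * (k * G K₀ D₀ k x * Complex.exp (Complex.I * L * shift K₀ D₀ k) * hat L θ₀ k
      - nu K₀ D₀ k * G K₀ D₀ k (x - L) * hat L θ₀ (nu K₀ D₀ k))) * Complex.I_mul_I

theorem pullback_integrandNN (θ₀ fN gN : ℝ → ℝ) (x t : ℝ) :
    pullback γ (integrandNN K₀ D₀ L θ₀ fN gN x t) = fun s => -Complex.I *
      pullback γ (robinIntegrand K₀ D₀ L neumann θ₀ (fun τ => -fN τ) (fun τ => -gN τ) x t) s := by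
  funext s
  rw [pullback, integrandNN_eq, pullback, mul_assoc]

theorem representation_integrandNN (θ₀ fN gN : ℝ → ℝ) (x t : ℝ) :
    representation K₀ D₀ L θ₀ (1 / Real.pi) γ (integrandNN K₀ D₀ L θ₀ fN gN x t) x t =
      representation K₀ D₀ L θ₀ (-(Complex.I / Real.pi)) γ
        (robinIntegrand K₀ D₀ L neumann θ₀ (fun τ => -fN τ) (fun τ => -gN τ) x t) x t := by
  unfold representation contourIntegral
  rw [pullback_integrandNN, integral_const_mul]
  ring

theorem robinF_scale {α : ℝ} (hα : α ≠ 0) (k : ℂ) (y : ℝ) :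
    robinF K₀ D₀ 1 α k y = α * robinF K₀ D₀ α⁻¹ 1 k y := by
  have : (α : ℂ) ≠ 0 := by exact_mod_cast hα
  simp only [robinF, Complex.ofReal_one, Complex.ofReal_inv]
  linear_combination (-Complex.sin (y * shift K₀ D₀ k)) * (mul_inv_cancel₀ this).symm

theorem symb_scale {α : ℝ} (hα : α ≠ 0) (k : ℂ) : symb 1 α k = α * symb α⁻¹ 1 k := by
  have : (α : ℂ) ≠ 0 := by exact_mod_cast hα
  simp only [symb, Complex.ofReal_one, Complex.ofReal_inv]
  linear_combination (mul_inv_cancel₀ this).symm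

theorem robinDelta_scale {α : ℝ} (hα : α ≠ 0) (k : ℂ) :
    robinDelta K₀ D₀ L ⟨1, α, 1, α⟩ k = α ^ 2 * robinDelta K₀ D₀ L ⟨α⁻¹, 1, α⁻¹, 1⟩ k := by
  simp only [robinDelta, symb_scale hα]
  ring

/-- Every term of the numerator is a product of two coefficient factors, or of one such factor and a
datum proportional to `α`; the denominator is also of degree two. So `α²` cancels, and large `α`
becomes a small perturbation `a = b = 1/α` of the Neumann conditions. -/
theorem integrandRR_scale {α : ℝ} (hα : α ≠ 0) (θ₀ fN gN : ℝ → ℝ) (x t : ℝ) :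
    integrandRR K₀ D₀ L α α θ₀ (fun τ => -α * fN τ) (fun τ => -α * gN τ) x t =
      robinIntegrand K₀ D₀ L ⟨α⁻¹, 1, α⁻¹, 1⟩ θ₀ (fun τ => -fN τ) (fun τ => -gN τ) x t := by
  have hα' : (α : ℂ) ≠ 0 := by exact_mod_cast hα
  have ht : ∀ (f : ℝ → ℝ) (w : ℂ), tilde (fun τ => -α * f τ) w t = α * -tilde f w t := by
    intro f w
    rw [← tilde_neg, tilde, tilde, ← integral_const_mul]
    refine integral_congr_ae (Eventually.of_forall fun τ => ?_)
    simp only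
    push_cast
    ring
  rw [integrandRR_eq]
  funext k
  simp only [robinIntegrand, robinDelta_scale hα, numA, numB, numf, numg, robinF_scale hα,
    symb_scale hα, tilde_neg, ht]
  rw [div_mul_eq_mul_div, div_mul_eq_mul_div, ← mul_div_mul_left _ (robinDelta K₀ D₀ L _ k)
    (pow_ne_zero 2 hα')]
  congr 1
  ring

/-- At `-iκ`, the fixed point of `ν`, the two terms of `Δ` coincide. -/
theorem Delta_fixed (α β : ℝ) : Delta K₀ D₀ L α β (nu K₀ D₀ 0 / 2) = 0 := by
  have h : nu K₀ D₀ (nu K₀ D₀ 0 / 2) = nu K₀ D₀ 0 / 2 := by unfold nu; ring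
  simp only [Delta, h]
  ring

theorem favourable_nearby_neumann (hL : 0 < L)
    (hγ : IsFavourable K₀ D₀ (robinDelta K₀ D₀ L neumann) γ) :
    ∀ᶠ α : ℝ in atTop, IsFavourable K₀ D₀ (Delta K₀ D₀ L α α) γ := by
  have h := favourable_nearby hL neumann_nontrivial hγ
  have hlim : Tendsto (fun α : ℝ => (α⁻¹, α⁻¹)) atTop (𝓝 (neumann.a, neumann.b)) :=
    tendsto_inv_atTop_zero.prodMk_nhds tendsto_inv_atTop_zero
  filter_upwards [hlim.eventually h, eventually_ne_atTop 0] with α h1 h0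
  refine h1.congr fun z hz => ?_
  rw [Delta_eq, robinDelta_scale h0] at hz
  exact (mul_eq_zero.1 hz).resolve_left (pow_ne_zero 2 (by exact_mod_cast h0))

/-- Continuity in the coefficients at `a = b = 0`; after rescaling, neither the data nor the line
integral depends on `α`. -/
theorem tendsto_representation_neumann (hD : 0 < D₀)
    (hγ : IsFavourable K₀ D₀ (robinDelta K₀ D₀ L neumann) γ) {θ₀ fN gN : ℝ → ℝ}
    (hθ : IntegrableOn θ₀ (Ioo 0 L)) (hf : IsBoundaryData fN) (hg : IsBoundaryData gN) {x t : ℝ}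
    (hx : x ∈ Ioo 0 L) (ht : 0 < t) :
    Tendsto (fun α : ℝ => representation K₀ D₀ L θ₀ (-(Complex.I / Real.pi)) γ
        (integrandRR K₀ D₀ L α α θ₀ (fun τ => -α * fN τ) (fun τ => -α * gN τ) x t) x t)
      atTop (𝓝 (representation K₀ D₀ L θ₀ (1 / Real.pi) γ
        (integrandNN K₀ D₀ L θ₀ fN gN x t) x t)) := by
  have h := tendsto_contourIntegral_heatIntegrand (l := atTop) (a := fun α : ℝ => α⁻¹)
    (b := fun α : ℝ => α⁻¹) (σ := fun _ => t) (φ := fun _ => θ₀) (f := fun _ τ => -fN τ)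
    (g := fun _ τ => -gN τ) hD hx ht neumann_nontrivial hγ tendsto_inv_atTop_zero
    tendsto_inv_atTop_zero (Eventually.of_forall fun _ => ⟨ht.le, le_rfl⟩) tendsto_const_nhds
    (MeanTendsto.const hθ) (MeanTendsto.const (hf t ht).neg) (MeanTendsto.const (hg t ht).neg)
  rw [representation_integrandNN, robinIntegrand_eq]
  refine Tendsto.congr' ?_ ((h.const_mul
    (-(Complex.I / Real.pi) * Complex.exp (-(K₀ / (2 * D₀)) * (L - x)))).const_add _)
  filter_upwards [eventually_ne_atTop 0] with α hα
  rw [integrandRR_scale hα, robinIntegrand_eq]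
  rfl

end

end

end AdvectionDiffusion

/-! ### The four boundary value problems and the Neumann limit -/

theorem mainTheorem1 (K₀ D₀ L : ℝ) (hD : 0 < D₀) (hL : 0 < L) :
    -- favourable contours exist, and `∂D₊` is one if `Δ` has no zero in the closure of `D₊`
    (∀ α β : ℝ, (∃ γ, IsFavourable K₀ D₀ (Delta K₀ D₀ L α β) γ) ∧
      ((∀ z ∈ closure (DPlus K₀ D₀), Delta K₀ D₀ L α β z ≠ 0) →
        IsFavourable K₀ D₀ (Delta K₀ D₀ L α β) (boundaryDPlus K₀ D₀))) ∧
    -- the Robin–Robin problem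
    (∀ (α β : ℝ) (θ₀ f g : ℝ → ℝ) (θ : ℝ → ℝ → ℝ), IsSolution K₀ D₀ L θ₀ θ →
      IsBoundaryData f → IsBoundaryData g →
      (∀ t, 0 < t → θ 0 t - α * dx L θ 0 t = f t) →
      (∀ t, 0 < t → θ L t - β * dx L θ L t = g t) →
      ∀ γ, IsFavourable K₀ D₀ (Delta K₀ D₀ L α β) γ →
        IsRepresentedBy K₀ D₀ L θ₀ θ (-(Complex.I / Real.pi)) γ
          (integrandRR K₀ D₀ L α β θ₀ f g)) ∧
    -- the Robin–Dirichlet problem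
    (∀ (α : ℝ) (θ₀ f g : ℝ → ℝ) (θ : ℝ → ℝ → ℝ), IsSolution K₀ D₀ L θ₀ θ →
      IsBoundaryData f → IsBoundaryData g →
      (∀ t, 0 < t → θ 0 t - α * dx L θ 0 t = f t) →
      (∀ t, 0 < t → θ L t = g t) →
      ∀ γ, IsFavourable K₀ D₀ (DeltaRD K₀ D₀ L α) γ →
        IsRepresentedBy K₀ D₀ L θ₀ θ (-(Complex.I / Real.pi)) γ
          (integrandRD K₀ D₀ L α θ₀ f g)) ∧
    -- the Dirichlet–Dirichlet problem
    (∀ (θ₀ f g : ℝ → ℝ) (θ : ℝ → ℝ → ℝ), IsSolution K₀ D₀ L θ₀ θ →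
      IsBoundaryData f → IsBoundaryData g →
      (∀ t, 0 < t → θ 0 t = f t) →
      (∀ t, 0 < t → θ L t = g t) →
      ∀ γ, IsFavourable K₀ D₀ (Delta0 K₀ D₀ L) γ →
        IsRepresentedBy K₀ D₀ L θ₀ θ (-(Complex.I / Real.pi)) γ
          (integrandDD K₀ D₀ L θ₀ f g)) ∧
    -- the special cases are obtained from the Robin–Robin integrand by setting `β = 0`, `α = β = 0`
    (∀ (α : ℝ) (θ₀ f g : ℝ → ℝ) (x t : ℝ),
      integrandRR K₀ D₀ L α 0 θ₀ f g x t = integrandRD K₀ D₀ L α θ₀ f g x t ∧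
      integrandRR K₀ D₀ L 0 0 θ₀ f g x t = integrandDD K₀ D₀ L θ₀ f g x t) ∧
    -- the Neumann–Neumann problem
    (∃ γ, IsFavourable K₀ D₀ (fun k => k * nu K₀ D₀ k * Delta0 K₀ D₀ L k) γ) ∧
    (∀ (θ₀ fN gN : ℝ → ℝ) (θ : ℝ → ℝ → ℝ), IsSolution K₀ D₀ L θ₀ θ →
      IsBoundaryData fN → IsBoundaryData gN →
      (∀ t, 0 < t → dx L θ 0 t = fN t) →
      (∀ t, 0 < t → dx L θ L t = gN t) →
      ∀ γ, IsFavourable K₀ D₀ (fun k => k * nu K₀ D₀ k * Delta0 K₀ D₀ L k) γ →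
        IsRepresentedBy K₀ D₀ L θ₀ θ (1 / Real.pi) γ
          (integrandNN K₀ D₀ L θ₀ fN gN)) ∧
    -- its representation is the limit `α = β → ∞` of the Robin–Robin one with rescaled data
    (∀ γ, IsFavourable K₀ D₀ (fun k => k * nu K₀ D₀ k * Delta0 K₀ D₀ L k) γ →
      (∀ᶠ α : ℝ in atTop, IsFavourable K₀ D₀ (Delta K₀ D₀ L α α) γ) ∧
      ∀ θ₀ fN gN : ℝ → ℝ, IntegrableOn θ₀ (Ioo 0 L) → IsBoundaryData fN → IsBoundaryData gN →
        ∀ x ∈ Ioo 0 L, ∀ t, 0 < t →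
          Tendsto (fun α : ℝ => representation K₀ D₀ L θ₀ (-(Complex.I / Real.pi)) γ
              (integrandRR K₀ D₀ L α α θ₀ (fun τ => -α * fN τ) (fun τ => -α * gN τ) x t) x t)
            atTop
            (𝓝 (representation K₀ D₀ L θ₀ (1 / Real.pi) γ
              (integrandNN K₀ D₀ L θ₀ fN gN x t) x t))) := by
  have hnt : ∀ α β : ℝ, BdryCoeff.Nontrivial ⟨1, α, 1, β⟩ := fun α β =>
    ⟨Or.inl one_ne_zero, Or.inl one_ne_zero⟩
  have hRR : ∀ (α β : ℝ) (θ₀ f g : ℝ → ℝ) (θ : ℝ → ℝ → ℝ), IsSolution K₀ D₀ L θ₀ θ →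
      IsBoundaryData f → IsBoundaryData g →
      (∀ t, 0 < t → θ 0 t - α * dx L θ 0 t = f t) →
      (∀ t, 0 < t → θ L t - β * dx L θ L t = g t) →
      ∀ γ, IsFavourable K₀ D₀ (Delta K₀ D₀ L α β) γ →
        IsRepresentedBy K₀ D₀ L θ₀ θ (-(Complex.I / Real.pi)) γ
          (integrandRR K₀ D₀ L α β θ₀ f g) := by
    intro α β θ₀ f g θ hθ hf hg hbf hbg γ hγ
    rw [Delta_eq] at hγ
    have h := hθ.isRepresentedBy hD (hnt α β) hγ hf hg (fun τ hτ => by simpa using hbf τ hτ)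
      fun τ hτ => by simpa using hbg τ hτ
    intro x hx t ht
    rw [integrandRR_eq]
    exact h x hx t ht
  refine ⟨fun α β => ⟨?_, fun h => isFavourable_boundaryDPlus hD (Delta_fixed α β) h⟩, hRR, ?_, ?_,
    fun α θ₀ f g x t => ⟨integrandRR_zero_right α θ₀ f g x t, integrandRR_zero θ₀ f g x t⟩, ?_, ?_, ?_⟩
  · rw [Delta_eq]
    exact exists_favourable hD hL (hnt α β)
  · intro α θ₀ f g θ hθ hf hg hbf hbg γ hγ x hx t ht
    rw [DeltaRD_eq] at hγ
    have h := hRR α 0 θ₀ f g θ hθ hf hg hbf (fun τ hτ => by simpa using hbg τ hτ) γ hγ x hx t ht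
    rwa [integrandRR_zero_right] at h
  · intro θ₀ f g θ hθ hf hg hbf hbg γ hγ x hx t ht
    rw [Delta0_eq] at hγ
    have h := hRR 0 0 θ₀ f g θ hθ hf hg (fun τ hτ => by simpa using hbf τ hτ)
      (fun τ hτ => by simpa using hbg τ hτ) γ hγ x hx t ht
    rwa [integrandRR_zero] at h
  · obtain ⟨γ, hγ⟩ := exists_favourable (K₀ := K₀) hD hL neumann_nontrivial
    exact ⟨γ, isFavourable_neumann_iff.1 hγ⟩
  · intro θ₀ fN gN θ hθ hf hg hbf hbg γ hγ x hx t ht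
    obtain ⟨h1, h2, h3⟩ := hθ.isRepresentedBy hD neumann_nontrivial (isFavourable_neumann_iff.2 hγ)
      (f := fun τ => -fN τ) (g := fun τ => -gN τ) (fun T hT => (hf T hT).neg)
      (fun T hT => (hg T hT).neg) (fun τ hτ => by simp [neumann, hbf τ hτ])
      (fun τ hτ => by simp [neumann, hbg τ hτ]) x hx t ht
    refine ⟨h1, ?_, ?_⟩
    · rw [pullback_integrandNN]
      exact h2.const_mul _
    · rw [representation_integrandNN, h3]
  · intro γ hγ
    have hγ' := isFavourable_neumann_iff.2 hγ
    exact ⟨favourable_nearby_neumann hL hγ', fun θ₀ fN gN hθ hf hg x hx t ht =>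
      tendsto_representation_neumann hD hγ' hθ hf hg hx ht⟩
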